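/- **Setting.** Let $d_x,d_u\ge 1$ and consider the linear system $x_{t+1}=A_\star x_t+B_\star u_t+w_t$, $x_0=0$, with states in $\mathbb R^{d_x}$, actions in $\mathbb R^{d_u}$ and costs $c_t=x_t^{\mathsf T}Qx_t+u_t^{\mathsf T}Ru_t$. The noise terms $w_t$ are i.i.d. with $\mathbb E w_t=0$, $\|w_t\|\le W$ and $\mathbb E w_tw_t^{\mathsf T}\succ\sigma^2 I$, where $\sigma,W>0$. Let $0\prec Q,R\preceq I$, and let $\alpha_0>0$, $\psi\ge1$, $\nu>0$ satisfy $\|Q^{-1}\|,\|R^{-1}\|\le 1/\alpha_0$ and $\|B_\star\|\le\psi$. For $K\in\mathbb R^{d_u\times d_x}$ let $$J(K)=\lim_{n\to\infty}\frac1n\,\mathbb E\Big[\sum_{t=1}^n x_t^{\mathsf T}(Q+K^{\mathsf T}RK)x_t\Big]\in[0,\infty],$$ where $x_0=0$ and $u_t=Kx_t$ for all $t$. Let $K_0$ be a controller with $J(K_0)\le\nu/4$. **Algorithm and parameters.** Let $T\ge1$ be an integer and $\delta\in(0,1)$. Put $$\kappa=\sqrt{\frac{\nu}{\alpha_0\sigma^2}},\quad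 \eta=\frac{\alpha_0}{128\,\nu\psi^2\kappa^{10}},\quad \mu=\frac{4\nu}{\kappa^4},\quad \tau=\big\lceil 2\kappa^2\log(7\kappa T)\big\rceil,\quad r_0=\frac{\alpha_0}{448\sqrt{d_x}\,\psi^2\kappa^{10}},$$ $$\sqrt{\bar m_0}=\frac{2^{17}d_ud_x^{3/2}\psi^2\kappa^{20}W^2}{\alpha_0\sigma^2}\sqrt{\log\frac{240T^4}{\delta}},\quad r_j=r_0\Big(1-\frac{\mu\eta}3\Big)^{j/2},\quad m_j=\Big\lceil \bar m_0\Big(1-\frac{\mu\eta}3\Big)^{-2j}\Big\rceil .$$ The algorithm starts in the state $x_0=0$ and proceeds in epochs $j=0,1,2,\dots$. In epoch $j$, for $i=1,\dots,m_j$, it draws $G_{j,i}\in\mathbb R^{d_u\times d_x}$ with i.i.d. $\mathcal N(0,1)$ entries, jointly independent over all $(j,i)$ and independent of the noise; it sets $U_{j,i}=G_{j,i}/\|G_{j,i}\|_F$ and plays $u=K_{j,i}x$ with $K_{j,i}=K_j+r_jU_{j,i}$ for $\tau$ consecutive rounds, continuing from the current state and incurring the costs $c_{j,i,1},\dots,c_{j,i,\tau}$.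 At the end of the epoch it sets $$K_{j+1}=K_j-\eta\,\frac{d_xd_u}{m_jr_j}\sum_{i=1}^{m_j}c_{j,i,\tau}\,U_{j,i}.$$ **Lemma 4 (indirect exploration cost).** There is a universal constant $C>0$ such that, in the above setting, for every epoch $j\ge0$ with $m_j\le T$, with probability at least $1-\frac{\delta}{4T}$ all $J(K_{j,i})$, $1\le i\le m_j$, are finite and $$\sum_{i=1}^{m_j}\sum_{s=1}^{\tau}\big(c_{j,i,s}-J(K_{j,i})\big)\le C\left(\frac{\nu\kappa^8W^2}{\sigma^2}\,\tau\sqrt{m_j\log\frac T\delta}+\frac{d_x\nu\psi^2\kappa^{10}}{\alpha_0}\,m_jr_j^2\right).$$ -/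

import Mathlib

open MeasureTheory ProbabilityTheory Filter
open scoped ENNReal Matrix Matrix.Norms.L2Operator

noncomputable section

namespace LQR

/-- The matrices of a linear quadratic regulator with states in `ℝ^dx` and actions in `ℝ^du`. -/
structure System (dx du : ℕ) where
  A : Matrix (Fin dx) (Fin dx) ℝ
  B : Matrix (Fin dx) (Fin du) ℝ
  Q : Matrix (Fin dx) (Fin dx) ℝ
  R : Matrix (Fin du) (Fin du) ℝ

/-- A linear controller `u = K x`. -/
abbrev Controller (dx du : ℕ) := Matrix (Fin du) (Fin dx) ℝ

namespace System

variable {dx du : ℕ} (S : System dx du)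

/-- The state after `s` rounds of playing the fixed controller `K` from the state `x` with noise
sequence `w`: `x_{s+1} = A x_s + B (K x_s) + w_s`. -/
def rollout (K : Controller dx du) (x : Fin dx → ℝ) (w : ℕ → Fin dx → ℝ) : ℕ → Fin dx → ℝ
  | 0 => x
  | s + 1 => S.A *ᵥ rollout K x w s + S.B *ᵥ (K *ᵥ rollout K x w s) + w s

/-- The instantaneous cost `xᵀ Q x + uᵀ R u` of the action `u` in the state `x`. -/
def cost (x : Fin dx → ℝ) (u : Fin du → ℝ) : ℝ :=
  x ⬝ᵥ S.Q *ᵥ x + u ⬝ᵥ S.R *ᵥ u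

/-- The infinite horizon expected cost
`J(K) = lim_n (1/n) E[∑_{t=1}^n x_tᵀ (Q + Kᵀ R K) x_t]`, with `x_0 = 0` and `u_t = K x_t`, as an
extended nonnegative real (`∞` for a controller that does not stabilize the system).
For centered i.i.d. square-integrable noise and positive semidefinite `Q`, `R`, the expected cost at
time `t` is nondecreasing in `t`, so that the averages converge in `[0, ∞]` and the upper limit is
the limit. -/
def J {Ω : Type*} [MeasurableSpace Ω] (P : Measure Ω) (w : ℕ → Ω → Fin dx → ℝ)
    (K : Controller dx du) : ℝ≥0∞ :=
  limsup (fun n : ℕ =>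
    (∫⁻ ω, ENNReal.ofReal (∑ t ∈ Finset.Icc 1 n,
      S.rollout K 0 (fun t => w t ω) t ⬝ᵥ
        (S.Q + Kᵀ * S.R * K) *ᵥ S.rollout K 0 (fun t => w t ω) t) ∂P) / (n : ℝ≥0∞)) atTop

end System

/-- The noise terms are i.i.d., centered, bounded by `W` in Euclidean norm, and their covariance
matrix is larger than `σ² I` in the Loewner order. -/
structure IsNoise {Ω : Type*} [MeasurableSpace Ω] (P : Measure Ω) {dx : ℕ}
    (w : ℕ → Ω → Fin dx → ℝ) (σ W : ℝ) : Prop where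
  measurable : ∀ t, Measurable (w t)
  indep : iIndepFun w P
  ident : ∀ t, IdentDistrib (w t) (w 0) P P
  mean_zero : ∀ t a, ∫ ω, w t ω a ∂P = 0
  bounded : ∀ t, ∀ᵐ ω ∂P, ‖WithLp.toLp 2 (w t ω)‖ ≤ W
  cov : (Matrix.of (fun a b => ∫ ω, w 0 ω a * w 0 ω b ∂P)
    - σ ^ 2 • (1 : Matrix (Fin dx) (Fin dx) ℝ)).PosDef

/-- The exploration matrices, indexed by epoch and sub-epoch, have i.i.d. standard Gaussian
entries. -/
structure IsGaussianExploration {Ω : Type*} [MeasurableSpace Ω] (P : Measure Ω) {dx du : ℕ}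
    (G : ℕ → ℕ → Ω → Controller dx du) : Prop where
  measurable : ∀ j i a b, Measurable (fun ω => G j i ω a b)
  indep : iIndepFun
    (fun (q : ℕ × ℕ × Fin du × Fin dx) ω => G q.1 q.2.1 ω q.2.2.1 q.2.2.2) P
  law : ∀ j i a b, P.map (fun ω => G j i ω a b) = gaussianReal 0 1

/-- Parameters of the policy gradient algorithm; sub-epochs, rounds and epochs are counted
from `0`. -/
structure AlgParams where
  /-- step size -/
  η : ℝ
  /-- number of rounds for which each perturbed controller is played -/
  τ : ℕ
  /-- exploration radius in epoch `j` -/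
  r : ℕ → ℝ
  /-- number of sub-epochs of epoch `j` -/
  m : ℕ → ℕ

/-- The Frobenius norm. -/
def frob {dx du : ℕ} (M : Controller dx du) : ℝ := √(∑ a, ∑ b, M a b ^ 2)

/-- What the algorithm carries from one epoch to the next: the underlying controller, the current
state and the number of rounds played so far. -/
structure EpochStart (dx du : ℕ) where
  K : Controller dx du
  x : Fin dx → ℝ
  t : ℕ

section Algorithm

variable {dx du : ℕ} (S : System dx du) (p : AlgParams) (K₀ : Controller dx du)
  (w : ℕ → Fin dx → ℝ) (G : ℕ → ℕ → Controller dx du)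

/-- The direction `u_{j,i}`, the exploration matrix normalized to the unit Frobenius sphere. -/
def direction (j i : ℕ) : Controller dx du := (frob (G j i))⁻¹ • G j i

/-- The perturbed controller played in sub-epoch `i` of epoch `j`, around the controller `K`. -/
def perturbed (K : Controller dx du) (j i : ℕ) : Controller dx du :=
  K + p.r j • direction G j i

/-- The state at the beginning of sub-epoch `i` of epoch `j`. -/
def subStart (e : EpochStart dx du) (j : ℕ) : ℕ → Fin dx → ℝ
  | 0 => e.x
  | i + 1 => S.rollout (perturbed p G e.K j i) (subStart e j i)
      (fun s => w (e.t + i * p.τ + s)) p.τ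

/-- The state in round `s` of sub-epoch `i` of epoch `j`. -/
def subState (e : EpochStart dx du) (j i s : ℕ) : Fin dx → ℝ :=
  S.rollout (perturbed p G e.K j i) (subStart S p w G e j i)
    (fun s => w (e.t + i * p.τ + s)) s

/-- The cost incurred in round `s` of sub-epoch `i` of epoch `j`. -/
def subCost (e : EpochStart dx du) (j i s : ℕ) : ℝ :=
  S.cost (subState S p w G e j i s) (perturbed p G e.K j i *ᵥ subState S p w G e j i s)

/-- The one-point gradient estimate of epoch `j`, from the costs of the final rounds. -/
def gradEstimate (e : EpochStart dx du) (j : ℕ) : Controller dx du :=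
  (((dx : ℝ) * du) / (p.m j * p.r j)) •
    ∑ i ∈ Finset.range (p.m j), subCost S p w G e j i (p.τ - 1) • direction G j i

/-- The run of the algorithm at the beginning of epoch `j`. -/
def epoch : ℕ → EpochStart dx du
  | 0 => ⟨K₀, 0, 0⟩
  | j + 1 =>
    { K := (epoch j).K - p.η • gradEstimate S p w G (epoch j) j
      x := subStart S p w G (epoch j) j (p.m j)
      t := (epoch j).t + p.m j * p.τ }

/-- The controller `K_{j,i}` played in sub-epoch `i` of epoch `j` of the run. -/
def playedController (j i : ℕ) : Controller dx du :=
  perturbed p G (epoch S p K₀ w G j).K j i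

/-- The cost `c_{j,i,s}` incurred in round `s` of sub-epoch `i` of epoch `j` of the run. -/
def realizedCost (j i s : ℕ) : ℝ :=
  subCost S p w G (epoch S p K₀ w G j) j i s

end Algorithm

/-- `κ = √(ν / (α₀ σ²))`. -/
def kappa (α₀ ν σ : ℝ) : ℝ := √(ν / (α₀ * σ ^ 2))

/-- The decay factor `1 - μ η / 3` for given step size `η` and `μ = 4 ν / κ⁴`. -/
def decay (α₀ ν σ η : ℝ) : ℝ := 1 - (4 * ν / kappa α₀ ν σ ^ 4) * η / 3

/-- The tuning of the algorithm. The mixing length and the numbers of sub-epochs, which have to be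
integers, are rounded up. -/
def tuning (dx du : ℕ) (α₀ ψ ν σ W δ : ℝ) (T : ℕ) : AlgParams :=
  let κ := kappa α₀ ν σ
  let η := α₀ / (128 * ν * ψ ^ 2 * κ ^ 10)
  let ρ := decay α₀ ν σ η
  let r₀ := α₀ / (448 * √dx * ψ ^ 2 * κ ^ 10)
  let m₀ := (2 ^ 17 * du * (dx : ℝ) ^ (3 / 2 : ℝ) * ψ ^ 2 * κ ^ 20 * W ^ 2 / (α₀ * σ ^ 2)
    * √(Real.log (240 * T ^ 4 / δ))) ^ 2
  { η := η
    τ := ⌈2 * κ ^ 2 * Real.log (7 * κ * T)⌉₊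
    r := fun j => r₀ * ρ ^ ((j : ℝ) / 2)
    m := fun j => ⌈m₀ * ρ ^ (-2 * (j : ℤ))⌉₊ }

end LQR

end

/-! Write `P_K` for the value matrix of a stable controller `K`, the solution of the Lyapunov
equation of its closed loop with the stage cost as source, and `Σ_K` for its stationary state
covariance. By the Bellman equation the expected excess cost of one sub-epoch telescopes
(`sum_expQuad_stageCost`): it is the form `P_{K_i}` at the initial state minus its expectation at
the final state. Across sub-epochs this no longer telescopes, because the final state of one
sub-epoch meets the value matrix of the next perturbed controller. These matrices differ by order
`r`, so a direct estimate would give `m r` where `m r²` is claimed.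

The remedy is a common potential `xᵀ M x`, where `M` is the mean of `P_{K+rU}` over the random
direction `U` (`averageValue`). Its change is added to the excess cost of each sub-epoch
(`blockExcess`). Over an epoch the potential telescopes to two boundary terms. The conditional mean
of the compensated excess has two parts. The form `P_{K_i} - M` at the initial state averages to
zero, since that state is independent of the new direction. The form `M - P_{K_i}` at the final
state is, up to an exponentially small mixing error, `tr((M - P_{K_i}) Σ_{K_i})`. Replacing
`Σ_{K_i}` by `Σ_K` costs a product of two quantities of order `r`, and `tr((M - P_{K_i}) Σ_K)` again
averages to zero. This is `expQuad_averageValue_sub_le` and `integral_blockExcess_le`. Azuma's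
inequality then bounds the fluctuation over the epoch by a multiple of `τ √m`.

All this presupposes that every sub-epoch starts in `goodStart`: a base controller of cost at most
`ν/2` and a state of controlled size. The state is kept small by the contraction of `xᵀ P_K x` over
`τ` rounds. The controller is kept good by induction on the epochs. The gradient estimate has a
fluctuation (a dimension-free Azuma inequality, `azuma_norm`), a smoothing bias
(`norm_onePoint_sub_le`, from the almost-linearity of the cost near `K`) and a mixing error. The
tuning bounds their sum in epoch `k` by a multiple of `√(ρ^k)`, so an inexact gradient step raises
the cost by at most a multiple of `ρ^k` (`descent`), and these increases sum to at most `ν/4`. No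
gradient domination is used, since the cost need not decrease.

Conditional expectations are avoided. Within an epoch the run is a chain whose state is a function
of the past and whose innovation, the noise and direction of one sub-epoch, is independent of the
past (`IsChain`). Bounds are proved for each frozen state and transferred by Fubini. There are at
most `j + 1` bad events, each of probability at most `δ / (240 T⁴)`, and `m_j ≤ T` forces `j ≤ T`.
-/

noncomputable section

namespace LQR

/-! ### Quadratic forms, traces and operator norms -/

section MatrixBasics

variable {m n : ℕ}

/-- The Euclidean norm of a coordinate vector. -/
def euc (x : Fin n → ℝ) : ℝ := ‖WithLp.toLp 2 x‖

lemma euc_nonneg (x : Fin n → ℝ) : 0 ≤ euc x := norm_nonneg _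

lemma euc_sq (x : Fin n → ℝ) : euc x ^ 2 = x ⬝ᵥ x := by
  rw [euc, EuclideanSpace.real_norm_sq_eq]
  simp [dotProduct, sq]

lemma dot_self_nonneg (x : Fin n → ℝ) : 0 ≤ x ⬝ᵥ x := by rw [← euc_sq]; positivity

lemma euc_add_le (x y : Fin n → ℝ) : euc (x + y) ≤ euc x + euc y := by
  simpa [euc] using norm_add_le (WithLp.toLp 2 x) (WithLp.toLp 2 y)

lemma abs_dot_le (x y : Fin n → ℝ) : |x ⬝ᵥ y| ≤ euc x * euc y := by
  have h := abs_real_inner_le_norm (WithLp.toLp 2 x) (WithLp.toLp 2 y)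
  simpa [euc, PiLp.inner_apply, dotProduct, mul_comm] using h

lemma euc_mulVec_le (M : Matrix (Fin m) (Fin n) ℝ) (x : Fin n → ℝ) :
    euc (M *ᵥ x) ≤ ‖M‖ * euc x :=
  M.l2_opNorm_mulVec (WithLp.toLp 2 x)

lemma abs_bilin_le (M : Matrix (Fin m) (Fin n) ℝ) (x : Fin m → ℝ) (y : Fin n → ℝ) :
    |x ⬝ᵥ M *ᵥ y| ≤ ‖M‖ * (euc x * euc y) :=
  (abs_dot_le _ _).trans (by
    nlinarith [mul_le_mul_of_nonneg_left (euc_mulVec_le M y) (euc_nonneg x)])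

lemma abs_quad_le (M : Matrix (Fin n) (Fin n) ℝ) (x : Fin n → ℝ) :
    |x ⬝ᵥ M *ᵥ x| ≤ ‖M‖ * (x ⬝ᵥ x) := by
  simpa [← euc_sq, sq] using abs_bilin_le M x x

lemma mulVec_dot_mulVec_le (M : Matrix (Fin m) (Fin n) ℝ) (x : Fin n → ℝ) :
    (M *ᵥ x) ⬝ᵥ (M *ᵥ x) ≤ ‖M‖ ^ 2 * (x ⬝ᵥ x) := by
  rw [← euc_sq, ← euc_sq, ← mul_pow]
  exact pow_le_pow_left₀ (euc_nonneg _) (euc_mulVec_le M x) 2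

lemma norm_le_of_euc {c : ℝ} (hc : 0 ≤ c) (M : Matrix (Fin m) (Fin n) ℝ)
    (h : ∀ x, euc (M *ᵥ x) ≤ c * euc x) : ‖M‖ ≤ c := by
  rw [Matrix.l2_opNorm_def]
  exact ContinuousLinearMap.opNorm_le_bound _ hc fun x => h (WithLp.ofLp x)

lemma norm_le_of_dot {c : ℝ} (hc : 0 ≤ c) (M : Matrix (Fin m) (Fin n) ℝ)
    (h : ∀ x, (M *ᵥ x) ⬝ᵥ (M *ᵥ x) ≤ c ^ 2 * (x ⬝ᵥ x)) : ‖M‖ ≤ c := by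
  refine norm_le_of_euc hc M fun x => ?_
  refine le_of_sq_le_sq ?_ (mul_nonneg hc (euc_nonneg x))
  simpa [mul_pow, euc_sq] using h x

/-- Test with `x = M *ᵥ y` and cancel one factor of the norm of `M *ᵥ y`. -/
lemma norm_le_of_bilin {c : ℝ} (hc : 0 ≤ c) (M : Matrix (Fin m) (Fin n) ℝ)
    (h : ∀ x y, x ⬝ᵥ M *ᵥ y ≤ c * (euc x * euc y)) : ‖M‖ ≤ c := by
  refine norm_le_of_euc hc M fun y => ?_
  have h1 := h (M *ᵥ y) y
  rw [← euc_sq] at h1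
  rcases (euc_nonneg (M *ᵥ y)).eq_or_lt with h0 | h0
  · rw [← h0]; exact mul_nonneg hc (euc_nonneg y)
  · exact le_of_mul_le_mul_left (by nlinarith) h0

lemma norm_transpose_eq (M : Matrix (Fin m) (Fin n) ℝ) : ‖Mᵀ‖ = ‖M‖ := by
  rw [← Matrix.conjTranspose_eq_transpose_of_trivial, Matrix.l2_opNorm_conjTranspose]

lemma dot_mulVec_comm (M : Matrix (Fin m) (Fin n) ℝ) (x : Fin m → ℝ) (y : Fin n → ℝ) :
    x ⬝ᵥ M *ᵥ y = (Mᵀ *ᵥ x) ⬝ᵥ y := by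
  rw [Matrix.dotProduct_mulVec, Matrix.mulVec_transpose]

lemma quad_conj (M : Matrix (Fin m) (Fin n) ℝ) (P : Matrix (Fin m) (Fin m) ℝ) (x y : Fin n → ℝ) :
    x ⬝ᵥ (Mᵀ * P * M) *ᵥ y = (M *ᵥ x) ⬝ᵥ P *ᵥ (M *ᵥ y) := by
  rw [← Matrix.mulVec_mulVec, ← Matrix.mulVec_mulVec, dot_mulVec_comm Mᵀ, Matrix.transpose_transpose]

lemma trace_transpose_mul_self_eq_sum (M : Matrix (Fin m) (Fin n) ℝ) :
    (Mᵀ * M).trace = ∑ i, (M *ᵥ Pi.single i 1) ⬝ᵥ (M *ᵥ Pi.single i 1) := by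
  simp [Matrix.trace, Matrix.mul_apply, dotProduct]

lemma posSemidef_quad_nonneg {P : Matrix (Fin n) (Fin n) ℝ} (hP : P.PosSemidef) (x : Fin n → ℝ) :
    0 ≤ x ⬝ᵥ P *ᵥ x := by simpa using hP.dotProduct_mulVec_nonneg x

lemma posSemidef_transpose_eq {P : Matrix (Fin n) (Fin n) ℝ} (hP : P.PosSemidef) : Pᵀ = P := by
  have := hP.isHermitian
  rwa [Matrix.IsHermitian, Matrix.conjTranspose_eq_transpose_of_trivial] at this

lemma posSemidef_of_quad {P : Matrix (Fin n) (Fin n) ℝ} (hs : Pᵀ = P)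
    (h : ∀ x, 0 ≤ x ⬝ᵥ P *ᵥ x) : P.PosSemidef := by
  refine Matrix.PosSemidef.of_dotProduct_mulVec_nonneg ?_ (by simpa using h)
  rw [Matrix.IsHermitian, Matrix.conjTranspose_eq_transpose_of_trivial, hs]

open scoped MatrixOrder in
-- With this factorization, Cauchy–Schwarz in the form `P` is the Euclidean inequality for images
-- under `C`, and traces against `P` are sums over the rows of `C`.
lemma posSemidef_exists_sqrt {P : Matrix (Fin n) (Fin n) ℝ} (hP : P.PosSemidef) :
    ∃ C : Matrix (Fin n) (Fin n) ℝ, P = Cᵀ * C := by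
  obtain ⟨C, hC⟩ := CStarAlgebra.nonneg_iff_eq_star_mul_self.mp hP.nonneg
  refine ⟨C, ?_⟩
  rw [hC, Matrix.star_eq_conjTranspose, Matrix.conjTranspose_eq_transpose_of_trivial]

lemma posSemidef_cauchy_schwarz {P : Matrix (Fin n) (Fin n) ℝ} (hP : P.PosSemidef)
    (x y : Fin n → ℝ) :
    x ⬝ᵥ P *ᵥ y ≤ √(x ⬝ᵥ P *ᵥ x) * √(y ⬝ᵥ P *ᵥ y) := by
  obtain ⟨C, rfl⟩ := posSemidef_exists_sqrt hP
  have h : ∀ u v : Fin n → ℝ, u ⬝ᵥ (Cᵀ * C) *ᵥ v = (C *ᵥ u) ⬝ᵥ (C *ᵥ v) := fun u v => by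
    rw [← Matrix.mulVec_mulVec, dot_mulVec_comm, Matrix.transpose_transpose]
  rw [h, h, h, ← euc_sq, ← euc_sq, Real.sqrt_sq (euc_nonneg _), Real.sqrt_sq (euc_nonneg _)]
  exact (le_abs_self _).trans (abs_dot_le _ _)

/-- Turns pointwise bounds on a quadratic form into bounds on its trace against a positive
semidefinite matrix, with no symmetry of `G`. -/
lemma trace_mul_sqrt (G C : Matrix (Fin n) (Fin n) ℝ) :
    (G * (Cᵀ * C)).trace = ∑ i, (C i) ⬝ᵥ G *ᵥ (C i) := by
  rw [← Matrix.mul_assoc, Matrix.trace_mul_comm, Matrix.trace]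
  refine Finset.sum_congr rfl fun i _ => ?_
  simp only [Matrix.diag, Matrix.mul_apply, dotProduct, Matrix.mulVec, Matrix.transpose_apply]

lemma trace_sqrt (C : Matrix (Fin n) (Fin n) ℝ) :
    (Cᵀ * C).trace = ∑ i, (C i) ⬝ᵥ (C i) := by
  simpa using trace_mul_sqrt 1 C

lemma trace_mul_le_of_quad {G H X : Matrix (Fin n) (Fin n) ℝ} (hX : X.PosSemidef)
    (h : ∀ x, x ⬝ᵥ G *ᵥ x ≤ x ⬝ᵥ H *ᵥ x) : (G * X).trace ≤ (H * X).trace := by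
  obtain ⟨C, rfl⟩ := posSemidef_exists_sqrt hX
  rw [trace_mul_sqrt, trace_mul_sqrt]
  exact Finset.sum_le_sum fun i _ => h _

lemma trace_mul_nonneg {G X : Matrix (Fin n) (Fin n) ℝ} (hX : X.PosSemidef)
    (h : ∀ x, 0 ≤ x ⬝ᵥ G *ᵥ x) : 0 ≤ (G * X).trace := by
  simpa using trace_mul_le_of_quad (G := 0) (H := G) hX (by simpa using h)

lemma trace_mul_ge {G X : Matrix (Fin n) (Fin n) ℝ} {c : ℝ} (hX : X.PosSemidef)
    (h : ∀ x, c * (x ⬝ᵥ x) ≤ x ⬝ᵥ G *ᵥ x) : c * X.trace ≤ (G * X).trace := by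
  have := trace_mul_le_of_quad (G := c • 1) (H := G) hX
    (by simpa [Matrix.smul_mulVec, dotProduct_smul] using h)
  simpa using this

lemma abs_trace_mul_le (G : Matrix (Fin n) (Fin n) ℝ) {X : Matrix (Fin n) (Fin n) ℝ}
    (hX : X.PosSemidef) : |(G * X).trace| ≤ ‖G‖ * X.trace := by
  obtain ⟨C, rfl⟩ := posSemidef_exists_sqrt hX
  rw [trace_mul_sqrt, trace_sqrt, Finset.mul_sum]
  exact (Finset.abs_sum_le_sum_abs _ _).trans (Finset.sum_le_sum fun i _ => abs_quad_le G _)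

lemma trace_mul_transpose_symm {X : Matrix (Fin n) (Fin n) ℝ} (hX : Xᵀ = X)
    (G : Matrix (Fin n) (Fin n) ℝ) : (Gᵀ * X).trace = (G * X).trace := by
  rw [← Matrix.trace_transpose, Matrix.transpose_mul, Matrix.transpose_transpose, hX,
    Matrix.trace_mul_comm]

/-- Cauchy–Schwarz for each row of a square root; it stands in for bounding the largest eigenvalue
by the trace. -/
lemma quad_le_trace {P : Matrix (Fin n) (Fin n) ℝ} (hP : P.PosSemidef) (x : Fin n → ℝ) :
    x ⬝ᵥ P *ᵥ x ≤ P.trace * (x ⬝ᵥ x) := by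
  obtain ⟨C, rfl⟩ := posSemidef_exists_sqrt hP
  rw [trace_sqrt, ← Matrix.mulVec_mulVec, dot_mulVec_comm, Matrix.transpose_transpose,
    Finset.sum_mul]
  refine Finset.sum_le_sum fun i _ => ?_
  have h := abs_dot_le (C i) x
  have h2 : (C *ᵥ x) i = C i ⬝ᵥ x := rfl
  rw [h2, ← euc_sq, ← euc_sq, ← mul_pow, ← sq, ← sq_abs]
  exact pow_le_pow_left₀ (abs_nonneg _) h 2

/-- The trace inner product is dominated by the Frobenius norms. -/
lemma frob_sq {dx du : ℕ} (M : Controller dx du) : frob M ^ 2 = (Mᵀ * M).trace := by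
  rw [frob, Real.sq_sqrt (by positivity), Finset.sum_comm]
  simp [Matrix.trace, Matrix.mul_apply, sq]

lemma frob_nonneg {dx du : ℕ} (M : Controller dx du) : 0 ≤ frob M := Real.sqrt_nonneg _

lemma norm_le_sqrt_trace (M : Matrix (Fin m) (Fin n) ℝ) : ‖M‖ ^ 2 ≤ (Mᵀ * M).trace := by
  have h0 : 0 ≤ (Mᵀ * M).trace := by
    rw [trace_transpose_mul_self_eq_sum]; exact Finset.sum_nonneg fun _ _ => dot_self_nonneg _
  have hps : (Mᵀ * M).PosSemidef := by
    have := Matrix.posSemidef_conjTranspose_mul_self M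
    rwa [Matrix.conjTranspose_eq_transpose_of_trivial] at this
  have h : ‖M‖ ≤ √((Mᵀ * M).trace) := by
    refine norm_le_of_dot (Real.sqrt_nonneg _) M fun x => ?_
    rw [Real.sq_sqrt h0]
    have := quad_le_trace hps x
    rwa [← Matrix.mulVec_mulVec, dot_mulVec_comm, Matrix.transpose_transpose] at this
  calc ‖M‖ ^ 2 ≤ √((Mᵀ * M).trace) ^ 2 := pow_le_pow_left₀ (norm_nonneg _) h 2
    _ = _ := Real.sq_sqrt h0

lemma norm_le_frob {dx du : ℕ} (M : Controller dx du) : ‖M‖ ≤ frob M := by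
  refine le_of_sq_le_sq ?_ (frob_nonneg M)
  rw [frob_sq]; exact norm_le_sqrt_trace M

end MatrixBasics

/-! ### Discrete Lyapunov equations and stability -/

section Lyapunov

variable {n : ℕ}

/-- Square summability of the powers; equivalent to spectral radius smaller than one. -/
def StableMat (A : Matrix (Fin n) (Fin n) ℝ) : Prop := Summable fun k : ℕ => ‖A ^ k‖ ^ 2

/-- The solution of the discrete Lyapunov equation `L = X + Aᵀ L A`. -/
def lyap (A X : Matrix (Fin n) (Fin n) ℝ) : Matrix (Fin n) (Fin n) ℝ :=
  ∑' k : ℕ, (A ^ k)ᵀ * X * A ^ k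

variable {A X Y P : Matrix (Fin n) (Fin n) ℝ}

lemma pow_succ_mulVec (A : Matrix (Fin n) (Fin n) ℝ) (k : ℕ) (x : Fin n → ℝ) :
    A ^ (k + 1) *ᵥ x = A *ᵥ (A ^ k *ᵥ x) := by
  rw [Matrix.mulVec_mulVec, pow_succ']

lemma euc_eq_zero {x : Fin n → ℝ} (h : euc x = 0) : x = 0 := by
  have h1 : WithLp.toLp 2 x = 0 := norm_eq_zero.mp h
  simpa using h1

lemma StableMat.transpose (hA : StableMat A) : StableMat Aᵀ := by
  refine hA.congr fun k => ?_
  rw [← Matrix.transpose_pow, norm_transpose_eq]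

lemma norm_conj_le (M X : Matrix (Fin n) (Fin n) ℝ) : ‖Mᵀ * X * M‖ ≤ ‖X‖ * ‖M‖ ^ 2 := by
  calc ‖Mᵀ * X * M‖ ≤ ‖Mᵀ‖ * ‖X‖ * ‖M‖ :=
        (norm_mul_le _ _).trans (mul_le_mul_of_nonneg_right (norm_mul_le _ _) (norm_nonneg _))
    _ = _ := by rw [norm_transpose_eq]; ring

lemma StableMat.summable (hA : StableMat A) (X : Matrix (Fin n) (Fin n) ℝ) :
    Summable fun k : ℕ => (A ^ k)ᵀ * X * A ^ k :=
  Summable.of_norm_bounded (g := fun k => ‖X‖ * ‖A ^ k‖ ^ 2) (hA.mul_left _)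
    fun _ => norm_conj_le _ _

lemma StableMat.hasSum (hA : StableMat A) (X : Matrix (Fin n) (Fin n) ℝ) :
    HasSum (fun k : ℕ => (A ^ k)ᵀ * X * A ^ k) (lyap A X) := (hA.summable X).hasSum

lemma StableMat.tendsto_norm (hA : StableMat A) :
    Tendsto (fun k : ℕ => ‖A ^ k‖ ^ 2) atTop (nhds 0) := hA.tendsto_atTop_zero

lemma StableMat.lyap_eq (hA : StableMat A) (X : Matrix (Fin n) (Fin n) ℝ) :
    lyap A X = X + Aᵀ * lyap A X * A := by
  have h2 : Aᵀ * lyap A X * A = ∑' k : ℕ, (A ^ (k + 1))ᵀ * X * A ^ (k + 1) := by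
    rw [lyap, ← (hA.summable X).tsum_mul_left, ← ((hA.summable X).mul_left Aᵀ).tsum_mul_right]
    refine tsum_congr fun k => ?_
    rw [pow_succ, Matrix.transpose_mul]
    simp only [Matrix.mul_assoc]
  rw [h2, lyap, (hA.summable X).tsum_eq_zero_add]
  simp

/-- Iterate the equation. The identity is exact for every `N` and needs no stability; its remainder
is what later measures mixing. -/
lemma eq_partial_add_of_fixed (h : Y = X + Aᵀ * Y * A) (N : ℕ) :
    Y = ∑ k ∈ Finset.range N, (A ^ k)ᵀ * X * A ^ k + (A ^ N)ᵀ * Y * A ^ N := by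
  induction N with
  | zero => simp
  | succ N ih =>
    have e : (A ^ N)ᵀ * Y * A ^ N
        = (A ^ N)ᵀ * X * A ^ N + (A ^ (N + 1))ᵀ * Y * A ^ (N + 1) := by
      conv_lhs => rw [h]
      rw [pow_succ' A N, Matrix.transpose_mul]
      simp only [Matrix.mul_add, Matrix.add_mul, Matrix.mul_assoc]
    rw [Finset.sum_range_succ, add_assoc, ← e]
    exact ih

/-- The remainder after `N` iterations is at most `‖Y‖ ‖A^N‖²`, which tends to zero. Differences of
value matrices and of covariances are identified through this uniqueness. -/
lemma StableMat.lyap_unique (hA : StableMat A) (h : Y = X + Aᵀ * Y * A) : Y = lyap A X := by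
  have h1 : Tendsto (fun N => ∑ k ∈ Finset.range N, (A ^ k)ᵀ * X * A ^ k + (A ^ N)ᵀ * Y * A ^ N)
      atTop (nhds (lyap A X + 0)) := by
    refine (hA.hasSum X).tendsto_sum_nat.add ?_
    refine squeeze_zero_norm (fun k => norm_conj_le _ _) ?_
    simpa using hA.tendsto_norm.const_mul ‖Y‖
  rw [add_zero] at h1
  refine tendsto_nhds_unique (tendsto_const_nhds.congr fun N => ?_) h1
  exact eq_partial_add_of_fixed h N

lemma StableMat.hasSum_trace (hA : StableMat A) (X Y : Matrix (Fin n) (Fin n) ℝ) :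
    HasSum (fun k : ℕ => ((A ^ k)ᵀ * X * A ^ k * Y).trace) ((lyap A X * Y).trace) :=
  ((hA.hasSum X).mul_right Y).map (Matrix.traceAddMonoidHom (Fin n) ℝ)
    (continuous_id.matrix_trace)

/-- Cyclicity of the trace, term by term: the Lyapunov operators of `A` and `Aᵀ` are adjoint. This
exchanges the value matrix and the stationary covariance. -/
lemma StableMat.trace_lyap_mul (hA : StableMat A) (X Y : Matrix (Fin n) (Fin n) ℝ) :
    (lyap A X * Y).trace = (X * lyap Aᵀ Y).trace := by
  have h1 := hA.hasSum_trace X Y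
  have h2 := hA.transpose.hasSum_trace Y X
  rw [Matrix.trace_mul_comm (lyap Aᵀ Y) X] at h2
  refine h1.unique (h2.congr_fun fun k => ?_)
  rw [← Matrix.transpose_pow, Matrix.transpose_transpose, Matrix.mul_assoc, Matrix.mul_assoc,
    Matrix.trace_mul_comm, Matrix.trace_mul_comm _ X]
  simp only [Matrix.mul_assoc]

lemma StableMat.hasSum_bilin (hA : StableMat A) (X : Matrix (Fin n) (Fin n) ℝ)
    (x y : Fin n → ℝ) :
    HasSum (fun k : ℕ => (A ^ k *ᵥ x) ⬝ᵥ X *ᵥ (A ^ k *ᵥ y)) (x ⬝ᵥ lyap A X *ᵥ y) := by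
  have h := (hA.hasSum X).map
    ({ toFun := fun M => x ⬝ᵥ M *ᵥ y, map_zero' := by simp,
       map_add' := fun M N => by simp [Matrix.add_mulVec, dotProduct_add] } :
      Matrix (Fin n) (Fin n) ℝ →+ ℝ)
    (continuous_const.dotProduct (continuous_id.matrix_mulVec continuous_const))
  exact h.congr_fun fun k => (quad_conj _ _ _ _).symm

lemma lyap_transpose (hX : Xᵀ = X) : (lyap A X)ᵀ = lyap A X := by
  rw [lyap, Matrix.transpose_tsum]
  refine tsum_congr fun k => ?_
  simp [Matrix.transpose_mul, hX, Matrix.mul_assoc]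

lemma StableMat.lyap_posSemidef (hA : StableMat A) (hX : X.PosSemidef) :
    (lyap A X).PosSemidef :=
  posSemidef_of_quad (lyap_transpose (posSemidef_transpose_eq hX)) fun x =>
    (hA.hasSum_bilin X x x).nonneg fun _ => posSemidef_quad_nonneg hX _

/-- Comparing the series for `X` with `a` times the identity bounds the sum of `‖A^k x‖²` by `c
‖x‖²`, and this controls the solution for every source `N`, symmetric or not, without a dimension
factor. -/
lemma StableMat.norm_lyap_le (hA : StableMat A) {a c : ℝ} (ha : 0 < a)
    (hX : ∀ x, a * (x ⬝ᵥ x) ≤ x ⬝ᵥ X *ᵥ x) (hc : 0 ≤ c)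
    (hL : ∀ x, x ⬝ᵥ lyap A X *ᵥ x ≤ a * c * (x ⬝ᵥ x)) (N : Matrix (Fin n) (Fin n) ℝ) :
    ‖lyap A N‖ ≤ c * ‖N‖ := by
  have hsum : ∀ x : Fin n → ℝ, Summable fun k : ℕ => euc (A ^ k *ᵥ x) ^ 2 := fun x =>
    Summable.of_nonneg_of_le (fun _ => sq_nonneg _)
      (fun k => by
        simp only [euc_sq]
        exact mulVec_dot_mulVec_le _ _) (hA.mul_right (x ⬝ᵥ x))
  have hle : ∀ x : Fin n → ℝ, ∑' k : ℕ, euc (A ^ k *ᵥ x) ^ 2 ≤ c * euc x ^ 2 := fun x => by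
    have h1 := ((hsum x).hasSum.mul_left a)
    have h2 := hasSum_le (fun k => by
      simp only [euc_sq]
      exact hX (A ^ k *ᵥ x)) h1 (hA.hasSum_bilin X x x)
    have h3 := h2.trans (hL x)
    rw [mul_assoc] at h3
    rw [euc_sq]
    exact le_of_mul_le_mul_left h3 ha
  refine norm_le_of_bilin (mul_nonneg hc (norm_nonneg _)) _ fun x y => ?_
  have key : ∀ x y : Fin n → ℝ, x ⬝ᵥ lyap A N *ᵥ y ≤ ‖N‖ * ((c * euc x ^ 2 + c * euc y ^ 2) / 2) := by
    intro x y
    have h1 := (((hsum x).hasSum.add (hsum y).hasSum).div_const 2).mul_left ‖N‖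
    refine (hasSum_le (fun k => ?_) (hA.hasSum_bilin N x y) h1).trans ?_
    · refine (le_abs_self _).trans ((abs_bilin_le _ _ _).trans ?_)
      refine mul_le_mul_of_nonneg_left ?_ (norm_nonneg _)
      nlinarith [sq_nonneg (euc (A ^ k *ᵥ x) - euc (A ^ k *ᵥ y))]
    · refine mul_le_mul_of_nonneg_left ?_ (norm_nonneg _)
      linarith [hle x, hle y]
  rcases (euc_nonneg x).eq_or_lt with hx | hx
  · simp [euc_eq_zero hx.symm, euc]
  rcases (euc_nonneg y).eq_or_lt with hy | hy
  · simp [euc_eq_zero hy.symm, euc]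
  -- Scaling both vectors to unit length turns the mean of the squared norms in `key` into the
  -- product of the norms.
  have h := key ((euc x)⁻¹ • x) ((euc y)⁻¹ • y)
  have he : ∀ z : Fin n → ℝ, 0 < euc z → euc ((euc z)⁻¹ • z) = 1 := fun z hz => by
    have : euc ((euc z)⁻¹ • z) = |(euc z)⁻¹| * euc z := by
      simp [euc, norm_smul]
    rw [this, abs_of_pos (inv_pos.mpr hz), inv_mul_cancel₀ hz.ne']
  rw [he x hx, he y hy, Matrix.mulVec_smul, dotProduct_smul, smul_dotProduct, smul_eq_mul,
    smul_eq_mul] at h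
  have h' := mul_le_mul_of_nonneg_left h (mul_pos hx hy).le
  calc x ⬝ᵥ lyap A N *ᵥ y
      = euc x * euc y * ((euc y)⁻¹ * ((euc x)⁻¹ * (x ⬝ᵥ lyap A N *ᵥ y))) := by
        field_simp
    _ ≤ _ := h'
    _ = _ := by ring

lemma partial_quad_le
    (h : ∀ x, x ⬝ᵥ X *ᵥ x + (A *ᵥ x) ⬝ᵥ P *ᵥ (A *ᵥ x) ≤ x ⬝ᵥ P *ᵥ x) (x : Fin n → ℝ) (N : ℕ) :
    ∑ k ∈ Finset.range N, (A ^ k *ᵥ x) ⬝ᵥ X *ᵥ (A ^ k *ᵥ x)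
      + (A ^ N *ᵥ x) ⬝ᵥ P *ᵥ (A ^ N *ᵥ x) ≤ x ⬝ᵥ P *ᵥ x := by
  induction N with
  | zero => simp
  | succ N ih =>
    have := h (A ^ N *ᵥ x)
    rw [← pow_succ_mulVec] at this
    rw [Finset.sum_range_succ]
    linarith

lemma stableMat_of_trace_bounded {c : ℝ}
    (h : ∀ N : ℕ, ∑ k ∈ Finset.range N, ‖A ^ k‖ ^ 2 ≤ c) : StableMat A :=
  summable_of_sum_range_le (fun _ => sq_nonneg _) h

/-- The Lyapunov criterion. -/
lemma stableMat_of_quad {a : ℝ} (ha : 0 < a) (hX : ∀ x, a * (x ⬝ᵥ x) ≤ x ⬝ᵥ X *ᵥ x)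
    (hP : ∀ x, 0 ≤ x ⬝ᵥ P *ᵥ x)
    (h : ∀ x, x ⬝ᵥ X *ᵥ x + (A *ᵥ x) ⬝ᵥ P *ᵥ (A *ᵥ x) ≤ x ⬝ᵥ P *ᵥ x) : StableMat A := by
  refine stableMat_of_trace_bounded (c := a⁻¹ * P.trace) fun N => ?_
  -- The operator norm is at most the Frobenius norm, so only the basis vectors need to be tested;
  -- summed over them, the form `P` gives its trace.
  have hb : ∀ k, ‖A ^ k‖ ^ 2 ≤ a⁻¹ * ∑ i, (A ^ k *ᵥ Pi.single i 1) ⬝ᵥ X *ᵥ (A ^ k *ᵥ Pi.single i 1) := by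
    intro k
    refine (norm_le_sqrt_trace _).trans ?_
    rw [trace_transpose_mul_self_eq_sum, Finset.mul_sum]
    refine Finset.sum_le_sum fun i _ => ?_
    rw [inv_mul_eq_div, le_div_iff₀ ha, mul_comm]
    exact hX _
  refine (Finset.sum_le_sum fun k _ => hb k).trans ?_
  rw [← Finset.mul_sum, Finset.sum_comm]
  refine mul_le_mul_of_nonneg_left ?_ (inv_pos.mpr ha).le
  refine Finset.sum_le_sum fun i _ => ?_
  have := partial_quad_le h (Pi.single i 1) N
  have h2 := hP (A ^ N *ᵥ Pi.single i 1)
  have h3 : (Pi.single i 1 : Fin n → ℝ) ⬝ᵥ P *ᵥ Pi.single i 1 = P.diag i := by simp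
  linarith

lemma StableMat.lyap_quad_le (hA : StableMat A) (hP : ∀ x, 0 ≤ x ⬝ᵥ P *ᵥ x)
    (h : ∀ x, x ⬝ᵥ X *ᵥ x + (A *ᵥ x) ⬝ᵥ P *ᵥ (A *ᵥ x) ≤ x ⬝ᵥ P *ᵥ x) (x : Fin n → ℝ) :
    x ⬝ᵥ lyap A X *ᵥ x ≤ x ⬝ᵥ P *ᵥ x := by
  refine le_of_tendsto' (hA.hasSum_bilin X x x).tendsto_sum_nat fun N => ?_
  have := partial_quad_le h x N
  linarith [hP (A ^ N *ᵥ x)]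

/-- Geometric decay of the powers in the norm given by a Lyapunov function. -/
lemma quad_pow_le {q : ℝ} (hq : 0 ≤ q)
    (h : ∀ x, (A *ᵥ x) ⬝ᵥ P *ᵥ (A *ᵥ x) ≤ q * (x ⬝ᵥ P *ᵥ x)) (x : Fin n → ℝ) (k : ℕ) :
    (A ^ k *ᵥ x) ⬝ᵥ P *ᵥ (A ^ k *ᵥ x) ≤ q ^ k * (x ⬝ᵥ P *ᵥ x) := by
  induction k with
  | zero => simp
  | succ k ih =>
    have := h (A ^ k *ᵥ x)
    rw [← pow_succ_mulVec] at this
    calc _ ≤ _ := this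
      _ ≤ q * (q ^ k * (x ⬝ᵥ P *ᵥ x)) := mul_le_mul_of_nonneg_left ih hq
      _ = _ := by ring

end Lyapunov

/-! ### Value matrix, stationary covariance and their a priori bounds -/

namespace System

variable {dx du : ℕ} (S : System dx du)

/-- The closed-loop matrix. -/
def closedLoop (K : Controller dx du) : Matrix (Fin dx) (Fin dx) ℝ := S.A + S.B * K

/-- The matrix of the cost incurred in one round under the controller `K`. -/
def stageCost (K : Controller dx du) : Matrix (Fin dx) (Fin dx) ℝ := S.Q + Kᵀ * S.R * K

/-- The matrix of the (relative) value function of the controller `K`. -/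
def value (K : Controller dx du) : Matrix (Fin dx) (Fin dx) ℝ :=
  lyap (S.closedLoop K) (S.stageCost K)

/-- The stationary covariance of the state under the controller `K`. -/
def statCov (V : Matrix (Fin dx) (Fin dx) ℝ) (K : Controller dx du) :
    Matrix (Fin dx) (Fin dx) ℝ := lyap (S.closedLoop K)ᵀ V

/-- The average cost of the controller `K` for noise of covariance `V`. -/
def avgCost (V : Matrix (Fin dx) (Fin dx) ℝ) (K : Controller dx du) : ℝ := (S.value K * V).trace

/-- The derivative of the advantage function in the action; `2 * advantage K * statCov V K` is the
gradient of the average cost. -/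
def advantage (K : Controller dx du) : Controller dx du :=
  S.R * K + S.Bᵀ * S.value K * S.closedLoop K

/-- The curvature of the advantage function in the action. -/
def curvature (K : Controller dx du) : Matrix (Fin du) (Fin du) ℝ :=
  S.R + S.Bᵀ * S.value K * S.B

/-- The controller `K` is stable, of average cost at most `c`. -/
def Fine (V : Matrix (Fin dx) (Fin dx) ℝ) (c : ℝ) (K : Controller dx du) : Prop :=
  StableMat (S.closedLoop K) ∧ S.avgCost V K ≤ c

/-- The standing assumptions on the system and the noise covariance `V`. -/
structure Bounds (V : Matrix (Fin dx) (Fin dx) ℝ) (a ψ ν σ κ : ℝ) : Prop where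
  a_pos : 0 < a
  a_le : a ≤ 1
  psi_ge : 1 ≤ ψ
  nu_pos : 0 < ν
  sigma_pos : 0 < σ
  kappa_ge : 2 ≤ κ
  kappa_eq : a * κ ^ 2 * σ ^ 2 = ν
  Q_psd : S.Q.PosSemidef
  R_psd : S.R.PosSemidef
  Q_ge : ∀ x, a * (x ⬝ᵥ x) ≤ x ⬝ᵥ S.Q *ᵥ x
  R_le : ∀ x, x ⬝ᵥ S.R *ᵥ x ≤ x ⬝ᵥ x
  B_le : ‖S.B‖ ≤ ψ
  V_psd : V.PosSemidef
  V_ge : ∀ x, σ ^ 2 * (x ⬝ᵥ x) ≤ x ⬝ᵥ V *ᵥ x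

variable {S} {V : Matrix (Fin dx) (Fin dx) ℝ} {a ψ ν σ κ c : ℝ} {K : Controller dx du}

lemma Fine.mono {c' : ℝ} (h : S.Fine V c K) (hc : c ≤ c') : S.Fine V c' K := ⟨h.1, h.2.trans hc⟩

lemma norm_le_of_psd {n : ℕ} {P : Matrix (Fin n) (Fin n) ℝ} {c : ℝ} (hP : P.PosSemidef) (hc : 0 ≤ c)
    (h : ∀ x, x ⬝ᵥ P *ᵥ x ≤ c * (x ⬝ᵥ x)) : ‖P‖ ≤ c := by
  refine norm_le_of_bilin hc P fun x y => (posSemidef_cauchy_schwarz hP x y).trans ?_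
  have h' : ∀ z, √(z ⬝ᵥ P *ᵥ z) ≤ √c * euc z := fun z => by
    refine Real.sqrt_le_iff.mpr ⟨by have := euc_nonneg z; positivity, ?_⟩
    rw [mul_pow, Real.sq_sqrt hc, euc_sq]
    exact h z
  calc _ ≤ (√c * euc x) * (√c * euc y) :=
        mul_le_mul (h' x) (h' y) (Real.sqrt_nonneg _) (by have := euc_nonneg x; positivity)
    _ = √c ^ 2 * (euc x * euc y) := by ring
    _ = _ := by rw [Real.sq_sqrt hc]

namespace Bounds

variable (h : S.Bounds V a ψ ν σ κ)
include h

lemma kappa_pos : 0 < κ := by linarith [h.kappa_ge]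

lemma psi_pos : 0 < ψ := by linarith [h.psi_ge]

omit h in
lemma stage_quad (K : Controller dx du) (x : Fin dx → ℝ) :
    x ⬝ᵥ S.stageCost K *ᵥ x = x ⬝ᵥ S.Q *ᵥ x + (K *ᵥ x) ⬝ᵥ S.R *ᵥ (K *ᵥ x) := by
  rw [stageCost, Matrix.add_mulVec, dotProduct_add, quad_conj]

lemma stage_psd (K : Controller dx du) : (S.stageCost K).PosSemidef := by
  have := h.R_psd.conjTranspose_mul_mul_same K
  rw [Matrix.conjTranspose_eq_transpose_of_trivial] at this
  exact h.Q_psd.add this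

lemma stage_ge (K : Controller dx du) (x : Fin dx → ℝ) :
    a * (x ⬝ᵥ x) ≤ x ⬝ᵥ S.stageCost K *ᵥ x := by
  rw [stage_quad]
  linarith [h.Q_ge x, posSemidef_quad_nonneg h.R_psd (K *ᵥ x)]

lemma norm_R_le : ‖S.R‖ ≤ 1 := norm_le_of_psd h.R_psd zero_le_one (by simpa using h.R_le)

lemma value_psd (hK : StableMat (S.closedLoop K)) : (S.value K).PosSemidef :=
  hK.lyap_posSemidef (h.stage_psd K)

lemma statCov_psd (hK : StableMat (S.closedLoop K)) : (S.statCov V K).PosSemidef :=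
  hK.transpose.lyap_posSemidef h.V_psd

omit h in
lemma value_eq (hK : StableMat (S.closedLoop K)) :
    S.value K = S.stageCost K + (S.closedLoop K)ᵀ * S.value K * S.closedLoop K :=
  hK.lyap_eq _

omit h in
lemma statCov_eq (hK : StableMat (S.closedLoop K)) :
    S.statCov V K = V + S.closedLoop K * S.statCov V K * (S.closedLoop K)ᵀ := by
  simpa [statCov] using hK.transpose.lyap_eq V

omit h in
lemma value_quad (hK : StableMat (S.closedLoop K)) (x : Fin dx → ℝ) :
    x ⬝ᵥ S.value K *ᵥ x = x ⬝ᵥ S.stageCost K *ᵥ x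
      + (S.closedLoop K *ᵥ x) ⬝ᵥ S.value K *ᵥ (S.closedLoop K *ᵥ x) := by
  conv_lhs => rw [value_eq hK]
  rw [Matrix.add_mulVec, dotProduct_add, quad_conj]

omit h in
lemma avgCost_eq (hK : StableMat (S.closedLoop K)) :
    S.avgCost V K = (S.stageCost K * S.statCov V K).trace := hK.trace_lyap_mul _ _

lemma avgCost_nonneg (hK : StableMat (S.closedLoop K)) : 0 ≤ S.avgCost V K :=
  trace_mul_nonneg h.V_psd (posSemidef_quad_nonneg (h.value_psd hK))

/-- Since `V ≥ σ²`, the cost `tr(P_K V)` is at least `σ² tr P_K`; so the cost bound `ν` bounds the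
whole value matrix by `ν / σ² = a κ²`. -/
lemma value_trace_le (hK : S.Fine V ν K) : (S.value K).trace ≤ a * κ ^ 2 := by
  have h1 := trace_mul_ge (h.value_psd hK.1) h.V_ge
  rw [Matrix.trace_mul_comm] at h1
  have h2 : σ ^ 2 * (S.value K).trace ≤ σ ^ 2 * (a * κ ^ 2) := by
    refine (h1.trans hK.2).trans (le_of_eq ?_)
    rw [← h.kappa_eq]; ring
  exact le_of_mul_le_mul_left h2 (by have := h.sigma_pos; positivity)

lemma value_quad_le (hK : S.Fine V ν K) (x : Fin dx → ℝ) :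
    x ⬝ᵥ S.value K *ᵥ x ≤ a * κ ^ 2 * (x ⬝ᵥ x) :=
  (quad_le_trace (h.value_psd hK.1) x).trans
    (mul_le_mul_of_nonneg_right (h.value_trace_le hK) (dot_self_nonneg x))

lemma stage_le_value (hK : StableMat (S.closedLoop K)) (x : Fin dx → ℝ) :
    x ⬝ᵥ S.stageCost K *ᵥ x ≤ x ⬝ᵥ S.value K *ᵥ x := by
  rw [value_quad hK]
  linarith [posSemidef_quad_nonneg (h.value_psd hK) (S.closedLoop K *ᵥ x)]

lemma value_ge (hK : StableMat (S.closedLoop K)) (x : Fin dx → ℝ) :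
    a * (x ⬝ᵥ x) ≤ x ⬝ᵥ S.value K *ᵥ x := (h.stage_ge K x).trans (h.stage_le_value hK x)

lemma step_value_le (hK : StableMat (S.closedLoop K)) (x : Fin dx → ℝ) :
    (S.closedLoop K *ᵥ x) ⬝ᵥ S.value K *ᵥ (S.closedLoop K *ᵥ x) ≤ x ⬝ᵥ S.value K *ᵥ x := by
  rw [value_quad hK x]
  linarith [posSemidef_quad_nonneg (h.stage_psd K) x]

/-- Dual to `value_trace_le`: the cost is also the trace of the stage cost against the covariance,
and the stage cost is at least `a`. -/
lemma statCov_trace_le (hK : S.Fine V c K) : (S.statCov V K).trace ≤ c / a := by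
  rw [le_div_iff₀ h.a_pos, mul_comm]
  refine (trace_mul_ge (h.statCov_psd hK.1) (h.stage_ge K)).trans ?_
  rw [← avgCost_eq hK.1]
  exact hK.2

lemma statCov_trace_nonneg (hK : StableMat (S.closedLoop K)) : 0 ≤ (S.statCov V K).trace :=
  (h.statCov_psd hK).trace_nonneg

/-- The value does not increase along the noiseless dynamics and lies between `a ‖x‖²` and `a κ²
‖x‖²`. -/
lemma norm_closedLoop_le (hK : S.Fine V ν K) : ‖S.closedLoop K‖ ≤ κ := by
  refine norm_le_of_dot h.kappa_pos.le _ fun x => le_of_mul_le_mul_left ?_ h.a_pos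
  calc _ ≤ _ := h.value_ge hK.1 (S.closedLoop K *ᵥ x)
    _ ≤ _ := h.step_value_le hK.1 x
    _ ≤ _ := by rw [← mul_assoc]; exact h.value_quad_le hK x

lemma norm_value_le (hK : S.Fine V ν K) : ‖S.value K‖ ≤ a * κ ^ 2 :=
  norm_le_of_psd (h.value_psd hK.1) (by have := h.a_pos; positivity) (h.value_quad_le hK)

/-- One step pays the stage cost, at least `a ‖x‖²`, which is at least a fraction `1 / κ²` of the
value. -/
lemma contraction (hK : S.Fine V ν K) (x : Fin dx → ℝ) :
    (S.closedLoop K *ᵥ x) ⬝ᵥ S.value K *ᵥ (S.closedLoop K *ᵥ x)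
      ≤ (1 - 1 / κ ^ 2) * (x ⬝ᵥ S.value K *ᵥ x) := by
  have h1 := value_quad hK.1 x
  have h2 := h.stage_ge K x
  have h3 := h.value_quad_le hK x
  have hk := h.kappa_pos
  have h4 : 1 / κ ^ 2 * (x ⬝ᵥ S.value K *ᵥ x) ≤ a * (x ⬝ᵥ x) := by
    rw [one_div, inv_mul_le_iff₀ (by positivity)]
    linarith
  linarith

lemma norm_lyap_closedLoop_le (hK : S.Fine V ν K) (N : Matrix (Fin dx) (Fin dx) ℝ) :
    ‖lyap (S.closedLoop K) N‖ ≤ κ ^ 2 * ‖N‖ :=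
  hK.1.norm_lyap_le h.a_pos (h.stage_ge K) (sq_nonneg κ) (h.value_quad_le hK) N

lemma sqrt_a_le : √a ≤ 1 := Real.sqrt_le_one.mpr h.a_le

/-- Cauchy–Schwarz in the form `R`, with `KᵀRK ≤ P_K`. Only the product `R K` enters the gradient,
so no bound on `K` itself is needed. -/
lemma norm_R_mul_le (hK : S.Fine V ν K) : ‖S.R * K‖ ≤ √a * κ := by
  have ha := h.a_pos
  have hk := h.kappa_pos
  refine norm_le_of_bilin (by positivity) _ fun x y => ?_
  rw [← Matrix.mulVec_mulVec]
  refine (posSemidef_cauchy_schwarz h.R_psd x (K *ᵥ y)).trans ?_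
  have h1 : √(x ⬝ᵥ S.R *ᵥ x) ≤ euc x := by
    refine Real.sqrt_le_iff.mpr ⟨euc_nonneg x, ?_⟩
    rw [euc_sq]; exact h.R_le x
  have h2 : √((K *ᵥ y) ⬝ᵥ S.R *ᵥ (K *ᵥ y)) ≤ √a * κ * euc y := by
    refine Real.sqrt_le_iff.mpr ⟨by have := euc_nonneg y; positivity, ?_⟩
    rw [mul_pow, mul_pow, Real.sq_sqrt ha.le, euc_sq]
    have := h.stage_le_value hK.1 y
    rw [stage_quad] at this
    linarith [h.value_quad_le hK y, posSemidef_quad_nonneg h.Q_psd y]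
  calc _ ≤ euc x * (√a * κ * euc y) :=
        mul_le_mul h1 h2 (Real.sqrt_nonneg _) (euc_nonneg x)
    _ = _ := by ring

/-- Cauchy–Schwarz in the form `P_K`, together with the decrease of the value in one step, saves the
factor `κ` that the product of the two norms would cost. -/
lemma norm_value_closedLoop_le (hK : S.Fine V ν K) :
    ‖S.value K * S.closedLoop K‖ ≤ a * κ ^ 2 := by
  have ha := h.a_pos
  refine norm_le_of_bilin (by positivity) _ fun x y => ?_
  rw [← Matrix.mulVec_mulVec]
  refine (posSemidef_cauchy_schwarz (h.value_psd hK.1) x (S.closedLoop K *ᵥ y)).trans ?_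
  have key : ∀ z : Fin dx → ℝ, √(a * κ ^ 2 * (z ⬝ᵥ z)) = √(a * κ ^ 2) * euc z := fun z => by
    rw [← euc_sq, Real.sqrt_mul (by positivity), Real.sqrt_sq (euc_nonneg z)]
  have h1 : √(x ⬝ᵥ S.value K *ᵥ x) ≤ √(a * κ ^ 2) * euc x := by
    rw [← key]; exact Real.sqrt_le_sqrt (h.value_quad_le hK x)
  have h2 : √((S.closedLoop K *ᵥ y) ⬝ᵥ S.value K *ᵥ (S.closedLoop K *ᵥ y))
      ≤ √(a * κ ^ 2) * euc y := by
    rw [← key]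
    exact Real.sqrt_le_sqrt ((h.step_value_le hK.1 y).trans (h.value_quad_le hK y))
  calc _ ≤ (√(a * κ ^ 2) * euc x) * (√(a * κ ^ 2) * euc y) :=
        mul_le_mul h1 h2 (Real.sqrt_nonneg _) (by have := euc_nonneg x; positivity)
    _ = √(a * κ ^ 2) ^ 2 * (euc x * euc y) := by ring
    _ = _ := by rw [Real.sq_sqrt (by positivity)]

lemma norm_advantage_le (hK : S.Fine V ν K) : ‖S.advantage K‖ ≤ 2 * √a * ψ * κ ^ 2 := by
  have ha := h.a_pos
  have hk := h.kappa_ge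
  have hs := Real.sqrt_nonneg a
  have h1 : ‖S.Bᵀ * S.value K * S.closedLoop K‖ ≤ ψ * (a * κ ^ 2) := by
    rw [Matrix.mul_assoc]
    refine (Matrix.l2_opNorm_mul _ _).trans ?_
    rw [norm_transpose_eq]
    exact mul_le_mul h.B_le (h.norm_value_closedLoop_le hK) (norm_nonneg _) h.psi_pos.le
  have h2 : a ≤ √a := by
    nlinarith [Real.sq_sqrt ha.le, h.sqrt_a_le]
  have h3 : √a * κ ≤ √a * ψ * κ ^ 2 := by
    rw [mul_assoc]
    refine mul_le_mul_of_nonneg_left ?_ hs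
    nlinarith [h.psi_ge]
  have h4 : ψ * (a * κ ^ 2) ≤ √a * ψ * κ ^ 2 := by
    have := mul_le_mul_of_nonneg_right h2 (mul_nonneg h.psi_pos.le (sq_nonneg κ))
    linarith
  calc _ ≤ ‖S.R * K‖ + ‖S.Bᵀ * S.value K * S.closedLoop K‖ := norm_add_le _ _
    _ ≤ _ := by linarith [h.norm_R_mul_le hK]

lemma norm_curvature_le (hK : S.Fine V ν K) : ‖S.curvature K‖ ≤ 2 * ψ ^ 2 * κ ^ 2 := by
  have ha := h.a_pos
  have hp := h.psi_pos
  have h1 : ‖S.Bᵀ * S.value K * S.B‖ ≤ ψ * (a * κ ^ 2) * ψ := by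
    refine (Matrix.l2_opNorm_mul _ _).trans ?_
    refine mul_le_mul ?_ h.B_le (norm_nonneg _) (by positivity)
    refine (Matrix.l2_opNorm_mul _ _).trans ?_
    rw [norm_transpose_eq]
    exact mul_le_mul h.B_le (h.norm_value_le hK) (norm_nonneg _) hp.le
  have h2 : ψ * (a * κ ^ 2) * ψ ≤ ψ ^ 2 * κ ^ 2 := by
    have : ψ * (a * κ ^ 2) * ψ = a * (ψ ^ 2 * κ ^ 2) := by ring
    rw [this]
    exact mul_le_of_le_one_left (by positivity) h.a_le
  have h3 : 1 ≤ ψ ^ 2 * κ ^ 2 := by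
    have := h.psi_ge; have := h.kappa_ge
    exact one_le_mul_of_one_le_of_one_le (one_le_pow₀ h.psi_ge) (one_le_pow₀ (by linarith))
  calc _ ≤ ‖S.R‖ + ‖S.Bᵀ * S.value K * S.B‖ := norm_add_le _ _
    _ ≤ _ := by linarith [h.norm_R_le]

end Bounds
end System

/-! ### Perturbation of the controller -/

namespace System

variable {dx du : ℕ} (S : System dx du)

/-- The change of the right-hand side of the Lyapunov equation of `K` when it is perturbed
by `D`. -/
def increment (K D : Controller dx du) : Matrix (Fin dx) (Fin dx) ℝ :=
  Dᵀ * S.advantage K + (S.advantage K)ᵀ * D + Dᵀ * S.curvature K * D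

variable {S} {V : Matrix (Fin dx) (Fin dx) ℝ} {a ψ ν σ κ c : ℝ} {K K' : Controller dx du}

lemma closedLoop_add (K D : Controller dx du) :
    S.closedLoop (K + D) = S.closedLoop K + S.B * D := by
  rw [closedLoop, closedLoop, Matrix.mul_add, add_assoc]

/-- The Taylor expansion of one Bellman step with a fixed continuation `P`; it stops exactly at
second order because the step is quadratic in the controller. -/
lemma bellman_expansion {R : Matrix (Fin du) (Fin du) ℝ} {P : Matrix (Fin dx) (Fin dx) ℝ}
    (A Q : Matrix (Fin dx) (Fin dx) ℝ) (B : Matrix (Fin dx) (Fin du) ℝ) (K D : Controller dx du)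
    (hP : Pᵀ = P) (hR : Rᵀ = R) :
    Q + (K + D)ᵀ * R * (K + D) + (A + B * D)ᵀ * P * (A + B * D)
      = Q + Kᵀ * R * K + Aᵀ * P * A + (Dᵀ * (R * K + Bᵀ * P * A)
        + (R * K + Bᵀ * P * A)ᵀ * D + Dᵀ * (R + Bᵀ * P * B) * D) := by
  simp only [Matrix.transpose_add, Matrix.transpose_mul, Matrix.transpose_transpose,
    Matrix.mul_add, Matrix.add_mul, Matrix.mul_assoc, hP, hR]
  abel

namespace Bounds

variable (h : S.Bounds V a ψ ν σ κ)
include h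

lemma value_symm (hK : StableMat (S.closedLoop K)) : (S.value K)ᵀ = S.value K :=
  posSemidef_transpose_eq (h.value_psd hK)

lemma statCov_symm (hK : StableMat (S.closedLoop K)) : (S.statCov V K)ᵀ = S.statCov V K :=
  posSemidef_transpose_eq (h.statCov_psd hK)

/-- For `D = 0` this is the Lyapunov equation of `P_K`; the increment is therefore the Bellman
residual of `P_K` under the perturbed controller. -/
lemma increment_eq (hK : StableMat (S.closedLoop K)) (D : Controller dx du) :
    S.stageCost (K + D) + (S.closedLoop (K + D))ᵀ * S.value K * S.closedLoop (K + D)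
      = S.value K + S.increment K D := by
  rw [closedLoop_add, stageCost, increment, advantage, curvature,
    bellman_expansion _ _ _ _ _ (h.value_symm hK) (posSemidef_transpose_eq h.R_psd)]
  rw [show S.Q + Kᵀ * S.R * K + (S.closedLoop K)ᵀ * S.value K * S.closedLoop K = S.value K from
    (value_eq hK).symm]

lemma norm_increment_le (hK : S.Fine V ν K) (D : Controller dx du) :
    ‖S.increment K D‖ ≤ 4 * √a * ψ * κ ^ 2 * ‖D‖ + 2 * ψ ^ 2 * κ ^ 2 * ‖D‖ ^ 2 := by
  have h1 : ‖Dᵀ * S.advantage K‖ ≤ ‖D‖ * (2 * √a * ψ * κ ^ 2) := by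
    refine (Matrix.l2_opNorm_mul _ _).trans ?_
    rw [norm_transpose_eq]
    exact mul_le_mul_of_nonneg_left (h.norm_advantage_le hK) (norm_nonneg _)
  have h2 : ‖(S.advantage K)ᵀ * D‖ ≤ ‖D‖ * (2 * √a * ψ * κ ^ 2) := by
    rw [← norm_transpose_eq, Matrix.transpose_mul, Matrix.transpose_transpose]
    exact h1
  have h3 : ‖Dᵀ * S.curvature K * D‖ ≤ ‖D‖ * (2 * ψ ^ 2 * κ ^ 2) * ‖D‖ := by
    refine (Matrix.l2_opNorm_mul _ _).trans (mul_le_mul_of_nonneg_right ?_ (norm_nonneg _))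
    refine (Matrix.l2_opNorm_mul _ _).trans ?_
    rw [norm_transpose_eq]
    exact mul_le_mul_of_nonneg_left (h.norm_curvature_le hK) (norm_nonneg _)
  calc _ ≤ ‖Dᵀ * S.advantage K‖ + ‖(S.advantage K)ᵀ * D‖ + ‖Dᵀ * S.curvature K * D‖ :=
        norm_add₃_le
    _ ≤ _ := by nlinarith

/-- A linear bound on the increment for small perturbations. -/
lemma norm_increment_le' (hK : S.Fine V ν K) {D : Controller dx du} (hD : ‖D‖ ≤ √a / (8 * ψ * κ ^ 3)) :
    ‖S.increment K D‖ ≤ 5 * √a * ψ * κ ^ 2 * ‖D‖ := by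
  refine (h.norm_increment_le hK D).trans ?_
  have hp := h.psi_pos
  have hk := h.kappa_ge
  rw [le_div_iff₀ (by positivity)] at hD
  have h1 : 2 * ψ * ‖D‖ ≤ √a := by
    refine le_trans ?_ hD
    have : 1 ≤ κ ^ 3 := one_le_pow₀ (by linarith)
    nlinarith [mul_nonneg (norm_nonneg D) hp.le]
  have h2 := mul_le_mul_of_nonneg_right h1
    (show 0 ≤ ψ * κ ^ 2 * ‖D‖ by have := norm_nonneg D; positivity)
  nlinarith

/-- Controllers close to one of cost at most `ν / 2` have cost at most `ν`. -/
lemma fine_add (hK : S.Fine V (ν / 2) K) {D : Controller dx du}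
    (hD : ‖D‖ ≤ √a / (16 * ψ * κ ^ 3)) : S.Fine V ν (K + D) := by
  have ha := h.a_pos
  have hp := h.psi_pos
  have hk := h.kappa_ge
  have hK1 : S.Fine V ν K := hK.mono (by linarith [h.nu_pos])
  have hN := h.norm_increment_le' hK1 (hD.trans (by gcongr; norm_num))
  have hN2 : ‖S.increment K D‖ ≤ a / 2 := by
    rw [le_div_iff₀ (by positivity)] at hD
    have e : √a * √a = a := Real.mul_self_sqrt ha.le
    have h1 : 16 * ψ * κ ^ 2 * ‖D‖ ≤ √a := by
      refine le_trans ?_ hD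
      have : 1 ≤ κ := by linarith
      nlinarith [mul_nonneg (mul_nonneg (norm_nonneg D) hp.le) (sq_nonneg κ)]
    nlinarith [mul_le_mul_of_nonneg_left h1 (Real.sqrt_nonneg a)]
  -- `P_K` remains a Lyapunov function of the perturbed loop, now with half the stage cost as
  -- source: the residual is at most `a / 2`, and half the stage cost is at least that.
  have hq : ∀ x, x ⬝ᵥ ((1 / 2 : ℝ) • S.stageCost (K + D)) *ᵥ x
      + (S.closedLoop (K + D) *ᵥ x) ⬝ᵥ S.value K *ᵥ (S.closedLoop (K + D) *ᵥ x)
      ≤ x ⬝ᵥ S.value K *ᵥ x := by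
    intro x
    have e := congrArg (fun M => x ⬝ᵥ M *ᵥ x) (h.increment_eq hK.1 D)
    simp only [Matrix.add_mulVec, dotProduct_add, quad_conj] at e
    have h1 := (abs_le.mp (abs_quad_le (S.increment K D) x)).2
    have h2 := mul_le_mul_of_nonneg_right hN2 (dot_self_nonneg x)
    have h3 := h.stage_ge (K + D) x
    rw [Matrix.smul_mulVec, dotProduct_smul, smul_eq_mul]
    linarith
  have hP := posSemidef_quad_nonneg (h.value_psd hK.1)
  have hst : StableMat (S.closedLoop (K + D)) := by
    refine stableMat_of_quad (a := a / 2) (by positivity) (fun x => ?_) hP hq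
    rw [Matrix.smul_mulVec, dotProduct_smul, smul_eq_mul]
    linarith [h.stage_ge (K + D) x]
  refine ⟨hst, ?_⟩
  -- Halving the source is the same as doubling the Lyapunov function, so the perturbed value is at
  -- most twice the old one and the cost at most doubles from `ν / 2`.
  have hle : ∀ x, x ⬝ᵥ S.value (K + D) *ᵥ x ≤ x ⬝ᵥ ((2 : ℝ) • S.value K) *ᵥ x := by
    refine hst.lyap_quad_le (fun x => ?_) fun x => ?_
    · rw [Matrix.smul_mulVec, dotProduct_smul, smul_eq_mul]
      linarith [hP x]
    · have := hq x
      simp only [Matrix.smul_mulVec, dotProduct_smul, smul_eq_mul] at this ⊢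
      linarith
  have := trace_mul_le_of_quad h.V_psd hle
  rw [Matrix.smul_mul, Matrix.trace_smul, smul_eq_mul] at this
  have h2 : (S.value K * V).trace ≤ ν / 2 := hK.2
  exact this.trans (by linarith)

/-- The difference solves the Lyapunov equation of the perturbed loop with the Bellman residual as
source. -/
lemma value_sub (hK : StableMat (S.closedLoop K)) {D : Controller dx du}
    (hK' : StableMat (S.closedLoop (K + D))) :
    S.value (K + D) - S.value K = lyap (S.closedLoop (K + D)) (S.increment K D) := by
  refine hK'.lyap_unique ?_
  have e := h.increment_eq hK D
  have e' := value_eq hK'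
  rw [Matrix.mul_sub, Matrix.sub_mul, eq_sub_of_add_eq' e.symm]
  nth_rewrite 1 [e']
  abel

lemma norm_value_sub_le (hK : S.Fine V ν K) {D : Controller dx du} (hK' : S.Fine V ν (K + D))
    (hD : ‖D‖ ≤ √a / (8 * ψ * κ ^ 3)) :
    ‖S.value (K + D) - S.value K‖ ≤ 5 * ψ * κ ^ 4 * ‖D‖ := by
  rw [h.value_sub hK.1 hK'.1]
  refine (h.norm_lyap_closedLoop_le hK' _).trans ?_
  have h1 := mul_le_mul_of_nonneg_left (h.norm_increment_le' hK hD) (sq_nonneg κ)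
  refine h1.trans ?_
  have h2 := mul_le_mul_of_nonneg_right h.sqrt_a_le
    (show 0 ≤ 5 * ψ * κ ^ 4 * ‖D‖ by have := h.psi_pos; have := norm_nonneg D; positivity)
  calc _ = √a * (5 * ψ * κ ^ 4 * ‖D‖) := by ring
    _ ≤ _ := by linarith

/-- The performance difference identity. -/
lemma avgCost_sub (hK : StableMat (S.closedLoop K)) {D : Controller dx du}
    (hK' : StableMat (S.closedLoop (K + D))) :
    S.avgCost V (K + D) - S.avgCost V K = (S.increment K D * S.statCov V (K + D)).trace := by
  rw [avgCost, avgCost, ← Matrix.trace_sub, ← Matrix.sub_mul, h.value_sub hK hK',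
    hK'.trace_lyap_mul, statCov]

omit h in
-- Subtract the two Lyapunov equations and keep the unperturbed loop as operator. The source then
-- contains the perturbed covariance, and the identity is exact rather than first-order.
lemma statCov_sub (hK : StableMat (S.closedLoop K)) {D : Controller dx du}
    (hK' : StableMat (S.closedLoop (K + D))) :
    S.statCov V (K + D) - S.statCov V K = lyap (S.closedLoop K)ᵀ
      (S.B * D * S.statCov V (K + D) * (S.closedLoop (K + D))ᵀ
        + S.closedLoop K * S.statCov V (K + D) * (S.B * D)ᵀ) := by
  refine hK.transpose.lyap_unique ?_
  have e := statCov_eq (V := V) hK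
  have e' := statCov_eq (V := V) hK'
  rw [Matrix.transpose_transpose]
  nth_rewrite 1 [e, e']
  rw [closedLoop_add]
  simp only [Matrix.transpose_add, Matrix.mul_add, Matrix.add_mul, Matrix.mul_sub, Matrix.sub_mul]
  abel

/-- By duality the Lyapunov operator acts on `N`, where its norm is at most `κ²`, and the covariance
enters only through its trace, which the cost controls. -/
lemma abs_trace_statCov_sub_le (hK : S.Fine V ν K) {D : Controller dx du}
    (hK' : S.Fine V ν (K + D)) (N : Matrix (Fin dx) (Fin dx) ℝ) :
    |(N * (S.statCov V (K + D) - S.statCov V K)).trace|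
      ≤ 2 * ψ * κ ^ 3 * (ν / a) * ‖N‖ * ‖D‖ := by
  have hp := h.psi_pos
  have hk := h.kappa_pos
  rw [statCov_sub hK.1 hK'.1, ← hK.1.trace_lyap_mul]
  set L := lyap (S.closedLoop K) N
  have hL : ‖L‖ ≤ κ ^ 2 * ‖N‖ := h.norm_lyap_closedLoop_le hK N
  have hBD : ‖S.B * D‖ ≤ ψ * ‖D‖ := (Matrix.l2_opNorm_mul _ _).trans
    (mul_le_mul_of_nonneg_right h.B_le (norm_nonneg _))
  have hps := h.statCov_psd hK'.1
  have htr := h.statCov_trace_le hK'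
  have htr0 := hps.trace_nonneg
  set X := S.statCov V (K + D)
  rw [Matrix.mul_add, Matrix.trace_add]
  have t1 : (L * (S.B * D * X * (S.closedLoop (K + D))ᵀ)).trace
      = ((S.closedLoop (K + D))ᵀ * L * (S.B * D) * X).trace := by
    rw [← Matrix.mul_assoc, Matrix.trace_mul_comm]
    simp only [Matrix.mul_assoc]
  have t2 : (L * (S.closedLoop K * X * (S.B * D)ᵀ)).trace
      = ((S.B * D)ᵀ * L * S.closedLoop K * X).trace := by
    rw [← Matrix.mul_assoc, Matrix.trace_mul_comm]
    simp only [Matrix.mul_assoc]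
  have b1 : ‖(S.closedLoop (K + D))ᵀ * L * (S.B * D)‖ ≤ κ * (κ ^ 2 * ‖N‖) * (ψ * ‖D‖) := by
    refine (norm_mul_le _ _).trans (mul_le_mul ?_ hBD (norm_nonneg _) (by positivity))
    refine (norm_mul_le _ _).trans (mul_le_mul ?_ hL (norm_nonneg _) hk.le)
    rw [norm_transpose_eq]; exact h.norm_closedLoop_le hK'
  have b2 : ‖(S.B * D)ᵀ * L * S.closedLoop K‖ ≤ (ψ * ‖D‖) * (κ ^ 2 * ‖N‖) * κ := by
    refine (norm_mul_le _ _).trans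
      (mul_le_mul ?_ (h.norm_closedLoop_le hK) (norm_nonneg _) (by positivity))
    refine (norm_mul_le _ _).trans (mul_le_mul ?_ hL (norm_nonneg _) (by positivity))
    rw [norm_transpose_eq]; exact hBD
  rw [t1, t2]
  have c1 := (abs_trace_mul_le ((S.closedLoop (K + D))ᵀ * L * (S.B * D)) hps).trans
    (mul_le_mul b1 htr htr0 (by positivity))
  have c2 := (abs_trace_mul_le ((S.B * D)ᵀ * L * S.closedLoop K) hps).trans
    (mul_le_mul b2 htr htr0 (by positivity))
  calc _ ≤ _ := abs_add_le _ _
    _ ≤ _ := add_le_add c1 c2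
    _ = _ := by ring

lemma norm_advantage_sub_le (hK : S.Fine V ν K) {D : Controller dx du} (hK' : S.Fine V ν (K + D))
    (hD : ‖D‖ ≤ √a / (8 * ψ * κ ^ 3)) :
    ‖S.advantage (K + D) - S.advantage K‖ ≤ 6 * ψ ^ 2 * κ ^ 5 * ‖D‖ := by
  have hp := h.psi_pos
  have hk := h.kappa_ge
  have e : S.advantage (K + D) - S.advantage K = S.curvature K * D
      + S.Bᵀ * (S.value (K + D) - S.value K) * S.closedLoop (K + D) := by
    simp only [advantage, curvature, closedLoop_add, Matrix.mul_add, Matrix.add_mul,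
      Matrix.mul_sub, Matrix.sub_mul, Matrix.mul_assoc]
    abel
  rw [e]
  have b1 : ‖S.curvature K * D‖ ≤ 2 * ψ ^ 2 * κ ^ 2 * ‖D‖ := (Matrix.l2_opNorm_mul _ _).trans
    (mul_le_mul_of_nonneg_right (h.norm_curvature_le hK) (norm_nonneg _))
  have b2 : ‖S.Bᵀ * (S.value (K + D) - S.value K) * S.closedLoop (K + D)‖
      ≤ ψ * (5 * ψ * κ ^ 4 * ‖D‖) * κ := by
    refine (Matrix.l2_opNorm_mul _ _).trans
      (mul_le_mul ?_ (h.norm_closedLoop_le hK') (norm_nonneg _) (by positivity))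
    refine (Matrix.l2_opNorm_mul _ _).trans
      (mul_le_mul ?_ (h.norm_value_sub_le hK hK' hD) (norm_nonneg _) (by positivity))
    rw [norm_transpose_eq]; exact h.B_le
  have b3 : 2 * ψ ^ 2 * κ ^ 2 * ‖D‖ ≤ ψ ^ 2 * κ ^ 5 * ‖D‖ := by
    refine mul_le_mul_of_nonneg_right ?_ (norm_nonneg _)
    have : 2 ≤ κ ^ 3 := by nlinarith [pow_le_pow_left₀ (by norm_num) hk 3]
    nlinarith [mul_le_mul_of_nonneg_left this (show 0 ≤ ψ ^ 2 * κ ^ 2 by positivity)]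
  calc _ ≤ _ := norm_add_le _ _
    _ ≤ _ := by nlinarith

/-- Smoothness of the average cost: between two controllers close to `K`, it is almost linear, with
the slope at `K`. -/
lemma abs_avgCost_sub_le (hK : S.Fine V ν K) {D₁ D₂ : Controller dx du} {r : ℝ}
    (h₁ : S.Fine V ν (K + D₁)) (h₂ : S.Fine V ν (K + D₂))
    (hD₁ : ‖D₁‖ ≤ r) (hD₂ : ‖D₂‖ ≤ r) (hr : r ≤ √a / (8 * ψ * κ ^ 3)) :
    |S.avgCost V (K + D₂) - S.avgCost V (K + D₁)
      - 2 * ((D₂ - D₁)ᵀ * (S.advantage K * S.statCov V K)).trace|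
      ≤ 25 * ψ ^ 2 * κ ^ 5 * (ν / a) * r * ‖D₂ - D₁‖ := by
  have hp := h.psi_pos
  have ha := h.a_pos
  have hn := h.nu_pos
  have hk := h.kappa_ge
  set D := D₂ - D₁ with hDdef
  have hD2 : K + D₁ + D = K + D₂ := by rw [hDdef]; abel
  have hDn : ‖D‖ ≤ 2 * r := (norm_sub_le _ _).trans (by linarith)
  have e1 := h.avgCost_sub (D := D) h₁.1 (by rw [hD2]; exact h₂.1)
  rw [hD2] at e1
  rw [e1]
  clear_value D
  have hr0 : 0 ≤ r := (norm_nonneg _).trans hD₁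
  have hsym := h.statCov_symm h₂.1
  have hps := h.statCov_psd h₂.1
  have htr := h.statCov_trace_le h₂
  have htr0 := hps.trace_nonneg
  have hcov := h.abs_trace_statCov_sub_le hK h₂ (Dᵀ * S.advantage K)
  have hadv := h.norm_advantage_sub_le hK h₁ (hD₁.trans hr)
  have hcur := h.norm_curvature_le h₁
  have hadv0 := h.norm_advantage_le hK
  set X := S.statCov V (K + D₂)
  set E₁ := S.advantage (K + D₁)
  set E := S.advantage K
  set M := S.curvature (K + D₁)
  have e2 : (S.increment (K + D₁) D * X).trace
      = 2 * (Dᵀ * E₁ * X).trace + (Dᵀ * M * D * X).trace := by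
    have := trace_mul_transpose_symm hsym (Dᵀ * E₁)
    rw [Matrix.transpose_mul, Matrix.transpose_transpose] at this
    rw [increment, Matrix.add_mul, Matrix.add_mul, Matrix.trace_add, Matrix.trace_add, this]
    ring
  -- The deviation from linearity consists of the change of the advantage, the change of the
  -- covariance and the curvature; each is of order `r ‖D‖`.
  have e3 : (S.increment (K + D₁) D * X).trace - 2 * (Dᵀ * (E * S.statCov V K)).trace
      = 2 * (Dᵀ * (E₁ - E) * X).trace + 2 * (Dᵀ * E * (X - S.statCov V K)).trace
        + (Dᵀ * M * D * X).trace := by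
    rw [e2, Matrix.mul_sub, Matrix.sub_mul, Matrix.trace_sub, Matrix.mul_sub, Matrix.trace_sub,
      ← Matrix.mul_assoc]
    ring
  rw [e3]
  have b1 : |(Dᵀ * (E₁ - E) * X).trace| ≤ ‖D‖ * (6 * ψ ^ 2 * κ ^ 5 * r) * (ν / a) := by
    refine (abs_trace_mul_le _ hps).trans (mul_le_mul ?_ htr htr0 (by positivity))
    refine (Matrix.l2_opNorm_mul _ _).trans ?_
    rw [norm_transpose_eq]
    refine mul_le_mul_of_nonneg_left (hadv.trans ?_) (norm_nonneg _)
    exact mul_le_mul_of_nonneg_left hD₁ (by positivity)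
  have b2 : |(Dᵀ * E * (X - S.statCov V K)).trace|
      ≤ 2 * ψ * κ ^ 3 * (ν / a) * (‖D‖ * (2 * ψ * κ ^ 2)) * r := by
    refine hcov.trans (mul_le_mul ?_ hD₂ (norm_nonneg _) (by positivity))
    refine mul_le_mul_of_nonneg_left ?_ (by positivity)
    refine (Matrix.l2_opNorm_mul _ _).trans ?_
    rw [norm_transpose_eq]
    refine mul_le_mul_of_nonneg_left (hadv0.trans ?_) (norm_nonneg _)
    have := mul_le_mul_of_nonneg_right h.sqrt_a_le (show 0 ≤ 2 * ψ * κ ^ 2 by positivity)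
    linarith
  have b3 : |(Dᵀ * M * D * X).trace| ≤ ‖D‖ * (2 * ψ ^ 2 * κ ^ 2) * (2 * r) * (ν / a) := by
    refine (abs_trace_mul_le _ hps).trans (mul_le_mul ?_ htr htr0 (by positivity))
    refine (Matrix.l2_opNorm_mul _ _).trans (mul_le_mul ?_ hDn (norm_nonneg _) (by positivity))
    refine (Matrix.l2_opNorm_mul _ _).trans ?_
    rw [norm_transpose_eq]
    exact mul_le_mul_of_nonneg_left hcur (norm_nonneg _)
  have b4 : ‖D‖ * (2 * ψ ^ 2 * κ ^ 2) * (2 * r) * (ν / a)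
      ≤ ψ ^ 2 * κ ^ 5 * (ν / a) * r * ‖D‖ := by
    have : 4 ≤ κ ^ 3 := by nlinarith [pow_le_pow_left₀ (by norm_num) hk 3]
    have := mul_le_mul_of_nonneg_left this
      (show 0 ≤ ψ ^ 2 * κ ^ 2 * (ν / a) * r * ‖D‖ by positivity)
    linarith
  have h3 := abs_add_three (2 * (Dᵀ * (E₁ - E) * X).trace)
    (2 * (Dᵀ * E * (X - S.statCov V K)).trace) (Dᵀ * M * D * X).trace
  rw [abs_mul, abs_mul, abs_two] at h3
  have key : 0 ≤ ψ ^ 2 * κ ^ 5 * (ν / a) * r * ‖D‖ := by positivity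
  linarith

end Bounds
end System

/-! ### Measurability of the system quantities -/

instance instMeasurableSpaceMatrix {m n : Type*} : MeasurableSpace (Matrix m n ℝ) :=
  inferInstanceAs (MeasurableSpace (m → n → ℝ))

instance instBorelSpaceMatrix {m n : Type*} [Fintype m] [Fintype n] [DecidableEq m]
    [DecidableEq n] : BorelSpace (Matrix m n ℝ) :=
  inferInstanceAs (BorelSpace (m → n → ℝ))

section Measurability

variable {dx du : ℕ} (S : System dx du)

lemma measurable_mulVec {m n : ℕ} :
    Measurable fun p : Matrix (Fin m) (Fin n) ℝ × (Fin n → ℝ) => p.1 *ᵥ p.2 :=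
  (continuous_fst.matrix_mulVec continuous_snd).measurable

lemma _root_.Measurable.matrix_mulVec {Ω : Type*} [MeasurableSpace Ω] {m n : ℕ}
    {f : Ω → Matrix (Fin m) (Fin n) ℝ} {g : Ω → Fin n → ℝ} (hf : Measurable f)
    (hg : Measurable g) : Measurable fun ω => f ω *ᵥ g ω :=
  measurable_mulVec.comp (hf.prodMk hg)

lemma _root_.Measurable.dot {Ω : Type*} [MeasurableSpace Ω] {n : ℕ}
    {f g : Ω → Fin n → ℝ} (hf : Measurable f)
    (hg : Measurable g) : Measurable fun ω => f ω ⬝ᵥ g ω := by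
  have : Measurable fun p : (Fin n → ℝ) × (Fin n → ℝ) => p.1 ⬝ᵥ p.2 :=
    (continuous_fst.dotProduct continuous_snd).measurable
  exact this.comp (hf.prodMk hg)

lemma System.rollout_eq (K : Controller dx du) (x : Fin dx → ℝ) (w : ℕ → Fin dx → ℝ) (s : ℕ) :
    S.rollout K x w (s + 1) = S.closedLoop K *ᵥ S.rollout K x w s + w s := by
  rw [rollout, closedLoop, Matrix.add_mulVec, Matrix.mulVec_mulVec]

lemma System.rollout_congr (K : Controller dx du) (x : Fin dx → ℝ) {w w' : ℕ → Fin dx → ℝ} {s : ℕ}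
    (h : ∀ k < s, w k = w' k) : S.rollout K x w s = S.rollout K x w' s := by
  induction s with
  | zero => rfl
  | succ s ih =>
    rw [rollout_eq, rollout_eq, ih fun k hk => h k (by omega), h s (by omega)]

lemma System.continuous_closedLoop : Continuous S.closedLoop := by
  unfold closedLoop; fun_prop

lemma System.continuous_stageCost : Continuous S.stageCost := by
  unfold stageCost; fun_prop

lemma System.measurable_rollout (s : ℕ) : Measurable
    fun p : Controller dx du × (Fin dx → ℝ) × (ℕ → Fin dx → ℝ) => S.rollout p.1 p.2.1 p.2.2 s := by
  induction s with
  | zero => exact measurable_fst.comp measurable_snd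
  | succ s ih =>
    simp only [rollout_eq]
    refine ((S.continuous_closedLoop.measurable.comp measurable_fst).matrix_mulVec ih).add ?_
    exact (measurable_pi_apply s).comp (measurable_snd.comp measurable_snd)

lemma System.measurable_value : Measurable S.value := by
  unfold value lyap
  refine Measurable.tsum fun k => ?_
  refine Continuous.measurable ?_
  have h1 := S.continuous_closedLoop
  have h2 := S.continuous_stageCost
  fun_prop

lemma System.measurable_avgCost (V : Matrix (Fin dx) (Fin dx) ℝ) : Measurable (S.avgCost V) := by
  have h : Measurable fun M : Matrix (Fin dx) (Fin dx) ℝ => (M * V).trace := by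
    refine Continuous.measurable ?_
    fun_prop
  exact h.comp S.measurable_value

/-- Stability means bounded partial sums of `‖A^k‖²`, hence a countable union of closed sets of
controllers. -/
lemma System.measurableSet_fine (V : Matrix (Fin dx) (Fin dx) ℝ) (c : ℝ) :
    MeasurableSet {K | S.Fine V c K} := by
  refine MeasurableSet.inter (s₁ := {K | StableMat (S.closedLoop K)}) ?_
    (measurableSet_le (S.measurable_avgCost V) measurable_const)
  have : {K | StableMat (S.closedLoop K)}
      = ⋃ M : ℕ, ⋂ N : ℕ, {K | ∑ k ∈ Finset.range N, ‖S.closedLoop K ^ k‖ ^ 2 ≤ M} := by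
    ext K
    simp only [Set.mem_ofPred_eq, Set.mem_iUnion, Set.mem_iInter]
    constructor
    · intro h
      obtain ⟨M, hM⟩ := exists_nat_ge (∑' k : ℕ, ‖S.closedLoop K ^ k‖ ^ 2)
      exact ⟨M, fun N => (h.sum_le_tsum _ fun _ _ => sq_nonneg _).trans hM⟩
    · rintro ⟨M, hM⟩
      exact stableMat_of_trace_bounded hM
  rw [this]
  refine MeasurableSet.iUnion fun M => MeasurableSet.iInter fun N => ?_
  refine measurableSet_le (Continuous.measurable ?_) measurable_const
  have h1 := S.continuous_closedLoop
  fun_prop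

end Measurability

/-! ### Second moments of the state -/

section Moments

variable {dx du : ℕ} {Ω : Type*} [MeasurableSpace Ω] {P : Measure Ω}
  {w : ℕ → Ω → Fin dx → ℝ} {σ W : ℝ}

/-- The information in the noise before time `t`. -/
abbrev noisePast (w : ℕ → Ω → Fin dx → ℝ) (t : ℕ) : MeasurableSpace Ω :=
  ⨆ k ∈ Set.Iio t, MeasurableSpace.comap (w k) inferInstance

/-- The covariance matrix of the noise. -/
def noiseCov (P : Measure Ω) (w : ℕ → Ω → Fin dx → ℝ) : Matrix (Fin dx) (Fin dx) ℝ :=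
  Matrix.of fun a b => ∫ ω, w 0 ω a * w 0 ω b ∂P

omit [MeasurableSpace Ω] in
lemma measurable_noisePast {k t : ℕ} (hk : k < t) : Measurable[noisePast w t] (w k) :=
  Measurable.of_comap_le (le_iSup₂_of_le (f := fun k (_ : k ∈ Set.Iio t) =>
    MeasurableSpace.comap (w k) inferInstance) k hk le_rfl)

/-- The first `s` terms of a sequence, continued by zero. -/
def trunc (s : ℕ) (ζ : ℕ → Fin dx → ℝ) : ℕ → Fin dx → ℝ := fun k => if k < s then ζ k else 0

lemma System.rollout_trunc (S : System dx du) (K : Controller dx du) (x : Fin dx → ℝ)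
    (ζ : ℕ → Fin dx → ℝ) {s t : ℕ} (h : s ≤ t) :
    S.rollout K x (trunc t ζ) s = S.rollout K x ζ s :=
  S.rollout_congr K x fun k hk => by simp [trunc, hk.trans_le h]

omit [MeasurableSpace Ω] in
lemma measurable_trunc_past (t s : ℕ) :
    Measurable[noisePast w (t + s)] fun ω => trunc s fun k => w (t + k) ω := by
  refine @measurable_pi_lambda _ _ _ (noisePast w (t + s)) _ _ fun k => ?_
  by_cases hk : k < s
  · simpa [trunc, hk] using measurable_noisePast (w := w) (show t + k < t + s by omega)
  · simp [trunc, hk]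

omit [MeasurableSpace Ω] in
lemma measurable_rollout_past (S : System dx du) (K : Controller dx du) (x : Fin dx → ℝ)
    (t s : ℕ) :
    Measurable[noisePast w (t + s)] fun ω => S.rollout K x (fun k => w (t + k) ω) s := by
  simp only [← fun ω => S.rollout_trunc K x (fun k => w (t + k) ω) (le_refl s)]
  have h1 : Measurable fun ζ : ℕ → Fin dx → ℝ => (K, x, ζ) :=
    measurable_const.prodMk (measurable_const.prodMk measurable_id)
  exact ((S.measurable_rollout s).comp h1).comp (measurable_trunc_past t s)

namespace IsNoise

variable (hw : IsNoise P w σ W)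
include hw

lemma noisePast_le (t : ℕ) : noisePast w t ≤ ‹MeasurableSpace Ω› :=
  iSup₂_le fun k _ => (hw.measurable k).comap_le

lemma indep_past (t : ℕ) : Indep (noisePast w t) (MeasurableSpace.comap (w t) inferInstance) P := by
  have h := indep_iSup_of_disjoint (fun k => (hw.measurable k).comap_le) hw.indep.iIndep
    (S := Set.Iio t) (T := {t}) (by simp)
  simpa [noisePast] using h

lemma indepFun_of_past {α : Type*} [MeasurableSpace α] {t : ℕ} {f : Ω → α}
    (hf : Measurable[noisePast w t] f) : IndepFun f (w t) P :=
  (IndepFun_iff_Indep _ _ _).mpr (indep_of_indep_of_le_left (hw.indep_past t) hf.comap_le)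

lemma W_nonneg [IsProbabilityMeasure P] : 0 ≤ W := by
  obtain ⟨ω, hω⟩ := (hw.bounded 0).exists
  exact (norm_nonneg _).trans hω

lemma abs_coord_le (t : ℕ) : ∀ᵐ ω ∂P, ∀ a, |w t ω a| ≤ W := by
  filter_upwards [hw.bounded t] with ω hω a
  exact (PiLp.norm_apply_le (WithLp.toLp 2 (w t ω)) a).trans hω

lemma measurable_rollout (S : System dx du) (K : Controller dx du) (x : Fin dx → ℝ) (t s : ℕ) :
    Measurable fun ω => S.rollout K x (fun k => w (t + k) ω) s :=
  (measurable_rollout_past S K x t s).mono (hw.noisePast_le _) le_rfl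

lemma rollout_bounded (S : System dx du) (K : Controller dx du) (x : Fin dx → ℝ) (t s : ℕ) :
    ∃ C, ∀ᵐ ω ∂P, euc (S.rollout K x (fun k => w (t + k) ω) s) ≤ C := by
  induction s with
  | zero => exact ⟨euc x, ae_of_all _ fun _ => le_rfl⟩
  | succ s ih =>
    obtain ⟨C, hC⟩ := ih
    refine ⟨‖S.closedLoop K‖ * C + W, ?_⟩
    filter_upwards [hC, hw.bounded (t + s)] with ω h1 h2
    rw [S.rollout_eq]
    refine (euc_add_le _ _).trans (add_le_add ((euc_mulVec_le _ _).trans ?_) h2)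
    exact mul_le_mul_of_nonneg_left h1 (norm_nonneg _)

lemma integrable_rollout_quad [IsProbabilityMeasure P] (S : System dx du) (K : Controller dx du)
    (x : Fin dx → ℝ) (t s : ℕ) (N : Matrix (Fin dx) (Fin dx) ℝ) :
    Integrable (fun ω => S.rollout K x (fun k => w (t + k) ω) s ⬝ᵥ
      N *ᵥ S.rollout K x (fun k => w (t + k) ω) s) P := by
  obtain ⟨C, hC⟩ := hw.rollout_bounded S K x t s
  have hm := hw.measurable_rollout S K x t s
  refine Integrable.of_bound (C := ‖N‖ * C ^ 2)
    (hm.dot (measurable_const.matrix_mulVec hm)).aestronglyMeasurable ?_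
  filter_upwards [hC] with ω h
  refine (abs_quad_le _ _).trans (mul_le_mul_of_nonneg_left ?_ (norm_nonneg _))
  rw [← euc_sq]
  exact pow_le_pow_left₀ (euc_nonneg _) h 2

/-- A function of the past is independent of the current noise, which is centered; this is applied
coordinate by coordinate. -/
lemma integral_bilin_eq_zero [IsProbabilityMeasure P] {t : ℕ} {y : Ω → Fin dx → ℝ}
    (hy : Measurable[noisePast w t] y) {C : ℝ} (hC : ∀ᵐ ω ∂P, euc (y ω) ≤ C) :
    Integrable (fun ω => y ω ⬝ᵥ w t ω) P ∧ ∫ ω, y ω ⬝ᵥ w t ω ∂P = 0 := by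
  have hym : Measurable y := hy.mono (hw.noisePast_le t) le_rfl
  have hyc : ∀ a, Measurable fun ω => y ω a := fun a => (measurable_pi_apply a).comp hym
  have hwc : ∀ a, Measurable fun ω => w t ω a :=
    fun a => (measurable_pi_apply a).comp (hw.measurable t)
  have hint : ∀ a, Integrable (fun ω => y ω a * w t ω a) P := fun a => by
    refine Integrable.of_bound (C := C * W) ((hyc a).mul (hwc a)).aestronglyMeasurable ?_
    filter_upwards [hC, hw.abs_coord_le t] with ω h1 h2
    rw [norm_mul]
    have h3 : ‖y ω a‖ ≤ C := (PiLp.norm_apply_le (WithLp.toLp 2 (y ω)) a).trans h1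
    exact mul_le_mul h3 (h2 a) (norm_nonneg _) ((norm_nonneg _).trans h3)
  simp only [dotProduct]
  refine ⟨integrable_finsetSum _ fun a _ => hint a, ?_⟩
  rw [integral_finsetSum _ fun a _ => hint a]
  refine Finset.sum_eq_zero fun a _ => ?_
  have hind : IndepFun (fun ω => y ω a) (fun ω => w t ω a) P :=
    (hw.indepFun_of_past hy).comp (measurable_pi_apply a) (measurable_pi_apply a)
  rw [hind.integral_fun_mul_eq_mul_integral (hyc a).aestronglyMeasurable
    (hwc a).aestronglyMeasurable, hw.mean_zero t a, mul_zero]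

lemma integral_quad [IsProbabilityMeasure P] (t : ℕ) (N : Matrix (Fin dx) (Fin dx) ℝ) :
    Integrable (fun ω => w t ω ⬝ᵥ N *ᵥ w t ω) P ∧
      ∫ ω, w t ω ⬝ᵥ N *ᵥ w t ω ∂P = (N * noiseCov P w).trace := by
  have hwc : ∀ a, Measurable fun ω => w t ω a :=
    fun a => (measurable_pi_apply a).comp (hw.measurable t)
  have hint : ∀ a b, Integrable (fun ω => w t ω a * w t ω b) P := fun a b => by
    refine Integrable.of_bound (C := W * W) ((hwc a).mul (hwc b)).aestronglyMeasurable ?_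
    filter_upwards [hw.abs_coord_le t] with ω h
    rw [norm_mul]
    exact mul_le_mul (h a) (h b) (norm_nonneg _) ((abs_nonneg _).trans (h a))
  have hcov : ∀ a b, ∫ ω, w t ω a * w t ω b ∂P = noiseCov P w a b := fun a b => by
    have h := (hw.ident t).comp (u := fun v : Fin dx → ℝ => v a * v b) (by fun_prop)
    exact h.integral_eq
  have e : ∀ ω, w t ω ⬝ᵥ N *ᵥ w t ω = ∑ a, ∑ b, N a b * (w t ω b * w t ω a) := fun ω => by
    simp only [dotProduct, Matrix.mulVec, Finset.mul_sum]
    exact Finset.sum_congr rfl fun a _ => Finset.sum_congr rfl fun b _ => by ring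
  have hi : ∀ a, Integrable (fun ω => ∑ b, N a b * (w t ω b * w t ω a)) P :=
    fun a => integrable_finsetSum _ fun b _ => (hint b a).const_mul _
  simp only [e]
  refine ⟨integrable_finsetSum _ fun a _ => hi a, ?_⟩
  rw [integral_finsetSum _ fun a _ => hi a, Matrix.trace]
  refine Finset.sum_congr rfl fun a _ => ?_
  rw [integral_finsetSum _ fun b _ => (hint b a).const_mul _, Matrix.diag, Matrix.mul_apply]
  exact Finset.sum_congr rfl fun b _ => by rw [integral_const_mul, hcov]

/-- Second moments of the state after `s` rounds from a fixed state. -/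
lemma integral_rollout_quad [IsProbabilityMeasure P] (S : System dx du) (K : Controller dx du)
    (x : Fin dx → ℝ) (t s : ℕ) (N : Matrix (Fin dx) (Fin dx) ℝ) :
    ∫ ω, S.rollout K x (fun k => w (t + k) ω) s ⬝ᵥ
        N *ᵥ S.rollout K x (fun k => w (t + k) ω) s ∂P
      = (S.closedLoop K ^ s *ᵥ x) ⬝ᵥ N *ᵥ (S.closedLoop K ^ s *ᵥ x)
        + ∑ k ∈ Finset.range s,
          ((S.closedLoop K ^ k)ᵀ * N * S.closedLoop K ^ k * noiseCov P w).trace := by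
  induction s generalizing N with
  | zero => simp [System.rollout]
  | succ s ih =>
    set A := S.closedLoop K with hA
    -- Peel off the last noise term. The cross term has mean zero, and the form `N` is pulled back
    -- to `Aᵀ N A` at the previous state; `N + Nᵀ` appears because `N` need not be symmetric.
    have e : ∀ ω, S.rollout K x (fun k => w (t + k) ω) (s + 1) ⬝ᵥ
        N *ᵥ S.rollout K x (fun k => w (t + k) ω) (s + 1)
        = S.rollout K x (fun k => w (t + k) ω) s ⬝ᵥ
            (Aᵀ * N * A) *ᵥ S.rollout K x (fun k => w (t + k) ω) s
          + (((N + Nᵀ) * A) *ᵥ S.rollout K x (fun k => w (t + k) ω) s) ⬝ᵥ w (t + s) ω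
          + w (t + s) ω ⬝ᵥ N *ᵥ w (t + s) ω := fun ω => by
      rw [S.rollout_eq, quad_conj, ← Matrix.mulVec_mulVec, Matrix.add_mulVec]
      set y := A *ᵥ S.rollout K x (fun k => w (t + k) ω) s
      rw [Matrix.mulVec_add, dotProduct_add, add_dotProduct, add_dotProduct, add_dotProduct,
        dot_mulVec_comm N y (w (t + s) ω), dotProduct_comm (w (t + s) ω) (N *ᵥ y)]
      ring
    have hm : Measurable[noisePast w (t + s)] fun ω =>
        ((N + Nᵀ) * A) *ᵥ S.rollout K x (fun k => w (t + k) ω) s :=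
      ((continuous_const.matrix_mulVec continuous_id).measurable).comp
        (measurable_rollout_past S K x t s)
    obtain ⟨C, hC⟩ := hw.rollout_bounded S K x t s
    have hC' : ∀ᵐ ω ∂P, euc (((N + Nᵀ) * A) *ᵥ S.rollout K x (fun k => w (t + k) ω) s)
        ≤ ‖(N + Nᵀ) * A‖ * C := by
      filter_upwards [hC] with ω h
      exact (euc_mulVec_le _ _).trans (mul_le_mul_of_nonneg_left h (norm_nonneg _))
    have hcross := hw.integral_bilin_eq_zero hm hC'
    have hq := hw.integral_quad (t + s) N
    have hi := hw.integrable_rollout_quad S K x t s (Aᵀ * N * A)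
    simp only [e]
    rw [integral_add (hi.fun_add hcross.1) hq.1, integral_add hi hcross.1, ih, hcross.2, hq.2,
      Finset.sum_range_succ', quad_conj, pow_succ_mulVec]
    have e2 : ∀ k, (A ^ k)ᵀ * (Aᵀ * N * A) * A ^ k * noiseCov P w
        = (A ^ (k + 1))ᵀ * N * A ^ (k + 1) * noiseCov P w := fun k => by
      rw [pow_succ' A k, Matrix.transpose_mul]
      simp only [Matrix.mul_assoc]
    simp only [e2]
    simp [add_assoc]

end IsNoise

end Moments

/-! ### The infinite horizon cost as a trace -/

namespace IsNoise

variable {dx du : ℕ} {Ω : Type*} [MeasurableSpace Ω] {P : Measure Ω} [IsProbabilityMeasure P]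
  {w : ℕ → Ω → Fin dx → ℝ} {σ W : ℝ} {S : System dx du} {a ψ ν κ : ℝ} {K : Controller dx du}

lemma J_eq_limsup (hw : IsNoise P w σ W) (h : S.Bounds (noiseCov P w) a ψ ν σ κ)
    (K : Controller dx du) :
    S.J P w K = limsup (fun n : ℕ => ENNReal.ofReal (∑ t ∈ Finset.Icc 1 n,
      ∑ k ∈ Finset.range t, ((S.closedLoop K ^ k)ᵀ * S.stageCost K * S.closedLoop K ^ k
        * noiseCov P w).trace) / (n : ℝ≥0∞)) atTop := by
  unfold System.J
  congr 1
  funext n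
  congr 1
  have hi : ∀ t, Integrable (fun ω => S.rollout K 0 (fun t => w t ω) t ⬝ᵥ
      S.stageCost K *ᵥ S.rollout K 0 (fun t => w t ω) t) P := fun t => by
    simpa using hw.integrable_rollout_quad S K 0 0 t (S.stageCost K)
  have e : ∀ t, ∫ ω, S.rollout K 0 (fun t => w t ω) t ⬝ᵥ
      S.stageCost K *ᵥ S.rollout K 0 (fun t => w t ω) t ∂P
      = ∑ k ∈ Finset.range t, ((S.closedLoop K ^ k)ᵀ * S.stageCost K * S.closedLoop K ^ k
        * noiseCov P w).trace := fun t => by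
    simpa using hw.integral_rollout_quad S K 0 0 t (S.stageCost K)
  change ∫⁻ ω, ENNReal.ofReal (∑ t ∈ Finset.Icc 1 n, S.rollout K 0 (fun t => w t ω) t ⬝ᵥ
      S.stageCost K *ᵥ S.rollout K 0 (fun t => w t ω) t) ∂P = _
  rw [← ofReal_integral_eq_lintegral_ofReal (integrable_finsetSum _ fun t _ => hi t)
    (ae_of_all _ fun ω => Finset.sum_nonneg fun t _ => posSemidef_quad_nonneg (h.stage_psd K) _),
    integral_finsetSum _ fun t _ => hi t]
  simp only [e]

omit [IsProbabilityMeasure P] in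
-- Bounds the squared Frobenius norm of the power by a term of the cost series, so that finite cost
-- will force summability.
lemma conj_trace_ge (h : S.Bounds (noiseCov P w) a ψ ν σ κ) (K : Controller dx du) (k : ℕ) :
    a * σ ^ 2 * ((S.closedLoop K ^ k)ᵀ * S.closedLoop K ^ k).trace
      ≤ ((S.closedLoop K ^ k)ᵀ * S.stageCost K * S.closedLoop K ^ k * noiseCov P w).trace := by
  set M := S.closedLoop K ^ k
  have h1 : a * (Mᵀ * M * noiseCov P w).trace ≤ (Mᵀ * S.stageCost K * M * noiseCov P w).trace := by
    have := trace_mul_le_of_quad (G := a • (Mᵀ * M)) (H := Mᵀ * S.stageCost K * M) h.V_psd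
      fun x => by
        rw [quad_conj, Matrix.smul_mulVec, dotProduct_smul, smul_eq_mul, ← Matrix.mulVec_mulVec,
          dot_mulVec_comm, Matrix.transpose_transpose]
        exact h.stage_ge K _
    simpa using this
  have hps : (Mᵀ * M).PosSemidef := by
    have := Matrix.posSemidef_conjTranspose_mul_self M
    rwa [Matrix.conjTranspose_eq_transpose_of_trivial] at this
  have h2 := trace_mul_ge hps h.V_ge
  rw [Matrix.trace_mul_comm (noiseCov P w)] at h2
  have := mul_le_mul_of_nonneg_left h2 h.a_pos.le
  linarith

/-- A controller of finite cost is stable. -/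
lemma stable_of_J_lt_top (hw : IsNoise P w σ W) (h : S.Bounds (noiseCov P w) a ψ ν σ κ)
    (hK : S.J P w K < ∞) : StableMat (S.closedLoop K) := by
  set g : ℕ → ℝ := fun k => ((S.closedLoop K ^ k)ᵀ * S.stageCost K * S.closedLoop K ^ k
        * noiseCov P w).trace
  have ha := h.a_pos
  have hs := h.sigma_pos
  have htr : ∀ k, ‖S.closedLoop K ^ k‖ ^ 2 ≤ (a * σ ^ 2)⁻¹ * g k := fun k => by
    rw [inv_mul_eq_div, le_div_iff₀ (by positivity), mul_comm]
    exact (mul_le_mul_of_nonneg_left (norm_le_sqrt_trace _) (by positivity)).trans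
      (conj_trace_ge h K k)
  have hg : ∀ k, 0 ≤ g k := fun k => by
    have h0 := (sq_nonneg ‖S.closedLoop K ^ k‖).trans (htr k)
    exact nonneg_of_mul_nonneg_right h0 (by positivity)
  rw [hw.J_eq_limsup h] at hK
  obtain ⟨c, hc1, hc2⟩ := exists_between hK
  have hc3 := eventually_lt_of_limsup_lt hc1
  refine stableMat_of_trace_bounded (c := (a * σ ^ 2)⁻¹ * (2 * c.toReal)) fun N => ?_
  refine (Finset.sum_le_sum fun k _ => htr k).trans ?_
  rw [← Finset.mul_sum]
  refine mul_le_mul_of_nonneg_left ?_ (by positivity)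
  -- With `n ≥ 2 N + 2`, at least half of the times up to `n` exceed `N`, and each of them
  -- contributes at least the partial sum `G`; the average is then at least `G / 2`.
  obtain ⟨n, hn1, hn2⟩ := (hc3.and (eventually_ge_atTop (2 * N + 2))).exists
  set G := ∑ k ∈ Finset.range N, g k
  have hG0 : 0 ≤ G := Finset.sum_nonneg fun k _ => hg k
  have hsum : (n : ℝ) / 2 * G ≤ ∑ t ∈ Finset.Icc 1 n, ∑ k ∈ Finset.range t, g k := by
    have h1 : ∑ t ∈ Finset.Icc (N + 1) n, G ≤ ∑ t ∈ Finset.Icc (N + 1) n,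
        ∑ k ∈ Finset.range t, g k := by
      refine Finset.sum_le_sum fun t ht => ?_
      refine Finset.sum_le_sum_of_subset_of_nonneg ?_ fun k _ _ => hg k
      exact Finset.range_subset_range.mpr (by have := (Finset.mem_Icc.mp ht).1; omega)
    have h2 : ∑ t ∈ Finset.Icc (N + 1) n, ∑ k ∈ Finset.range t, g k
        ≤ ∑ t ∈ Finset.Icc 1 n, ∑ k ∈ Finset.range t, g k :=
      Finset.sum_le_sum_of_subset_of_nonneg (Finset.Icc_subset_Icc (by omega) le_rfl)
        fun t _ _ => Finset.sum_nonneg fun k _ => hg k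
    refine le_trans ?_ (h1.trans h2)
    rw [Finset.sum_const, Nat.card_Icc, nsmul_eq_mul]
    refine mul_le_mul_of_nonneg_right ?_ hG0
    have h3 : n ≤ 2 * (n + 1 - (N + 1)) := by omega
    have h4 : (n : ℝ) ≤ 2 * ((n + 1 - (N + 1) : ℕ) : ℝ) := by exact_mod_cast h3
    linarith
  have hn0 : (0 : ℝ) < n := by
    have : 0 < n := by omega
    exact_mod_cast this
  rw [ENNReal.div_lt_iff (Or.inl (by simpa using hn0.ne')) (Or.inl (by simp)),
    ← ENNReal.ofReal_toReal hc2.ne, ← ENNReal.ofReal_natCast,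
    ← ENNReal.ofReal_mul ENNReal.toReal_nonneg] at hn1
  have h5 := (ENNReal.ofReal_lt_ofReal_iff_of_nonneg
    ((by positivity : (0 : ℝ) ≤ n / 2 * G).trans hsum)).mp hn1
  have h6 : (n : ℝ) * G ≤ n * (2 * c.toReal) := by nlinarith
  exact le_of_mul_le_mul_left h6 hn0

/-- The cost of a stable controller. -/
lemma J_eq_avgCost (hw : IsNoise P w σ W) (h : S.Bounds (noiseCov P w) a ψ ν σ κ)
    (hK : StableMat (S.closedLoop K)) :
    S.J P w K = ENNReal.ofReal (S.avgCost (noiseCov P w) K) := by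
  rw [hw.J_eq_limsup h]
  refine Tendsto.limsup_eq ?_
  have h1 := (hK.hasSum_trace (S.stageCost K) (noiseCov P w)).tendsto_sum_nat
  -- The shift by one is there because the average in `J` runs over the times from `1` to `n`.
  have h2 := (h1.comp (tendsto_add_atTop_nat 1)).cesaro
  refine (ENNReal.tendsto_ofReal h2).congr' ?_
  filter_upwards [eventually_gt_atTop 0] with n hn
  have hn' : (0 : ℝ) < n := by exact_mod_cast hn
  rw [← ENNReal.ofReal_natCast n, ← ENNReal.ofReal_div_of_pos hn', div_eq_inv_mul]
  congr 2
  simp only [Function.comp_apply]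
  rw [Finset.range_eq_Ico, Finset.sum_Ico_add' (fun t => ∑ k ∈ Finset.range t,
    ((S.closedLoop K ^ k)ᵀ * S.stageCost K * S.closedLoop K ^ k * noiseCov P w).trace) 0 n 1]
  rfl

lemma fine_of_J_le (hw : IsNoise P w σ W) (h : S.Bounds (noiseCov P w) a ψ ν σ κ) {c : ℝ}
    (hc : 0 ≤ c) (hK : S.J P w K ≤ ENNReal.ofReal c) : S.Fine (noiseCov P w) c K := by
  have hst := hw.stable_of_J_lt_top h (hK.trans_lt ENNReal.ofReal_lt_top)
  refine ⟨hst, ?_⟩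
  rw [hw.J_eq_avgCost h hst] at hK
  exact (ENNReal.ofReal_le_ofReal_iff hc).mp hK

end IsNoise

/-! ### Concentration for chains driven by independent innovations -/

section Azuma

variable {Ω : Type*} {m : MeasurableSpace Ω} [mΩ : MeasurableSpace Ω] {P : Measure Ω} [IsProbabilityMeasure P]
  {𝒵 Ξ : Type*} [MeasurableSpace 𝒵] [MeasurableSpace Ξ]

lemma map_prod_of_indep (hm : m ≤ mΩ) {Z : Ω → 𝒵} {ξ : Ω → Ξ}
    (hZ : Measurable[m] Z) (hξ : Measurable ξ)
    (hi : Indep m (MeasurableSpace.comap ξ inferInstance) P) :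
    P.map (fun ω => (Z ω, ξ ω)) = (P.map Z).prod (P.map ξ) := by
  have h : IndepFun Z ξ P :=
    (IndepFun_iff_Indep _ _ _).mpr (indep_of_indep_of_le_left hi hZ.comap_le)
  exact (indepFun_iff_map_prod_eq_prod_map_map (hZ.mono hm le_rfl).aemeasurable
    hξ.aemeasurable).mp h

/-- Fubini for the product law. It takes the place of conditional expectation: the past is frozen
and only the innovation is integrated. -/
lemma lintegral_of_indep (hm : m ≤ mΩ) {Z : Ω → 𝒵} {ξ : Ω → Ξ}
    (hZ : Measurable[m] Z) (hξ : Measurable ξ)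
    (hi : Indep m (MeasurableSpace.comap ξ inferInstance) P)
    {f : 𝒵 → Ξ → ℝ≥0∞} (hf : Measurable (Function.uncurry f)) :
    ∫⁻ ω, f (Z ω) (ξ ω) ∂P = ∫⁻ ω, ∫⁻ ω', f (Z ω) (ξ ω') ∂P ∂P := by
  have hZ' : Measurable Z := hZ.mono hm le_rfl
  have e1 : ∫⁻ ω, f (Z ω) (ξ ω) ∂P
      = ∫⁻ p, Function.uncurry f p ∂(P.map fun ω => (Z ω, ξ ω)) := by
    rw [lintegral_map hf (hZ'.prodMk hξ)]
    rfl
  rw [e1, map_prod_of_indep hm hZ hξ hi]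
  have : IsProbabilityMeasure (P.map ξ) := Measure.isProbabilityMeasure_map hξ.aemeasurable
  rw [lintegral_prod _ hf.aemeasurable, lintegral_map hf.lintegral_prod_right' hZ']
  refine lintegral_congr fun ω => ?_
  exact lintegral_map (f := fun x => Function.uncurry f (Z ω, x))
    (hf.comp measurable_prodMk_left) hξ

/-- The exceptional null set may depend on the frozen value; integrating its indicator shows that
the random past value does not meet it. -/
lemma ae_of_indep (hm : m ≤ mΩ) {Z : Ω → 𝒵} {ξ : Ω → Ξ}
    (hZ : Measurable[m] Z) (hξ : Measurable ξ)
    (hi : Indep m (MeasurableSpace.comap ξ inferInstance) P)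
    {p : 𝒵 → Ξ → Prop} (hp : MeasurableSet {q : 𝒵 × Ξ | p q.1 q.2})
    (h : ∀ z, ∀ᵐ ω ∂P, p z (ξ ω)) : ∀ᵐ ω ∂P, p (Z ω) (ξ ω) := by
  have hZ' : Measurable Z := hZ.mono hm le_rfl
  have e := lintegral_of_indep (P := P) hm hZ hξ hi
    (f := fun z x => {q : 𝒵 × Ξ | p q.1 q.2}ᶜ.indicator 1 (z, x))
    ((measurable_const (a := (1 : ℝ≥0∞))).indicator hp.compl)
  have h0 : ∀ ω, ∫⁻ ω', {q : 𝒵 × Ξ | p q.1 q.2}ᶜ.indicator (1 : 𝒵 × Ξ → ℝ≥0∞) (Z ω, ξ ω') ∂P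
      = 0 := fun ω => by
    rw [lintegral_congr_ae (g := fun _ => 0), lintegral_zero]
    filter_upwards [h (Z ω)] with ω' hω'
    simp [hω']
  simp only [h0, lintegral_zero] at e
  replace e := (lintegral_eq_zero_iff
    (((measurable_const (a := (1 : ℝ≥0∞))).indicator hp.compl).comp (hZ'.prodMk hξ))).mp e
  filter_upwards [e] with ω hω
  by_contra hc
  simp [hc] at hω

/-- Hoeffding's lemma on `[-c, c]`, with variance proxy `c²`. Only an upper bound on the mean is
known, which is why `t ≥ 0` is required. -/
lemma lintegral_exp_le {X : Ω → ℝ} (hX : Measurable X) {b c t : ℝ} (ht : 0 ≤ t) (hc : 0 ≤ c)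
    (hb : ∀ᵐ ω ∂P, |X ω| ≤ c) (hm : ∫ ω, X ω ∂P ≤ b) :
    ∫⁻ ω, ENNReal.ofReal (Real.exp (t * X ω)) ∂P
      ≤ ENNReal.ofReal (Real.exp (t * b + c ^ 2 * t ^ 2 / 2)) := by
  have hs := hasSubgaussianMGF_of_mem_Icc (μ := P) (a := -c) (b := c) hX.aemeasurable
    (by filter_upwards [hb] with ω h using abs_le.mp h)
  set e := ∫ ω, X ω ∂P
  have h1 := hs.mgf_le t
  have hp : (((‖c - -c‖₊ / 2) ^ 2 : NNReal) : ℝ) = c ^ 2 := by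
    push_cast
    rw [sub_neg_eq_add, Real.norm_of_nonneg (by linarith)]
    ring
  rw [hp] at h1
  rw [← ofReal_integral_eq_lintegral_ofReal]
  · refine ENNReal.ofReal_le_ofReal ?_
    have h2 : ∀ ω, Real.exp (t * X ω) = Real.exp (t * e) * Real.exp (t * (X ω - e)) := fun ω => by
      rw [← Real.exp_add]; congr 1; ring
    simp only [h2]
    rw [integral_const_mul, Real.exp_add]
    exact mul_le_mul (Real.exp_le_exp.mpr (mul_le_mul_of_nonneg_left hm ht)) h1
      (integral_nonneg fun _ => (Real.exp_pos _).le) (Real.exp_pos _).le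
  · refine Integrable.of_bound (C := Real.exp (t * c)) (by fun_prop) ?_
    filter_upwards [hb] with ω h
    rw [Real.norm_of_nonneg (Real.exp_pos _).le]
    exact Real.exp_le_exp.mpr (mul_le_mul_of_nonneg_left (abs_le.mp h).2 ht)
  · exact ae_of_all _ fun _ => (Real.exp_pos _).le

/-- A sequence of states, each a function of the past, driven by innovations independent of
the past. -/
structure IsChain (P : Measure Ω) (F : ℕ → MeasurableSpace Ω) (Z : ℕ → Ω → 𝒵) (ξ : ℕ → Ω → Ξ) :
    Prop where
  mono : Monotone F
  le : ∀ n, F n ≤ mΩ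
  state : ∀ n, Measurable[F n] (Z n)
  innov : ∀ n, Measurable[F (n + 1)] (ξ n)
  indep : ∀ n, Indep (F n) (MeasurableSpace.comap (ξ n) inferInstance) P

namespace IsChain

variable {F : ℕ → MeasurableSpace Ω} {Z : ℕ → Ω → 𝒵} {ξ : ℕ → Ω → Ξ}

omit [IsProbabilityMeasure P] in
lemma measurable_innov (h : IsChain P F Z ξ) (n : ℕ) : Measurable (ξ n) :=
  (h.innov n).mono (h.le _) le_rfl

omit [IsProbabilityMeasure P] in
lemma measurable_sum (h : IsChain P F Z ξ) {E : Type*} [AddCommMonoid E] [MeasurableSpace E]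
    [MeasurableAdd₂ E] {D : ℕ → 𝒵 → Ξ → E} (hD : ∀ n, Measurable (Function.uncurry (D n)))
    (n : ℕ) : Measurable[F n] fun ω => ∑ k ∈ Finset.range n, D k (Z k ω) (ξ k ω) := by
  refine Finset.measurable_fun_sum _ fun k hk => ?_
  have hk' := Finset.mem_range.mp hk
  have h1 : Measurable[F n] fun ω => (Z k ω, ξ k ω) :=
    ((h.state k).mono (h.mono hk'.le) le_rfl).prodMk ((h.innov k).mono (h.mono hk') le_rfl)
  exact (hD k).comp h1

/-- Azuma's inequality for chains. -/
lemma azuma (h : IsChain P F Z ξ) {D : ℕ → 𝒵 → Ξ → ℝ}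
    (hD : ∀ n, Measurable (Function.uncurry (D n))) {b c L : ℝ} (hc : 0 < c) (hL : 0 ≤ L)
    (hb : ∀ n z, ∀ᵐ ω ∂P, |D n z (ξ n ω)| ≤ c) (hm : ∀ n z, ∫ ω, D n z (ξ n ω) ∂P ≤ b)
    {N : ℕ} (hN : 0 < N) :
    P {ω | N * b + c * √(2 * N * L) ≤ ∑ k ∈ Finset.range N, D k (Z k ω) (ξ k ω)}
      ≤ ENNReal.ofReal (Real.exp (-L)) := by
  have key : ∀ t : ℝ, 0 ≤ t → ∀ n : ℕ,
      ∫⁻ ω, ENNReal.ofReal (Real.exp (t * ∑ k ∈ Finset.range n, D k (Z k ω) (ξ k ω))) ∂P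
        ≤ ENNReal.ofReal (Real.exp (n * (t * b + c ^ 2 * t ^ 2 / 2))) := by
    intro t ht n
    induction n with
    | zero => simp
    | succ n ih =>
      -- The pair of partial sum and state is frozen, so the factor of the last increment can be
      -- bounded uniformly and pulled out.
      have hZS : Measurable[F n] fun ω =>
          ((∑ k ∈ Finset.range n, D k (Z k ω) (ξ k ω), Z n ω) : ℝ × 𝒵) :=
        (h.measurable_sum hD n).prodMk (h.state n)
      have e := lintegral_of_indep (P := P) (h.le n) hZS (h.measurable_innov n) (h.indep n)
        (f := fun sz x => ENNReal.ofReal (Real.exp (t * (sz.1 + D n sz.2 x)))) (by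
          have h1 : Measurable fun p : (ℝ × 𝒵) × Ξ => D n p.1.2 p.2 :=
            (hD n).comp ((measurable_snd.comp measurable_fst).prodMk measurable_snd)
          have h2 : Measurable fun p : (ℝ × 𝒵) × Ξ => p.1.1 := measurable_fst.comp measurable_fst
          exact (Real.measurable_exp.comp ((h2.add h1).const_mul t)).ennreal_ofReal)
      simp only [Finset.sum_range_succ]
      rw [e]
      have h3 : ∀ s z, ∫⁻ ω', ENNReal.ofReal (Real.exp (t * (s + D n z (ξ n ω')))) ∂P
          ≤ ENNReal.ofReal (Real.exp (t * s))
            * ENNReal.ofReal (Real.exp (t * b + c ^ 2 * t ^ 2 / 2)) := fun s z => by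
        have hX : Measurable fun ω => D n z (ξ n ω) :=
          ((hD n).comp measurable_prodMk_left).comp (h.measurable_innov n)
        simp only [mul_add, Real.exp_add, ENNReal.ofReal_mul (Real.exp_pos _).le]
        rw [lintegral_const_mul _ (hX.const_mul t).exp.ennreal_ofReal, ← ENNReal.ofReal_mul (Real.exp_pos _).le,
          ← Real.exp_add]
        exact mul_le_mul_right (lintegral_exp_le hX ht hc.le (hb n z) (hm n z)) _
      refine (lintegral_mono fun ω => h3 _ _).trans ?_
      rw [lintegral_mul_const']
      · refine (mul_le_mul_left ih _).trans ?_
        rw [← ENNReal.ofReal_mul (Real.exp_pos _).le, ← Real.exp_add]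
        refine le_of_eq ?_
        push_cast
        ring_nf
      · exact ENNReal.ofReal_ne_top
  have hN' : (0 : ℝ) < N := by exact_mod_cast hN
  set ε := c * √(2 * N * L) with hε
  have hε0 : 0 ≤ ε := by positivity
  -- The minimizer of the Chernoff exponent `-t ε + N c² t² / 2`.
  set t := ε / (N * c ^ 2) with ht
  have ht0 : 0 ≤ t := by positivity
  have hmeas : Measurable fun ω => ∑ k ∈ Finset.range N, D k (Z k ω) (ξ k ω) :=
    (h.measurable_sum hD N).mono (h.le N) le_rfl
  have hsub : {ω | N * b + ε ≤ ∑ k ∈ Finset.range N, D k (Z k ω) (ξ k ω)}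
      ⊆ {ω | ENNReal.ofReal (Real.exp (t * (N * b + ε)))
        ≤ ENNReal.ofReal (Real.exp (t * ∑ k ∈ Finset.range N, D k (Z k ω) (ξ k ω)))} :=
    fun ω hω => ENNReal.ofReal_le_ofReal (Real.exp_le_exp.mpr (mul_le_mul_of_nonneg_left hω ht0))
  refine (measure_mono hsub).trans ?_
  refine (meas_ge_le_lintegral_div (hmeas.const_mul t).exp.ennreal_ofReal.aemeasurable (by simp [Real.exp_pos])
    ENNReal.ofReal_ne_top).trans ?_
  refine (ENNReal.div_le_div_right (key t ht0 N) _).trans ?_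
  rw [← ENNReal.ofReal_div_of_pos (Real.exp_pos _), ← Real.exp_sub]
  refine ENNReal.ofReal_le_ofReal (Real.exp_le_exp.mpr (le_of_eq ?_))
  have h1 : ε ^ 2 = c ^ 2 * (2 * N * L) := by
    rw [hε, mul_pow, Real.sq_sqrt (by positivity)]
  have h2 : t * ε = 2 * L := by
    rw [ht, div_mul_eq_mul_div, ← sq, h1]; field_simp
  have h3 : N * (c ^ 2 * t ^ 2) = t * ε := by
    rw [ht]; field_simp
  linarith

/-- A dimension-free version of Azuma's inequality for vectors. -/
lemma azuma_norm {E : Type*} [NormedAddCommGroup E] [InnerProductSpace ℝ E] [MeasurableSpace E]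
    [BorelSpace E] [SecondCountableTopology E] [CompleteSpace E]
    (h : IsChain P F Z ξ) {D : ℕ → 𝒵 → Ξ → E}
    (hD : ∀ n, Measurable (Function.uncurry (D n))) {c L : ℝ} (hc : 0 < c) (hL : 0 ≤ L)
    (hb : ∀ n z, ∀ᵐ ω ∂P, ‖D n z (ξ n ω)‖ ≤ c) (hm : ∀ n z, ∫ ω, D n z (ξ n ω) ∂P = 0)
    {N : ℕ} (hN : 0 < N) :
    P {ω | c * √N * (3 / 2) + c * √(2 * N * L) ≤ ‖∑ k ∈ Finset.range N, D k (Z k ω) (ξ k ω)‖}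
      ≤ ENNReal.ofReal (Real.exp (-L)) := by
  have hN' : (0 : ℝ) < N := by exact_mod_cast hN
  -- A smoothed norm that never falls below `c √N`. Its first-order increments are scalars bounded
  -- by `c` with mean zero, and its second-order error is at most `c / (2 √N)` per step, in total `c
  -- √N / 2`; with `φ 0 = c √N` this is the factor `3 / 2`.
  set φ : E → ℝ := fun s => √(‖s‖ ^ 2 + c ^ 2 * N) with hφ
  have hφpos : ∀ s, 0 < φ s := fun s => Real.sqrt_pos.mpr (by positivity)
  have hφsq : ∀ s, φ s ^ 2 = ‖s‖ ^ 2 + c ^ 2 * N := fun s => Real.sq_sqrt (by positivity)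
  have hφnorm : ∀ s, ‖s‖ ≤ φ s := fun s =>
    Real.le_sqrt_of_sq_le (by nlinarith [show 0 < c ^ 2 * N by positivity])
  have hφge : ∀ s, c * √N ≤ φ s := fun s => by
    refine Real.le_sqrt_of_sq_le ?_
    rw [mul_pow, Real.sq_sqrt hN'.le]
    nlinarith [sq_nonneg ‖s‖]
  have hφ0 : φ 0 = c * √N := by
    simp only [hφ, norm_zero]
    rw [zero_pow two_ne_zero, zero_add, Real.sqrt_mul (sq_nonneg c), Real.sqrt_sq hc.le]
  have hφm : Measurable φ := (by fun_prop : Continuous φ).measurable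
  set S : ℕ → Ω → E := fun n ω => ∑ k ∈ Finset.range n, D k (Z k ω) (ξ k ω) with hS
  -- The state is enlarged by the partial sum, which makes the scalar increments functions of state
  -- and innovation.
  have hchain : IsChain P F (fun n ω => (S n ω, Z n ω)) ξ :=
    { mono := h.mono, le := h.le, innov := h.innov, indep := h.indep
      state := fun n => (h.measurable_sum hD n).prodMk (h.state n) }
  have hDm : ∀ n z, Measurable fun ω => D n z (ξ n ω) := fun n z =>
    ((hD n).comp measurable_prodMk_left).comp (h.measurable_innov n)
  have haz := hchain.azuma (D := fun n sz x => inner ℝ sz.1 (D n sz.2 x) / φ sz.1) (b := 0)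
    (fun n => by
      have h1 : Measurable fun p : (E × 𝒵) × Ξ => D n p.1.2 p.2 :=
        (hD n).comp ((measurable_snd.comp measurable_fst).prodMk measurable_snd)
      have h2 : Measurable fun p : (E × 𝒵) × Ξ => p.1.1 := measurable_fst.comp measurable_fst
      exact (h2.inner h1).div (hφm.comp h2)) hc hL
    (fun n sz => by
      filter_upwards [hb n sz.2] with ω hω
      rw [abs_div, abs_of_pos (hφpos _), div_le_iff₀ (hφpos _)]
      refine (abs_real_inner_le_norm _ _).trans ?_
      rw [mul_comm]
      exact mul_le_mul hω (hφnorm _) (norm_nonneg _) hc.le)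
    (fun n sz => by
      have hint : Integrable (fun ω => D n sz.2 (ξ n ω)) P :=
        Integrable.of_bound (hDm n sz.2).aestronglyMeasurable c (hb n sz.2)
      rw [integral_div, integral_inner hint, hm, inner_zero_right, zero_div]) hN
  have hae : ∀ᵐ ω ∂P, ∀ n, ‖D n (Z n ω) (ξ n ω)‖ ≤ c := by
    rw [ae_all_iff]
    exact fun n => ae_of_indep (h.le n) (h.state n) (h.measurable_innov n) (h.indep n)
      (p := fun z x => ‖D n z x‖ ≤ c) (measurableSet_le (hD n).norm measurable_const) (hb n)
  refine le_trans (measure_mono_ae ?_) haz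
  filter_upwards [hae] with ω hω hω2
  change (N : ℝ) * 0 + c * √(2 * N * L)
    ≤ ∑ k ∈ Finset.range N, inner ℝ (S k ω) (D k (Z k ω) (ξ k ω)) / φ (S k ω)
  have hstep : ∀ s x : E, ‖x‖ ≤ c → φ (s + x) ≤ φ s + inner ℝ s x / φ s + c / (2 * √N) := by
    intro s x hx
    have hp := hφpos s
    have hsn : 0 < √(N : ℝ) := Real.sqrt_pos.mpr hN'
    have h1 : φ (s + x) ≤ φ s + inner ℝ s x / φ s + ‖x‖ ^ 2 / (2 * φ s) := by
      refine Real.sqrt_le_iff.mpr ⟨?_, ?_⟩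
      · have h2 : -(‖s‖ * ‖x‖) ≤ inner ℝ s x := (abs_le.mp (abs_real_inner_le_norm s x)).1
        have h3 : φ s + inner ℝ s x / φ s + ‖x‖ ^ 2 / (2 * φ s)
            = (2 * φ s ^ 2 + 2 * inner ℝ s x + ‖x‖ ^ 2) / (2 * φ s) := by field_simp
        rw [h3]
        refine div_nonneg ?_ (by positivity)
        rw [hφsq]
        nlinarith [sq_nonneg (‖s‖ - ‖x‖), show 0 < c ^ 2 * N by positivity, sq_nonneg ‖s‖]
      · have h2 : (φ s + inner ℝ s x / φ s + ‖x‖ ^ 2 / (2 * φ s)) ^ 2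
            = φ s ^ 2 + 2 * (inner ℝ s x + ‖x‖ ^ 2 / 2)
              + (inner ℝ s x / φ s + ‖x‖ ^ 2 / (2 * φ s)) ^ 2 := by
          field_simp; ring
        rw [h2, hφsq, norm_add_sq_real]
        nlinarith [sq_nonneg (inner ℝ s x / φ s + ‖x‖ ^ 2 / (2 * φ s))]
    refine h1.trans (add_le_add le_rfl ?_)
    calc ‖x‖ ^ 2 / (2 * φ s) ≤ c ^ 2 / (2 * (c * √N)) := by
          gcongr
          exact hφge s
      _ = c / (2 * √N) := by field_simp
  have hsum : ∀ n, φ (S n ω) ≤ φ 0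
      + ∑ k ∈ Finset.range n, inner ℝ (S k ω) (D k (Z k ω) (ξ k ω)) / φ (S k ω)
      + n * (c / (2 * √N)) := by
    intro n
    induction n with
    | zero => simp [hS]
    | succ n ih =>
      have h1 := hstep (S n ω) (D n (Z n ω) (ξ n ω)) (hω n)
      have h2 : S (n + 1) ω = S n ω + D n (Z n ω) (ξ n ω) := Finset.sum_range_succ _ _
      rw [h2, Finset.sum_range_succ]
      push_cast
      linarith
  have h1 := hsum N
  have h2 : (N : ℝ) * (c / (2 * √N)) = c * √N / 2 := by
    have hsn : 0 < √(N : ℝ) := Real.sqrt_pos.mpr hN'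
    have : (N : ℝ) = √N * √N := (Real.mul_self_sqrt hN'.le).symm
    nth_rewrite 1 [this]
    field_simp
  have h3 : c * √N * (3 / 2) + c * √(2 * N * L) ≤ ‖S N ω‖ := hω2
  have h4 := hφnorm (S N ω)
  rw [h2, hφ0] at h1
  linarith

end IsChain

end Azuma

/-! ### Uniform directions and the one-point gradient estimate -/

section Direction

variable {Ω : Type*} [MeasurableSpace Ω] {P : Measure Ω} {ι : Type*} [Fintype ι]

/-- A random unit vector whose law is invariant under isometries. -/
structure IsUniformDirection (P : Measure Ω) (u : Ω → EuclideanSpace ℝ ι) : Prop where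
  measurable : Measurable u
  norm_eq : ∀ᵐ ω ∂P, ‖u ω‖ = 1
  norm_le : ∀ ω, ‖u ω‖ ≤ 1
  ident : ∀ T : EuclideanSpace ℝ ι ≃ₗᵢ[ℝ] EuclideanSpace ℝ ι,
    IdentDistrib (fun ω => T (u ω)) u P P

namespace IsUniformDirection

variable {u : Ω → EuclideanSpace ℝ ι} (hu : IsUniformDirection P u)
include hu

lemma integrable_of_bounded [IsProbabilityMeasure P] {f : EuclideanSpace ℝ ι → ℝ}
    (hf : Measurable f) {C : ℝ} (hC : ∀ x, ‖x‖ ≤ 1 → |f x| ≤ C) :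
    Integrable (fun ω => f (u ω)) P :=
  Integrable.of_bound (hf.comp hu.measurable).aestronglyMeasurable C
    (ae_of_all _ fun ω => hC _ (hu.norm_le ω))

lemma integral_comp_isometry (T : EuclideanSpace ℝ ι ≃ₗᵢ[ℝ] EuclideanSpace ℝ ι)
    {f : EuclideanSpace ℝ ι → ℝ} (hf : Measurable f) :
    ∫ ω, f (T (u ω)) ∂P = ∫ ω, f (u ω) ∂P :=
  ((hu.ident T).comp hf).integral_eq

omit [MeasurableSpace Ω] hu in
lemma abs_inner_le (v : EuclideanSpace ℝ ι) {x : EuclideanSpace ℝ ι} (hx : ‖x‖ ≤ 1) :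
    |inner ℝ v x| ≤ ‖v‖ :=
  (abs_real_inner_le_norm v x).trans (mul_le_of_le_one_right (norm_nonneg v) hx)

lemma integrable_inner_sq [IsProbabilityMeasure P] (v : EuclideanSpace ℝ ι) :
    Integrable (fun ω => inner ℝ v (u ω) ^ 2) P :=
  hu.integrable_of_bounded (f := fun x => inner ℝ v x ^ 2) (by fun_prop) (C := ‖v‖ ^ 2)
    fun x hx => by
      rw [abs_of_nonneg (sq_nonneg _), ← sq_abs]
      exact pow_le_pow_left₀ (abs_nonneg _) (abs_inner_le v hx) 2

/-- The reflection that exchanges two vectors of equal norm preserves the law of `u`. -/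
lemma integral_inner_sq_eq_of_norm_eq {v v' : EuclideanSpace ℝ ι} (h : ‖v‖ = ‖v'‖) :
    ∫ ω, inner ℝ v (u ω) ^ 2 ∂P = ∫ ω, inner ℝ v' (u ω) ^ 2 ∂P := by
  set T := Submodule.reflection (Submodule.span ℝ {v - v'})ᗮ
  have hT : T v = v' := Submodule.reflection_sub h
  rw [← hT, ← hu.integral_comp_isometry T (f := fun x => inner ℝ (T v) x ^ 2) (by fun_prop)]
  simp only [LinearIsometryEquiv.inner_map_map]

/-- By invariance all basis directions have the same second moment, and over an orthonormal basis
these moments add up to that of a unit vector. -/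
lemma integral_inner_sq [IsProbabilityMeasure P] [Nonempty ι] (v : EuclideanSpace ℝ ι) :
    ∫ ω, inner ℝ v (u ω) ^ 2 ∂P = ‖v‖ ^ 2 / Fintype.card ι := by
  classical
  set b := EuclideanSpace.basisFun ι ℝ
  have h1 : ∀ i, ∫ ω, inner ℝ v (u ω) ^ 2 ∂P = ∫ ω, inner ℝ (‖v‖ • b i) (u ω) ^ 2 ∂P := fun i =>
    hu.integral_inner_sq_eq_of_norm_eq (by simp [norm_smul, b])
  have h2 : ∑ i, ∫ ω, inner ℝ (‖v‖ • b i) (u ω) ^ 2 ∂P = ‖v‖ ^ 2 := by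
    rw [← integral_finsetSum _ fun i _ => hu.integrable_inner_sq _]
    have h3 : ∀ᵐ ω ∂P, ∑ i, inner ℝ (‖v‖ • b i) (u ω) ^ 2 = ‖v‖ ^ 2 := by
      filter_upwards [hu.norm_eq] with ω hω
      have h4 : ∑ i, inner ℝ (b i) (u ω) ^ 2 = ‖u ω‖ ^ 2 := b.sum_sq_inner_right (u ω)
      simp only [real_inner_smul_left, mul_pow]
      rw [← Finset.mul_sum, h4, hω]
      ring
    rw [integral_congr_ae h3]
    simp
  rw [← Finset.sum_congr rfl fun i _ => h1 i] at h2
  rw [Finset.sum_const, Finset.card_univ, nsmul_eq_mul] at h2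
  rw [eq_div_iff (by exact_mod_cast Fintype.card_ne_zero), mul_comm]
  exact h2

/-- The one-point gradient estimate: its bias is at most the Lipschitz constant of the deviation of
the function from its linear approximation. -/
lemma norm_onePoint_sub_le [IsProbabilityMeasure P] [Nonempty ι] {f : EuclideanSpace ℝ ι → ℝ}
    (hf : Measurable f) {g : EuclideanSpace ℝ ι} {ε : ℝ}
    (h : ∀ x y, ‖x‖ ≤ 1 → ‖y‖ ≤ 1 → |f x - f y - inner ℝ g (x - y)| ≤ ε * ‖x - y‖) :
    ‖(Fintype.card ι : ℝ) • ∫ ω, f (u ω) • u ω ∂P - g‖ ≤ ε := by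
  set d : ℝ := (Fintype.card ι : ℝ)
  have hd : 0 < d := by
    exact Nat.cast_pos.mpr Fintype.card_pos
  have hfb : ∀ x, ‖x‖ ≤ 1 → |f x| ≤ |f 0| + ‖g‖ + |ε| := fun x hx => by
    have h1 := h x 0 hx (by simp)
    rw [sub_zero] at h1
    have h2 := abs_inner_le g hx
    have h3 : ε * ‖x‖ ≤ |ε| := (mul_le_mul_of_nonneg_right (le_abs_self ε) (norm_nonneg x)).trans
      (mul_le_of_le_one_right (abs_nonneg ε) hx)
    have h4 : f x = (f x - f 0 - inner ℝ g x) + f 0 + inner ℝ g x := by ring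
    rw [h4]
    exact (abs_add_three _ _ _).trans (by linarith)
  have hint : Integrable (fun ω => f (u ω) • u ω) P := by
    refine Integrable.of_bound ((hf.comp hu.measurable).smul hu.measurable).aestronglyMeasurable
      (|f 0| + ‖g‖ + |ε|) (ae_of_all _ fun ω => ?_)
    rw [norm_smul]
    exact (mul_le_of_le_one_right (norm_nonneg _) (hu.norm_le ω)).trans (hfb _ (hu.norm_le ω))
  have key : ∀ v : EuclideanSpace ℝ ι, v ≠ 0 →
      inner ℝ v (d • ∫ ω, f (u ω) • u ω ∂P - g) ≤ ε * ‖v‖ := by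
    intro v hv
    have hv' : 0 < ‖v‖ := norm_pos_iff.mpr hv
    -- The reflection in the hyperplane orthogonal to `v` reverses the sign of `⟨v, u⟩`.
    -- Symmetrizing expresses the mean of `f(u) ⟨v, u⟩` through differences of `f` along `v`, so
    -- neither derivatives of `f` nor integration by parts on the sphere is needed.
    set T := Submodule.reflection (Submodule.span ℝ {v})ᗮ with hTdef
    have hT : ∀ x, T x = x - (2 * inner ℝ v x / ‖v‖ ^ 2) • v := fun x => by
      rw [hTdef, Submodule.reflection_orthogonal_apply, Submodule.reflection_singleton_apply,
        ← Nat.cast_smul_eq_nsmul ℝ, smul_smul]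
      simp only [RCLike.ofReal_real_eq_id, id_eq, Nat.cast_ofNat, neg_sub]
      rw [mul_div_assoc]
    have hTv : T v = -v := Submodule.reflection_orthogonalComplement_singleton_eq_neg v
    have hb1 : ∀ T' : EuclideanSpace ℝ ι ≃ₗᵢ[ℝ] EuclideanSpace ℝ ι,
        Integrable (fun ω => f (T' (u ω)) * inner ℝ v (u ω)) P := fun T' =>
      hu.integrable_of_bounded (f := fun x => f (T' x) * inner ℝ v x)
        ((hf.comp T'.continuous.measurable).mul (by fun_prop))
        (C := (|f 0| + ‖g‖ + |ε|) * ‖v‖) fun x hx => by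
          rw [abs_mul]
          exact mul_le_mul (hfb _ (by simpa using hx)) (abs_inner_le v hx) (abs_nonneg _)
            (by positivity)
    have h0 : Integrable (fun ω => f (u ω) * inner ℝ v (u ω)) P := by
      simpa using hb1 (LinearIsometryEquiv.refl ℝ _)
    have hrefl : ∫ ω, f (T (u ω)) * inner ℝ v (u ω) ∂P = -∫ ω, f (u ω) * inner ℝ v (u ω) ∂P := by
      rw [← hu.integral_comp_isometry T (f := fun x => f x * inner ℝ v x)
        (hf.mul (by fun_prop)), ← integral_neg]
      refine integral_congr_ae (ae_of_all _ fun ω => ?_)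
      have : inner ℝ v (T (u ω)) = - inner ℝ v (u ω) := by
        have h1 := T.inner_map_map v (u ω)
        rw [hTv, inner_neg_left] at h1
        linarith
      simp only [this, mul_neg, neg_neg]
    have hsplit : 2 * ∫ ω, f (u ω) * inner ℝ v (u ω) ∂P
        = ∫ ω, (f (u ω) - f (T (u ω))) * inner ℝ v (u ω) ∂P := by
      simp only [sub_mul]
      rw [integral_sub h0 (hb1 T), hrefl]
      ring
    have hpt : ∀ ω, (f (u ω) - f (T (u ω))) * inner ℝ v (u ω)
        ≤ (2 * inner ℝ g v / ‖v‖ ^ 2 + 2 * ε / ‖v‖) * inner ℝ v (u ω) ^ 2 := fun ω => by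
      have h1 := h (u ω) (T (u ω)) (hu.norm_le ω) (by simpa using hu.norm_le ω)
      set s : ℝ := inner ℝ v (u ω)
      have h2 : u ω - T (u ω) = (2 * s / ‖v‖ ^ 2) • v := by rw [hT]; abel
      rw [h2, real_inner_smul_right, norm_smul, Real.norm_eq_abs, abs_div, abs_mul, abs_two,
        abs_of_pos (show 0 < ‖v‖ ^ 2 by positivity)] at h1
      have h3 : (f (u ω) - f (T (u ω)) - 2 * s / ‖v‖ ^ 2 * inner ℝ g v) * s
          ≤ ε * (2 * |s| / ‖v‖ ^ 2 * ‖v‖) * |s| :=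
        (le_abs_self _).trans (by rw [abs_mul]; exact mul_le_mul_of_nonneg_right h1 (abs_nonneg s))
      have h4 : ε * (2 * |s| / ‖v‖ ^ 2 * ‖v‖) * |s| = 2 * ε / ‖v‖ * s ^ 2 := by
        rw [← sq_abs s]; field_simp
      rw [h4] at h3
      have h5 : (2 * inner ℝ g v / ‖v‖ ^ 2 + 2 * ε / ‖v‖) * s ^ 2
          = 2 * s / ‖v‖ ^ 2 * inner ℝ g v * s + 2 * ε / ‖v‖ * s ^ 2 := by ring
      rw [h5]
      linarith
    have hle : 2 * ∫ ω, f (u ω) * inner ℝ v (u ω) ∂P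
        ≤ (2 * inner ℝ g v / ‖v‖ ^ 2 + 2 * ε / ‖v‖) * (‖v‖ ^ 2 / d) := by
      rw [hsplit, ← hu.integral_inner_sq v, ← integral_const_mul]
      refine integral_mono ?_ ((hu.integrable_inner_sq v).const_mul _) hpt
      simp only [sub_mul]
      exact h0.sub (hb1 T)
    have e1 : inner ℝ v (d • ∫ ω, f (u ω) • u ω ∂P - g)
        = d * ∫ ω, f (u ω) * inner ℝ v (u ω) ∂P - inner ℝ g v := by
      rw [inner_sub_right, real_inner_smul_right, ← integral_inner hint, real_inner_comm g v]
      simp only [real_inner_smul_right]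
    have e2 : (2 * inner ℝ g v / ‖v‖ ^ 2 + 2 * ε / ‖v‖) * (‖v‖ ^ 2 / d)
        = 2 * ((inner ℝ g v + ε * ‖v‖) / d) := by field_simp
    rw [e2] at hle
    have e3 : ∫ ω, f (u ω) * inner ℝ v (u ω) ∂P ≤ (inner ℝ g v + ε * ‖v‖) / d := by linarith
    rw [le_div_iff₀ hd] at e3
    rw [e1]
    linarith
  -- When the bias vanishes, what remains is `ε ≥ 0`, which follows from `key` at any nonzero
  -- vector.
  by_cases hz : d • ∫ ω, f (u ω) • u ω ∂P - g = 0
  · rw [hz, norm_zero]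
    by_contra hneg
    obtain ⟨v, hv⟩ : ∃ v : EuclideanSpace ℝ ι, v ≠ 0 := exists_ne 0
    have := key v hv
    rw [hz, inner_zero_right] at this
    have hv' : 0 < ‖v‖ := norm_pos_iff.mpr hv
    push Not at hneg
    nlinarith
  · have h1 := key _ hz
    rw [real_inner_self_eq_norm_sq, sq] at h1
    exact le_of_mul_le_mul_right h1 (norm_pos_iff.mpr hz)

end IsUniformDirection

/-- A standard Gaussian vector, normalized, is a uniform direction. -/
lemma isUniformDirection_of_gaussian [IsProbabilityMeasure P] [Nonempty ι]
    {g : Ω → EuclideanSpace ℝ ι}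
    (hg : Measurable g) (hlaw : P.map g = stdGaussian (EuclideanSpace ℝ ι)) :
    IsUniformDirection P fun ω => ‖g ω‖⁻¹ • g ω where
  measurable := hg.norm.inv.smul hg
  norm_eq := by
    have h : ∀ᵐ x ∂(P.map g), x ≠ 0 := by
      rw [hlaw, ← map_pi_eq_stdGaussian]
      refine (ae_map_iff (p := fun x => x ≠ 0) (WithLp.measurable_toLp 2 _).aemeasurable
        (measurableSet_singleton 0).compl).mpr ?_
      obtain ⟨i⟩ := ‹Nonempty ι›
      have h1 : ∀ᵐ y ∂(gaussianReal 0 1), y ≠ 0 := by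
        have := nullSingletonClass_gaussianReal (μ := 0) (v := 1) one_ne_zero
        exact compl_mem_ae_iff.mpr (measure_singleton 0)
      have h2 := (measurePreserving_eval (fun _ : ι => gaussianReal 0 1) i).quasiMeasurePreserving.ae h1
      filter_upwards [h2] with x hx hx0
      exact hx (by simpa using congrArg (fun v => v i) hx0)
    filter_upwards [ae_of_ae_map hg.aemeasurable h] with ω hω
    rw [norm_smul, norm_inv, norm_norm, inv_mul_cancel₀ (norm_ne_zero_iff.mpr hω)]
  norm_le := fun ω => by
    rw [norm_smul, norm_inv, norm_norm]
    exact inv_mul_le_one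
  ident := fun T => by
    have h1 : IdentDistrib (fun ω => T (g ω)) g P P :=
      { aemeasurable_fst := (T.continuous.measurable.comp hg).aemeasurable
        aemeasurable_snd := hg.aemeasurable
        map_eq := by
          have := Measure.map_map (μ := P) T.continuous.measurable hg
          change P.map (T ∘ g) = _
          rw [← this, hlaw, stdGaussian_map] }
    have h2 := h1.comp (u := fun x => ‖x‖⁻¹ • x) (by fun_prop)
    convert! h2 using 1
    ext1 ω
    simp

end Direction

/-! ### Joining independent families -/

section Independence

variable {Ω : Type*} [mΩ : MeasurableSpace Ω] {P : Measure Ω}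

/-- Two independent families, independent of each other, form an independent family. -/
lemma iIndep_sumElim {ι κ : Type*} {m₁ : ι → MeasurableSpace Ω} {m₂ : κ → MeasurableSpace Ω}
    (h₁ : iIndep m₁ P) (h₂ : iIndep m₂ P)
    (h : Indep (⨆ i, m₁ i) (⨆ k, m₂ k) P) : iIndep (Sum.elim m₁ m₂) P := by
  rw [iIndep_iff] at h₁ h₂ ⊢
  intro s f hf
  rw [← Finset.toLeft_disjSum_toRight (u := s), Finset.prod_disjSum]
  have hl : ∀ i ∈ s.toLeft, MeasurableSet[m₁ i] (f (Sum.inl i)) := fun i hi =>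
    hf _ (by simpa using hi)
  have hr : ∀ k ∈ s.toRight, MeasurableSet[m₂ k] (f (Sum.inr k)) := fun k hk =>
    hf _ (by simpa using hk)
  rw [← h₁ _ hl, ← h₂ _ hr]
  have hset : ⋂ i ∈ s.toLeft.disjSum s.toRight, f i
      = (⋂ i ∈ s.toLeft, f (Sum.inl i)) ∩ ⋂ k ∈ s.toRight, f (Sum.inr k) := by
    ext ω; simp
  rw [hset]
  refine (Indep_iff _ _ _).mp h _ _ ?_ ?_
  · exact @Finset.measurableSet_biInter _ _ (⨆ i, m₁ i) _ _ fun i hi => le_iSup m₁ i _ (hl i hi)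
  · exact @Finset.measurableSet_biInter _ _ (⨆ k, m₂ k) _ _ fun k hk => le_iSup m₂ k _ (hr k hk)

end Independence

/-! ### Elementary sources of randomness and the information they carry -/

section Information

variable {dx du : ℕ} {Ω : Type*}

/-- The σ-algebras of the single noise terms and of the single exploration entries. -/
@[reducible] def infoSource (w : ℕ → Ω → Fin dx → ℝ) (G : ℕ → ℕ → Ω → Controller dx du) :
    ℕ ⊕ (ℕ × ℕ × Fin du × Fin dx) → MeasurableSpace Ω :=
  Sum.elim (fun t => MeasurableSpace.comap (w t) inferInstance)
    (fun q => MeasurableSpace.comap (fun ω => G q.1 q.2.1 ω q.2.2.1 q.2.2.2) inferInstance)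

/-- The information in a set of sources. -/
abbrev infoOf (w : ℕ → Ω → Fin dx → ℝ) (G : ℕ → ℕ → Ω → Controller dx du)
    (A : Set (ℕ ⊕ (ℕ × ℕ × Fin du × Fin dx))) : MeasurableSpace Ω :=
  ⨆ x ∈ A, infoSource w G x

/-- The sources used before round `t` and sub-epoch `i` of epoch `j`. -/
def pastSources (dx du t j i : ℕ) : Set (ℕ ⊕ (ℕ × ℕ × Fin du × Fin dx)) :=
  {x | Sum.elim (fun k => k < t) (fun q => q.1 < j ∨ (q.1 = j ∧ q.2.1 < i)) x}

/-- The sources used in a sub-epoch that starts at time `t`. -/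
def blockSources (dx du τ t j i : ℕ) : Set (ℕ ⊕ (ℕ × ℕ × Fin du × Fin dx)) :=
  {x | Sum.elim (fun k => t ≤ k ∧ k < t + τ) (fun q => q.1 = j ∧ q.2.1 = i) x}

/-- The noise and the exploration matrix of a sub-epoch that starts at time `t`. -/
def block (w : ℕ → Ω → Fin dx → ℝ) (G : ℕ → ℕ → Ω → Controller dx du) (τ t j i : ℕ) (ω : Ω) :
    (ℕ → Fin dx → ℝ) × Controller dx du :=
  (trunc τ fun s => w (t + s) ω, G j i ω)

variable {w : ℕ → Ω → Fin dx → ℝ} {G : ℕ → ℕ → Ω → Controller dx du}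

lemma infoOf_mono {A B : Set (ℕ ⊕ (ℕ × ℕ × Fin du × Fin dx))} (h : A ⊆ B) :
    infoOf w G A ≤ infoOf w G B := biSup_mono fun _ hx => h hx

lemma infoSource_le_infoOf {A : Set (ℕ ⊕ (ℕ × ℕ × Fin du × Fin dx))} {x} (hx : x ∈ A) :
    infoSource w G x ≤ infoOf w G A :=
  le_iSup₂_of_le (f := fun x (_ : x ∈ A) => infoSource w G x) x hx le_rfl

lemma measurable_block_infoOf (τ t j i : ℕ) :
    Measurable[infoOf w G (blockSources dx du τ t j i)] (block w G τ t j i) := by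
  refine @Measurable.prodMk _ (infoOf w G (blockSources dx du τ t j i)) _ _ _ _ _ _ ?_ ?_
  · refine @measurable_pi_lambda _ _ _ (infoOf w G (blockSources dx du τ t j i)) _ _ fun k => ?_
    by_cases hk : k < τ
    · simp only [trunc, hk, if_true]
      refine Measurable.of_comap_le ?_
      exact infoSource_le_infoOf (w := w) (G := G) (x := Sum.inl (t + k))
        (by simp [blockSources, hk])
    · simp [trunc, hk]
  · refine @measurable_pi_lambda _ _ _ (infoOf w G (blockSources dx du τ t j i)) _ _ fun a => ?_
    refine @measurable_pi_lambda _ _ _ (infoOf w G (blockSources dx du τ t j i)) _ _ fun b => ?_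
    refine Measurable.of_comap_le ?_
    exact infoSource_le_infoOf (w := w) (G := G) (x := Sum.inr (j, i, a, b))
      (by simp [blockSources])

lemma pastSources_mono {t t' j i i' : ℕ} (ht : t ≤ t') (hi : i ≤ i') :
    pastSources dx du t j i ⊆ pastSources dx du t' j i' := by
  rintro (k | q) h
  · exact lt_of_lt_of_le h ht
  · rcases h with h | ⟨h1, h2⟩
    · exact Or.inl h
    · exact Or.inr ⟨h1, h2.trans_le hi⟩

lemma pastSources_succ (t j i : ℕ) :
    pastSources dx du t j i ⊆ pastSources dx du t (j + 1) 0 := by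
  rintro (k | q) h
  · exact h
  · rcases h with h | ⟨h1, _⟩
    · exact Or.inl (by omega)
    · exact Or.inl (by omega)

lemma blockSources_subset (τ t j i : ℕ) :
    blockSources dx du τ t j i ⊆ pastSources dx du (t + τ) j (i + 1) := by
  rintro (k | q) h
  · exact h.2
  · exact Or.inr ⟨h.1, by have := h.2; omega⟩

lemma disjoint_sources (τ t j i : ℕ) :
    Disjoint (pastSources dx du t j i) (blockSources dx du τ t j i) := by
  rw [Set.disjoint_left]
  rintro (k | q) h h'
  · exact absurd h (not_lt.mpr h'.1)
  · obtain ⟨h1, h2⟩ := h'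
    rcases h with h | ⟨_, h⟩ <;> omega

variable [mΩ : MeasurableSpace Ω] {P : Measure Ω} {σ W : ℝ}

lemma infoSource_le (hw : IsNoise P w σ W) (hG : IsGaussianExploration P G) (x) :
    infoSource w G x ≤ mΩ := by
  rcases x with t | q
  · exact (hw.measurable t).comap_le
  · exact (hG.measurable _ _ _ _).comap_le

lemma infoOf_le (hw : IsNoise P w σ W) (hG : IsGaussianExploration P G) (A) :
    infoOf w G A ≤ mΩ := iSup₂_le fun x _ => infoSource_le hw hG x

/-- Noise and exploration are independent within each family and as whole families. Merged into one
independent family of elementary sources, disjoint sets of sources carry independent information,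
which is how past and block are separated. -/
lemma iIndep_infoSource (hw : IsNoise P w σ W) (hG : IsGaussianExploration P G)
    (hI : IndepFun (fun ω t => w t ω)
      (fun ω (q : ℕ × ℕ × Fin du × Fin dx) => G q.1 q.2.1 ω q.2.2.1 q.2.2.2) P) :
    iIndep (infoSource w G) P := by
  refine iIndep_sumElim hw.indep.iIndep hG.indep.iIndep ?_
  rw [IndepFun_iff_Indep] at hI
  refine indep_of_indep_of_le_left (indep_of_indep_of_le_right hI ?_) ?_
  · refine iSup_le fun q => ?_
    have : (fun ω => G q.1 q.2.1 ω q.2.2.1 q.2.2.2) = (fun f => f q) ∘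
        fun ω (q : ℕ × ℕ × Fin du × Fin dx) => G q.1 q.2.1 ω q.2.2.1 q.2.2.2 := rfl
    rw [this, ← MeasurableSpace.comap_comp]
    exact MeasurableSpace.comap_mono (measurable_pi_apply q).comap_le
  · refine iSup_le fun t => ?_
    have : w t = (fun f => f t) ∘ fun ω t => w t ω := rfl
    rw [this, ← MeasurableSpace.comap_comp]
    exact MeasurableSpace.comap_mono (measurable_pi_apply t).comap_le

lemma indep_block (hw : IsNoise P w σ W) (hG : IsGaussianExploration P G)
    (hI : IndepFun (fun ω t => w t ω)
      (fun ω (q : ℕ × ℕ × Fin du × Fin dx) => G q.1 q.2.1 ω q.2.2.1 q.2.2.2) P) (τ t j i : ℕ) :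
    Indep (infoOf w G (pastSources dx du t j i))
      (MeasurableSpace.comap (block w G τ t j i) inferInstance) P :=
  indep_of_indep_of_le_right (indep_iSup_of_disjoint (infoSource_le hw hG)
    (iIndep_infoSource hw hG hI) (disjoint_sources τ t j i)) (measurable_block_infoOf τ t j i).comap_le

end Information

/-! ### The algorithm as a chain of sub-epochs -/

section Run

variable {dx du : ℕ} (S : System dx du) (p : AlgParams) (K₀ : Controller dx du)

/-- The controller perturbed in the direction of `g`. -/
def perturb (r : ℝ) (K g : Controller dx du) : Controller dx du := K + r • ((frob g)⁻¹ • g)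

/-- The state in round `s` of a sub-epoch, as a function of the controller of the epoch, the initial
state, the noise and the exploration matrix. -/
def blockState (r : ℝ) (z : Controller dx du × (Fin dx → ℝ))
    (b : (ℕ → Fin dx → ℝ) × Controller dx du) (s : ℕ) : Fin dx → ℝ :=
  S.rollout (perturb r z.1 b.2) z.2 b.1 s

/-- The cost of round `s` of a sub-epoch. -/
def blockCost (r : ℝ) (z : Controller dx du × (Fin dx → ℝ))
    (b : (ℕ → Fin dx → ℝ) × Controller dx du) (s : ℕ) : ℝ :=
  blockState S r z b s ⬝ᵥ S.stageCost (perturb r z.1 b.2) *ᵥ blockState S r z b s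

lemma System.cost_eq (K : Controller dx du) (x : Fin dx → ℝ) :
    S.cost x (K *ᵥ x) = x ⬝ᵥ S.stageCost K *ᵥ x := by
  rw [cost, stageCost, Matrix.add_mulVec, dotProduct_add, quad_conj]

lemma measurable_frob : Measurable (frob : Controller dx du → ℝ) := by
  refine Continuous.measurable ?_
  unfold frob
  fun_prop

lemma measurable_perturb (r : ℝ) :
    Measurable fun q : Controller dx du × Controller dx du => perturb r q.1 q.2 := by
  unfold perturb
  exact measurable_fst.add
    (((measurable_frob.comp measurable_snd).inv.smul measurable_snd).const_smul r)

lemma measurable_blockState (r : ℝ) (s : ℕ) : Measurable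
    fun q : (Controller dx du × (Fin dx → ℝ)) × ((ℕ → Fin dx → ℝ) × Controller dx du) =>
      blockState S r q.1 q.2 s := by
  have h1 : Measurable fun q : (Controller dx du × (Fin dx → ℝ)) ×
      ((ℕ → Fin dx → ℝ) × Controller dx du) => perturb r q.1.1 q.2.2 :=
    (measurable_perturb r).comp
      ((measurable_fst.comp measurable_fst).prodMk (measurable_snd.comp measurable_snd))
  exact (S.measurable_rollout s).comp (h1.prodMk
    ((measurable_snd.comp measurable_fst).prodMk (measurable_fst.comp measurable_snd)))

lemma measurable_blockCost (r : ℝ) (s : ℕ) : Measurable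
    fun q : (Controller dx du × (Fin dx → ℝ)) × ((ℕ → Fin dx → ℝ) × Controller dx du) =>
      blockCost S r q.1 q.2 s := by
  have h1 : Measurable fun q : (Controller dx du × (Fin dx → ℝ)) ×
      ((ℕ → Fin dx → ℝ) × Controller dx du) => perturb r q.1.1 q.2.2 :=
    (measurable_perturb r).comp
      ((measurable_fst.comp measurable_fst).prodMk (measurable_snd.comp measurable_snd))
  have h2 := measurable_blockState S r s
  exact h2.dot ((S.continuous_stageCost.measurable.comp h1).matrix_mulVec h2)

/-- The first round of epoch `j`. -/
def epochTime (p : AlgParams) : ℕ → ℕ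
  | 0 => 0
  | j + 1 => epochTime p j + p.m j * p.τ

lemma epoch_t (w : ℕ → Fin dx → ℝ) (G : ℕ → ℕ → Controller dx du) (j : ℕ) :
    (epoch S p K₀ w G j).t = epochTime p j := by
  induction j with
  | zero => rfl
  | succ j ih => rw [epoch, epochTime, ih]

variable {Ω : Type*} (w : ℕ → Ω → Fin dx → ℝ) (G : ℕ → ℕ → Ω → Controller dx du)

/-- The controller of epoch `j` and the state at the beginning of sub-epoch `i`. -/
def runState (j i : ℕ) (ω : Ω) : Controller dx du × (Fin dx → ℝ) :=
  ((epoch S p K₀ (fun t => w t ω) (fun j i => G j i ω) j).K,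
    subStart S p (fun t => w t ω) (fun j i => G j i ω)
      (epoch S p K₀ (fun t => w t ω) (fun j i => G j i ω) j) j i)

/-- The noise and the exploration matrix of sub-epoch `i` of epoch `j`. -/
def runBlock (j i : ℕ) : Ω → (ℕ → Fin dx → ℝ) × Controller dx du :=
  block w G p.τ (epochTime p j + i * p.τ) j i

lemma runState_fst (j i : ℕ) (ω : Ω) :
    (runState S p K₀ w G j i ω).1 = (runState S p K₀ w G j 0 ω).1 := rfl

lemma subState_eq (j i : ℕ) {s : ℕ} (hs : s ≤ p.τ) (ω : Ω) :
    subState S p (fun t => w t ω) (fun j i => G j i ω)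
      (epoch S p K₀ (fun t => w t ω) (fun j i => G j i ω) j) j i s
      = blockState S (p.r j) (runState S p K₀ w G j i ω) (runBlock p w G j i ω) s := by
  rw [subState, epoch_t, blockState, runBlock, block, S.rollout_trunc _ _ _ hs]
  rfl

lemma runState_succ_snd (j i : ℕ) (ω : Ω) :
    (runState S p K₀ w G j (i + 1) ω).2
      = blockState S (p.r j) (runState S p K₀ w G j i ω) (runBlock p w G j i ω) p.τ :=
  subState_eq S p K₀ w G j i le_rfl ω

lemma runState_succ (j i : ℕ) (ω : Ω) :
    runState S p K₀ w G j (i + 1) ω = ((runState S p K₀ w G j i ω).1,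
      blockState S (p.r j) (runState S p K₀ w G j i ω) (runBlock p w G j i ω) p.τ) :=
  Prod.ext rfl (runState_succ_snd S p K₀ w G j i ω)

lemma subCost_eq (j i : ℕ) {s : ℕ} (hs : s ≤ p.τ) (ω : Ω) :
    subCost S p (fun t => w t ω) (fun j i => G j i ω)
      (epoch S p K₀ (fun t => w t ω) (fun j i => G j i ω) j) j i s
      = blockCost S (p.r j) (runState S p K₀ w G j i ω) (runBlock p w G j i ω) s := by
  rw [subCost, S.cost_eq, subState_eq S p K₀ w G j i hs]
  rfl

lemma runState_epoch_zero (ω : Ω) : runState S p K₀ w G 0 0 ω = (K₀, 0) := rfl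

lemma runState_epoch_succ_snd (j : ℕ) (ω : Ω) :
    (runState S p K₀ w G (j + 1) 0 ω).2 = (runState S p K₀ w G j (p.m j) ω).2 := rfl

/-- The gradient estimate of a sub-epoch is a function of its block. -/
def blockGrad (r : ℝ) (τ : ℕ) (z : Controller dx du × (Fin dx → ℝ))
    (b : (ℕ → Fin dx → ℝ) × Controller dx du) : Controller dx du :=
  blockCost S r z b (τ - 1) • ((frob b.2)⁻¹ • b.2)

lemma measurable_blockGrad (r : ℝ) (τ : ℕ) : Measurable
    fun q : (Controller dx du × (Fin dx → ℝ)) × ((ℕ → Fin dx → ℝ) × Controller dx du) =>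
      blockGrad S r τ q.1 q.2 := by
  have h1 : Measurable fun q : (Controller dx du × (Fin dx → ℝ)) ×
      ((ℕ → Fin dx → ℝ) × Controller dx du) => q.2.2 := measurable_snd.comp measurable_snd
  exact (measurable_blockCost S r (τ - 1)).smul ((measurable_frob.comp h1).inv.smul h1)

lemma runState_epoch_succ_fst (j : ℕ) (ω : Ω) :
    (runState S p K₀ w G (j + 1) 0 ω).1 = (runState S p K₀ w G j 0 ω).1
      - p.η • ((((dx : ℝ) * du) / (p.m j * p.r j)) • ∑ i ∈ Finset.range (p.m j),
        blockGrad S (p.r j) p.τ (runState S p K₀ w G j i ω) (runBlock p w G j i ω)) := by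
  change _ - p.η • gradEstimate _ _ _ _ _ _ = _
  rw [gradEstimate]
  congr 3
  refine Finset.sum_congr rfl fun i _ => ?_
  rw [subCost_eq S p K₀ w G j i (Nat.sub_le _ _)]
  rfl

variable {w G} [mΩ : MeasurableSpace Ω] {P : Measure Ω} {σ W : ℝ}

/-- The history before sub-epoch `i` of epoch `j`. -/
abbrev history (w : ℕ → Ω → Fin dx → ℝ) (G : ℕ → ℕ → Ω → Controller dx du) (p : AlgParams)
    (j i : ℕ) : MeasurableSpace Ω :=
  infoOf w G (pastSources dx du (epochTime p j + i * p.τ) j i)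

omit mΩ in
lemma history_mono (j : ℕ) : Monotone (history w G p j) := fun i i' hi =>
  infoOf_mono (pastSources_mono (by gcongr) hi)

omit mΩ in
lemma measurable_runBlock (j i : ℕ) : Measurable[history w G p j (i + 1)] (runBlock p w G j i) := by
  refine (measurable_block_infoOf p.τ (epochTime p j + i * p.τ) j i).mono
    (infoOf_mono ((blockSources_subset _ _ _ _).trans ?_)) le_rfl
  exact pastSources_mono (by rw [add_mul, one_mul, add_assoc]) le_rfl

omit mΩ in
lemma measurable_runState_of_zero {j : ℕ}
    (h : Measurable[history w G p j 0] (runState S p K₀ w G j 0)) (i : ℕ) :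
    Measurable[history w G p j i] (runState S p K₀ w G j i) := by
  induction i with
  | zero => exact h
  | succ i ih =>
    have h1 : Measurable[history w G p j (i + 1)] (runState S p K₀ w G j i) :=
      ih.mono (history_mono p j (Nat.le_succ i)) le_rfl
    have h2 : Measurable[history w G p j (i + 1)]
        fun ω => (runState S p K₀ w G j i ω, runBlock p w G j i ω) :=
      @Measurable.prodMk _ (history w G p j (i + 1)) _ _ _ _ _ _ h1 (measurable_runBlock p j i)
    have h3 := (measurable_fst.comp measurable_fst).prodMk (measurable_blockState S (p.r j) p.τ)
    have e : runState S p K₀ w G j (i + 1) = (fun q : (Controller dx du × (Fin dx → ℝ)) ×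
        ((ℕ → Fin dx → ℝ) × Controller dx du) => (q.1.1, blockState S (p.r j) q.1 q.2 p.τ)) ∘
        fun ω => (runState S p K₀ w G j i ω, runBlock p w G j i ω) :=
      funext fun ω => runState_succ S p K₀ w G j i ω
    rw [e]
    exact h3.comp h2

lemma measurable_finset_sum_of {α β : Type*} {m : MeasurableSpace α} [MeasurableSpace β]
    [AddCommMonoid β] [MeasurableAdd₂ β] (n : ℕ) (f : ℕ → α → β)
    (hf : ∀ i < n, Measurable (f i)) : Measurable fun a => ∑ i ∈ Finset.range n, f i a :=
  Finset.measurable_fun_sum _ fun i hi => hf i (Finset.mem_range.mp hi)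

omit mΩ in
lemma measurable_blockGrad_run {j : ℕ}
    (hst : ∀ i, Measurable[history w G p j i] (runState S p K₀ w G j i)) {i : ℕ} (hi : i < p.m j) :
    Measurable[history w G p j (p.m j)] fun ω =>
      blockGrad S (p.r j) p.τ (runState S p K₀ w G j i ω) (runBlock p w G j i ω) := by
  have h1 : Measurable[history w G p j (p.m j)] (runState S p K₀ w G j i) :=
    (hst i).mono (history_mono p j hi.le) le_rfl
  have h2 : Measurable[history w G p j (p.m j)] (runBlock p w G j i) :=
    (measurable_runBlock p j i).mono (history_mono p j hi) le_rfl
  generalize history w G p j (p.m j) = m at h1 h2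
  have h3 := (measurable_blockGrad S (p.r j) p.τ).comp (h1.prodMk h2)
  exact h3

omit mΩ in
lemma measurable_gradStep {m : MeasurableSpace Ω} {f g : Ω → Controller dx du}
    (hf : Measurable f) (hg : Measurable g) (a b : ℝ) :
    Measurable fun ω => f ω - a • (b • g ω) :=
  hf.sub (((continuous_const_smul a).measurable.comp
    ((continuous_const_smul b).measurable.comp hg)))

omit mΩ in
-- The gradient step uses the costs of every sub-epoch of the previous epoch, so measurability is
-- first carried through that epoch to the history at its end.
lemma measurable_runState_zero (j : ℕ) :
    Measurable[history w G p j 0] (runState S p K₀ w G j 0) := by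
  induction j with
  | zero =>
    have e : runState S p K₀ w G 0 0 = fun _ => (K₀, 0) := rfl
    rw [e]
    exact @measurable_const _ _ _ (history w G p 0 0) _
  | succ j ih =>
    have hle : history w G p j (p.m j) ≤ history w G p (j + 1) 0 := by
      refine infoOf_mono ?_
      rw [zero_mul, add_zero, epochTime]
      exact pastSources_succ _ _ _
    have hst := measurable_runState_of_zero S p K₀ ih
    have h2 : Measurable[history w G p (j + 1) 0] fun ω => (runState S p K₀ w G (j + 1) 0 ω).2 :=
      (measurable_snd.comp (hst (p.m j))).mono hle le_rfl
    have h1 : Measurable[history w G p (j + 1) 0]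
        fun ω => (runState S p K₀ w G (j + 1) 0 ω).1 := by
      simp only [runState_epoch_succ_fst]
      refine Measurable.mono ?_ hle le_rfl
      have h0 : Measurable[history w G p j (p.m j)] fun ω => (runState S p K₀ w G j 0 ω).1 :=
        (measurable_fst.comp ih).mono (history_mono p j (Nat.zero_le _)) le_rfl
      exact measurable_gradStep h0 (measurable_finset_sum_of _ _ fun i hi => measurable_blockGrad_run S p K₀ hst hi) _ _
    exact @Measurable.prodMk _ (history w G p (j + 1) 0) _ _ _ _ _ _ h1 h2

/-- Within an epoch, the run of the algorithm is a chain driven by the blocks. -/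
lemma isChain_run (hw : IsNoise P w σ W) (hG : IsGaussianExploration P G)
    (hI : IndepFun (fun ω t => w t ω)
      (fun ω (q : ℕ × ℕ × Fin du × Fin dx) => G q.1 q.2.1 ω q.2.2.1 q.2.2.2) P) (j : ℕ) :
    IsChain P (history w G p j) (runState S p K₀ w G j) (runBlock p w G j) where
  mono := history_mono p j
  le := fun _ => infoOf_le hw hG _
  state := measurable_runState_of_zero S p K₀ (measurable_runState_zero S p K₀ j)
  innov := measurable_runBlock p j
  indep := fun _ => indep_block hw hG hI _ _ _ _

end Run

/-! ### Contraction along noisy trajectories and mixing -/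

section Trajectory

variable {dx du : ℕ} {S : System dx du} {V : Matrix (Fin dx) (Fin dx) ℝ} {a ψ ν σ κ W : ℝ}
  {K : Controller dx du}

/-- Cauchy–Schwarz in the form `P`, then Young's inequality with weight `θ`. -/
lemma posSemidef_quad_add_le {P : Matrix (Fin dx) (Fin dx) ℝ} (hP : P.PosSemidef) {θ : ℝ}
    (hθ : 0 < θ) (x y : Fin dx → ℝ) :
    (x + y) ⬝ᵥ P *ᵥ (x + y) ≤ (1 + θ) * (x ⬝ᵥ P *ᵥ x) + (1 + 1 / θ) * (y ⬝ᵥ P *ᵥ y) := by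
  have h1 := posSemidef_cauchy_schwarz hP x y
  have hx := Real.sq_sqrt (posSemidef_quad_nonneg hP x)
  have hy := Real.sq_sqrt (posSemidef_quad_nonneg hP y)
  have e : y ⬝ᵥ P *ᵥ x = x ⬝ᵥ P *ᵥ y := by
    rw [dot_mulVec_comm, posSemidef_transpose_eq hP, dotProduct_comm]
  rw [Matrix.mulVec_add, dotProduct_add, add_dotProduct, add_dotProduct, e]
  set u := √(x ⬝ᵥ P *ᵥ x)
  set v := √(y ⬝ᵥ P *ᵥ y)
  have h2 : 2 * (u * v) ≤ θ * u ^ 2 + 1 / θ * v ^ 2 := by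
    have h3 : 0 ≤ (θ * u - v) ^ 2 / θ := by positivity
    have h4 : (θ * u - v) ^ 2 / θ = θ * u ^ 2 + 1 / θ * v ^ 2 - 2 * (u * v) := by
      field_simp; ring
    linarith
  rw [← hx, ← hy]
  linarith

namespace System
namespace Bounds

variable (h : S.Bounds V a ψ ν σ κ)
include h

/-- Half of the contraction rate is given up to absorb the cross term: with `g = 1 / (2 κ²)` one has
`(1 + g)(1 - 2 g) ≤ 1 - g`, and the noise is multiplied by `1 + 2 κ² ≤ 9 κ² / 4` because `κ ≥ 2`. -/
lemma value_noise_step (hK : S.Fine V ν K) (x : Fin dx → ℝ) {y : Fin dx → ℝ} (hy : y ⬝ᵥ y ≤ W ^ 2) :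
    (S.closedLoop K *ᵥ x + y) ⬝ᵥ S.value K *ᵥ (S.closedLoop K *ᵥ x + y)
      ≤ (1 - 1 / (2 * κ ^ 2)) * (x ⬝ᵥ S.value K *ᵥ x) + 9 / 4 * a * κ ^ 4 * W ^ 2 := by
  have hk := h.kappa_ge
  have ha := h.a_pos
  have hv := posSemidef_quad_nonneg (h.value_psd hK.1) x
  have h1 := posSemidef_quad_add_le (h.value_psd hK.1) (θ := 1 / (2 * κ ^ 2)) (by positivity)
    (S.closedLoop K *ᵥ x) y
  have h2 := h.contraction hK x
  have h3 : y ⬝ᵥ S.value K *ᵥ y ≤ a * κ ^ 2 * W ^ 2 :=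
    (h.value_quad_le hK y).trans (mul_le_mul_of_nonneg_left hy (by positivity))
  set g := 1 / (2 * κ ^ 2) with hg
  have hg0 : 0 < g := by positivity
  have e1 : 1 / κ ^ 2 = 2 * g := by rw [hg]; field_simp
  have e2 : 1 / g = 2 * κ ^ 2 := by rw [hg]; field_simp
  rw [e1] at h2
  rw [e2] at h1
  have h4 : (1 + g) * ((S.closedLoop K *ᵥ x) ⬝ᵥ S.value K *ᵥ (S.closedLoop K *ᵥ x))
      ≤ (1 + g) * ((1 - 2 * g) * (x ⬝ᵥ S.value K *ᵥ x)) :=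
    mul_le_mul_of_nonneg_left h2 (by positivity)
  have h5 : (1 + 2 * κ ^ 2) * (y ⬝ᵥ S.value K *ᵥ y) ≤ 9 / 4 * κ ^ 2 * (a * κ ^ 2 * W ^ 2) :=
    mul_le_mul (by nlinarith) h3 (posSemidef_quad_nonneg (h.value_psd hK.1) y) (by positivity)
  nlinarith [mul_nonneg (mul_nonneg hg0.le hg0.le) hv]

/-- The contraction rate of the value function along noisy trajectories. -/
lemma rate_nonneg : 0 ≤ 1 - 1 / (2 * κ ^ 2) := by
  have hk := h.kappa_ge
  have : 1 / (2 * κ ^ 2) ≤ 1 := by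
    rw [div_le_one (by positivity)]
    nlinarith
  linarith

omit h in
lemma rate_le_one : 1 - 1 / (2 * κ ^ 2) ≤ 1 := by
  have : 0 ≤ 1 / (2 * κ ^ 2) := by positivity
  linarith

lemma rollout_value_le (hK : S.Fine V ν K) (x : Fin dx → ℝ) {w : ℕ → Fin dx → ℝ} {s : ℕ}
    (hw : ∀ k < s, w k ⬝ᵥ w k ≤ W ^ 2) :
    S.rollout K x w s ⬝ᵥ S.value K *ᵥ S.rollout K x w s
      ≤ (1 - 1 / (2 * κ ^ 2)) ^ s * (x ⬝ᵥ S.value K *ᵥ x) + 9 / 2 * a * κ ^ 6 * W ^ 2 := by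
  have hk := h.kappa_ge
  have ha := h.a_pos
  induction s with
  | zero =>
    rw [rollout, pow_zero, one_mul]
    have : 0 ≤ 9 / 2 * a * κ ^ 6 * W ^ 2 := by positivity
    linarith
  | succ s ih =>
    rw [S.rollout_eq]
    refine (h.value_noise_step hK _ (hw s (Nat.lt_succ_self s))).trans ?_
    have h1 := mul_le_mul_of_nonneg_left (ih fun k hk => hw k (hk.trans (Nat.lt_succ_self s)))
      h.rate_nonneg
    -- The additive constant is the fixed point of the recursion, `2 κ²` times the contribution of
    -- one noise term.
    have e : (1 - 1 / (2 * κ ^ 2)) * (9 / 2 * a * κ ^ 6 * W ^ 2)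
        = 9 / 2 * a * κ ^ 6 * W ^ 2 - 9 / 4 * a * κ ^ 4 * W ^ 2 := by
      field_simp
      ring
    rw [pow_succ' (1 - 1 / (2 * κ ^ 2)) s]
    linarith

end Bounds

/-- The expectation of the quadratic form `N` in the state after `s` rounds. -/
def expQuad (S : System dx du) (V : Matrix (Fin dx) (Fin dx) ℝ) (K : Controller dx du)
    (x : Fin dx → ℝ) (s : ℕ) (N : Matrix (Fin dx) (Fin dx) ℝ) : ℝ :=
  (S.closedLoop K ^ s *ᵥ x) ⬝ᵥ N *ᵥ (S.closedLoop K ^ s *ᵥ x)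
    + ∑ k ∈ Finset.range s, ((S.closedLoop K ^ k)ᵀ * N * S.closedLoop K ^ k * V).trace

lemma expQuad_succ (x : Fin dx → ℝ) (s : ℕ) (N : Matrix (Fin dx) (Fin dx) ℝ) :
    S.expQuad V K x (s + 1) N
      = S.expQuad V K x s ((S.closedLoop K)ᵀ * N * S.closedLoop K) + (N * V).trace := by
  set A := S.closedLoop K with hA
  have e : ∀ k, (A ^ k)ᵀ * (Aᵀ * N * A) * A ^ k * V = (A ^ (k + 1))ᵀ * N * A ^ (k + 1) * V :=
    fun k => by
      rw [pow_succ' A k, Matrix.transpose_mul]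
      simp only [Matrix.mul_assoc]
  rw [expQuad, expQuad, Finset.sum_range_succ', quad_conj, pow_succ_mulVec, ← hA]
  simp only [e]
  simp [add_assoc]

lemma expQuad_add (x : Fin dx → ℝ) (s : ℕ) (N M : Matrix (Fin dx) (Fin dx) ℝ) :
    S.expQuad V K x s (N + M) = S.expQuad V K x s N + S.expQuad V K x s M := by
  simp only [expQuad, Matrix.add_mulVec, dotProduct_add, Matrix.mul_add, Matrix.add_mul,
    Matrix.trace_add, Finset.sum_add_distrib]
  ring

/-- By the Bellman equation the expected value falls in each round by the expected stage cost minus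
the average cost, so the sum telescopes. -/
lemma sum_expQuad_stageCost (hK : StableMat (S.closedLoop K)) (x : Fin dx → ℝ) (n : ℕ) :
    ∑ s ∈ Finset.range n, (S.expQuad V K x s (S.stageCost K) - S.avgCost V K)
      = x ⬝ᵥ S.value K *ᵥ x - S.expQuad V K x n (S.value K) := by
  induction n with
  | zero => simp [expQuad]
  | succ n ih =>
    have e := expQuad_add (S := S) (V := V) (K := K) x n (S.stageCost K)
      ((S.closedLoop K)ᵀ * S.value K * S.closedLoop K)
    rw [← Bounds.value_eq hK] at e
    rw [Finset.sum_range_succ, ih, expQuad_succ, avgCost, e]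
    ring

namespace Bounds

variable (h : S.Bounds V a ψ ν σ κ)
include h

omit h in
lemma abs_lyap_quad_le (hK : StableMat (S.closedLoop K)) {N : Matrix (Fin dx) (Fin dx) ℝ} {c : ℝ}
    (hN : ∀ x, |x ⬝ᵥ N *ᵥ x| ≤ c * (x ⬝ᵥ S.stageCost K *ᵥ x)) (y : Fin dx → ℝ) :
    |y ⬝ᵥ lyap (S.closedLoop K) N *ᵥ y| ≤ c * (y ⬝ᵥ S.value K *ᵥ y) := by
  have h1 := hK.hasSum_bilin N y y
  have h2 := (hK.hasSum_bilin (S.stageCost K) y y).mul_left c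
  have h1' := h1.tendsto_sum_nat
  refine le_of_tendsto_of_tendsto' h1'.abs h2.tendsto_sum_nat fun n => ?_
  exact (Finset.abs_sum_le_sum_abs _ _).trans (Finset.sum_le_sum fun k _ => hN _)

/-- Bounds the tail from `s` on of the series for the stationary mean of `N`. The tail is dominated
by the value matrix pulled back `s` steps, which has shrunk by `q`, and `tr(P_K V) ≤ ν`. -/
lemma abs_trace_tail_le (hK : S.Fine V ν K) {N : Matrix (Fin dx) (Fin dx) ℝ} {c : ℝ} (hc : 0 ≤ c)
    (hN : ∀ x, |x ⬝ᵥ N *ᵥ x| ≤ c * (x ⬝ᵥ S.stageCost K *ᵥ x)) {q : ℝ} (hq : 0 ≤ q) (s : ℕ)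
    (hpow : ∀ y, (S.closedLoop K ^ s *ᵥ y) ⬝ᵥ S.value K *ᵥ (S.closedLoop K ^ s *ᵥ y)
      ≤ q * (y ⬝ᵥ S.value K *ᵥ y)) :
    |((S.closedLoop K ^ s)ᵀ * lyap (S.closedLoop K) N * S.closedLoop K ^ s * V).trace|
      ≤ c * (q * ν) := by
  have hlyap := abs_lyap_quad_le hK.1 hN
  set L := lyap (S.closedLoop K) N
  set M := S.closedLoop K ^ s
  have hbound : ∀ y, |y ⬝ᵥ (Mᵀ * L * M) *ᵥ y| ≤ y ⬝ᵥ ((c * q) • S.value K) *ᵥ y := fun y => by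
    rw [quad_conj, Matrix.smul_mulVec, dotProduct_smul, smul_eq_mul, mul_assoc]
    exact (hlyap _).trans (mul_le_mul_of_nonneg_left (hpow y) hc)
  have hfin : ((c * q) • S.value K * V).trace ≤ c * (q * ν) := by
    rw [Matrix.smul_mul, Matrix.trace_smul, smul_eq_mul, mul_assoc]
    exact mul_le_mul_of_nonneg_left (mul_le_mul_of_nonneg_left hK.2 hq) hc
  refine abs_le.mpr ⟨?_, (trace_mul_le_of_quad h.V_psd fun y =>
    (le_abs_self _).trans (hbound y)).trans hfin⟩
  have := trace_mul_le_of_quad (G := -(Mᵀ * L * M)) (H := (c * q) • S.value K) h.V_psd fun y => by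
    rw [Matrix.neg_mulVec, dotProduct_neg]
    exact (neg_le_abs _).trans (hbound y)
  rw [Matrix.neg_mul, Matrix.trace_neg] at this
  linarith

lemma mixing_nonneg : 0 ≤ 1 - 1 / κ ^ 2 := by
  have hk := h.kappa_ge
  have : 1 / κ ^ 2 ≤ 1 := by rw [div_le_one (by positivity)]; nlinarith
  linarith

/-- The mean after `s` rounds and the stationary mean share the first `s` noise contributions. Only
the transported initial state and the tail of the stationary series differ, and both have contracted
`s` times. -/
lemma abs_expQuad_sub_le (hK : S.Fine V ν K) {N : Matrix (Fin dx) (Fin dx) ℝ} {c : ℝ} (hc : 0 ≤ c)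
    (hN : ∀ x, |x ⬝ᵥ N *ᵥ x| ≤ c * (x ⬝ᵥ S.stageCost K *ᵥ x)) (x : Fin dx → ℝ) (s : ℕ) :
    |S.expQuad V K x s N - (N * S.statCov V K).trace|
      ≤ c * ((1 - 1 / κ ^ 2) ^ s * (a * κ ^ 2 * (x ⬝ᵥ x) + ν)) := by
  have hq := h.mixing_nonneg
  have hpow := quad_pow_le hq (h.contraction hK)
  have e1 : (N * S.statCov V K).trace
      = ∑ k ∈ Finset.range s, ((S.closedLoop K ^ k)ᵀ * N * S.closedLoop K ^ k * V).trace
      + ((S.closedLoop K ^ s)ᵀ * lyap (S.closedLoop K) N * S.closedLoop K ^ s * V).trace := by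
    rw [statCov, ← hK.1.trace_lyap_mul]
    conv_lhs => rw [eq_partial_add_of_fixed (hK.1.lyap_eq N) s]
    rw [Matrix.add_mul, Matrix.trace_add, Finset.sum_mul, Matrix.trace_sum]
  have b1 : |(S.closedLoop K ^ s *ᵥ x) ⬝ᵥ N *ᵥ (S.closedLoop K ^ s *ᵥ x)|
      ≤ c * ((1 - 1 / κ ^ 2) ^ s * (a * κ ^ 2 * (x ⬝ᵥ x))) := by
    refine (hN _).trans (mul_le_mul_of_nonneg_left ?_ hc)
    refine (h.stage_le_value hK.1 _).trans ((hpow x s).trans ?_)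
    exact mul_le_mul_of_nonneg_left (h.value_quad_le hK x) (pow_nonneg hq s)
  have b2 := h.abs_trace_tail_le hK hc hN (pow_nonneg hq s) s fun y => hpow y s
  have e2 : ∀ u v t : ℝ, u + v - (v + t) = u - t := fun u v t => by ring
  rw [e1, expQuad, e2, mul_add, mul_add]
  exact (abs_sub _ _).trans (add_le_add b1 b2)

lemma abs_expQuad_stageCost_sub_le (hK : S.Fine V ν K) (x : Fin dx → ℝ) (s : ℕ) :
    |S.expQuad V K x s (S.stageCost K) - S.avgCost V K|
      ≤ (1 - 1 / κ ^ 2) ^ s * (a * κ ^ 2 * (x ⬝ᵥ x) + ν) := by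
  have := h.abs_expQuad_sub_le hK (N := S.stageCost K) zero_le_one
    (fun y => by rw [one_mul, abs_of_nonneg (posSemidef_quad_nonneg (h.stage_psd K) y)]) x s
  rwa [one_mul, ← avgCost_eq hK.1] at this

lemma abs_expQuad_sub_le_norm (hK : S.Fine V ν K) (N : Matrix (Fin dx) (Fin dx) ℝ)
    (x : Fin dx → ℝ) (s : ℕ) :
    |S.expQuad V K x s N - (N * S.statCov V K).trace|
      ≤ ‖N‖ / a * ((1 - 1 / κ ^ 2) ^ s * (a * κ ^ 2 * (x ⬝ᵥ x) + ν)) := by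
  have ha := h.a_pos
  refine h.abs_expQuad_sub_le hK (by positivity) (fun y => (abs_quad_le N y).trans ?_) x s
  rw [div_mul_eq_mul_div, le_div_iff₀ ha, mul_assoc, mul_comm _ a]
  exact mul_le_mul_of_nonneg_left (h.stage_ge K y) (norm_nonneg _)

end Bounds
end System

end Trajectory

/-! ### Invariance of the set of good starts -/

section Blocks

variable {dx du : ℕ} {S : System dx du} {V : Matrix (Fin dx) (Fin dx) ℝ} {a ψ ν σ κ W r : ℝ}

lemma frob_smul_inv_le (g : Controller dx du) : frob ((frob g)⁻¹ • g) ≤ 1 := by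
  have e : frob ((frob g)⁻¹ • g) ^ 2 = (frob g)⁻¹ ^ 2 * frob g ^ 2 := by
    rw [frob_sq, frob_sq]; simp; ring
  refine le_of_sq_le_sq ?_ zero_le_one
  rw [e, ← mul_pow]
  by_cases h : frob g = 0
  · simp [h]
  · rw [inv_mul_cancel₀ h]

lemma norm_smul_direction_le (hr : 0 ≤ r) (g : Controller dx du) :
    ‖r • ((frob g)⁻¹ • g)‖ ≤ r := by
  rw [norm_smul, Real.norm_of_nonneg hr]
  exact mul_le_of_le_one_right hr ((norm_le_frob _).trans (frob_smul_inv_le g))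

/-- The controllers of average cost at most `ν / 2`, together with the states which are as small as
the dynamics keeps them at the ends of the sub-epochs. -/
def goodStart (S : System dx du) (V : Matrix (Fin dx) (Fin dx) ℝ) (ν κ W : ℝ) :
    Set (Controller dx du × (Fin dx → ℝ)) :=
  {z | S.Fine V (ν / 2) z.1 ∧ z.2 ⬝ᵥ z.2 ≤ 8 * κ ^ 6 * W ^ 2}

lemma measurableSet_goodStart : MeasurableSet (goodStart S V ν κ W) :=
  (measurable_fst (S.measurableSet_fine V (ν / 2))).inter
    (measurableSet_le (measurable_snd.dot measurable_snd) measurable_const)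

namespace System.Bounds

variable (h : S.Bounds V a ψ ν σ κ) (hr : 0 ≤ r) (hr' : r ≤ √a / (16 * ψ * κ ^ 3))
  {z : Controller dx du × (Fin dx → ℝ)} (hz : z ∈ goodStart S V ν κ W)
  {b : (ℕ → Fin dx → ℝ) × Controller dx du}
include h hr hr' hz

lemma fine_perturb (g : Controller dx du) : S.Fine V ν (perturb r z.1 g) :=
  h.fine_add hz.1 ((norm_smul_direction_le hr g).trans hr')

lemma value_start_le (g : Controller dx du) :
    z.2 ⬝ᵥ S.value (perturb r z.1 g) *ᵥ z.2 ≤ 8 * a * κ ^ 8 * W ^ 2 := by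
  have ha := h.a_pos
  have hk := h.kappa_ge
  refine (h.value_quad_le (h.fine_perturb hr hr' hz g) _).trans
    ((mul_le_mul_of_nonneg_left hz.2 (by positivity)).trans (le_of_eq ?_))
  ring

omit hr hr' hz in
lemma blockCost_nonneg (s : ℕ) : 0 ≤ blockCost S r z b s :=
  posSemidef_quad_nonneg (h.stage_psd _) _

lemma blockCost_le {τ : ℕ} (hb : ∀ k < τ, b.1 k ⬝ᵥ b.1 k ≤ W ^ 2) {s : ℕ} (hs : s ≤ τ) :
    blockCost S r z b s ≤ 10 * a * κ ^ 8 * W ^ 2 := by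
  have ha := h.a_pos
  have hk := h.kappa_ge
  have hf := h.fine_perturb hr hr' hz b.2
  have hv := h.value_start_le hr hr' hz b.2
  refine (h.stage_le_value hf.1 _).trans
    ((h.rollout_value_le hf _ fun k hk => hb k (by omega)).trans ?_)
  have h1 : (1 - 1 / (2 * κ ^ 2)) ^ s * (z.2 ⬝ᵥ S.value (perturb r z.1 b.2) *ᵥ z.2)
      ≤ z.2 ⬝ᵥ S.value (perturb r z.1 b.2) *ᵥ z.2 :=
    mul_le_of_le_one_left (posSemidef_quad_nonneg (h.value_psd hf.1) _)
      (pow_le_one₀ h.rate_nonneg rate_le_one)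
  have h2 : 9 / 2 * a * κ ^ 6 * W ^ 2 ≤ 9 / 8 * a * κ ^ 8 * W ^ 2 := by
    have h3 : 0 ≤ a * κ ^ 6 * W ^ 2 * (κ ^ 2 - 4) :=
      mul_nonneg (by positivity) (by nlinarith)
    nlinarith
  have h3 : 0 ≤ a * κ ^ 8 * W ^ 2 := by positivity
  nlinarith

/-- The initial value, at most `8 a κ⁸ W²`, has shrunk by `16 κ²` to `a κ⁶ W² / 2`; the accumulated
noise adds `9 / 2` of the same unit. -/
lemma blockState_value_le {τ : ℕ} (hb : ∀ k < τ, b.1 k ⬝ᵥ b.1 k ≤ W ^ 2)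
    (hq : (1 - 1 / (2 * κ ^ 2)) ^ (τ - 1) ≤ 1 / (16 * κ ^ 2)) {s : ℕ} (hs : s ≤ τ) (hs' : τ - 1 ≤ s) :
    blockState S r z b s ⬝ᵥ S.value (perturb r z.1 b.2) *ᵥ blockState S r z b s
      ≤ 5 * a * κ ^ 6 * W ^ 2 := by
  have ha := h.a_pos
  have hk := h.kappa_ge
  have hf := h.fine_perturb hr hr' hz b.2
  have hv := h.value_start_le hr hr' hz b.2
  refine (h.rollout_value_le hf _ fun k hk => hb k (by omega)).trans ?_
  have h1 : (1 - 1 / (2 * κ ^ 2)) ^ s * (z.2 ⬝ᵥ S.value (perturb r z.1 b.2) *ᵥ z.2)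
      ≤ 1 / (16 * κ ^ 2) * (8 * a * κ ^ 8 * W ^ 2) :=
    mul_le_mul ((pow_le_pow_of_le_one h.rate_nonneg rate_le_one hs').trans hq) hv
      (posSemidef_quad_nonneg (h.value_psd hf.1) _) (by positivity)
  have e : 1 / (16 * κ ^ 2) * (8 * a * κ ^ 8 * W ^ 2) = 1 / 2 * a * κ ^ 6 * W ^ 2 := by
    field_simp; ring
  rw [e] at h1
  linarith

lemma blockCost_last_le {τ : ℕ} (hb : ∀ k < τ, b.1 k ⬝ᵥ b.1 k ≤ W ^ 2)
    (hq : (1 - 1 / (2 * κ ^ 2)) ^ (τ - 1) ≤ 1 / (16 * κ ^ 2)) :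
    blockCost S r z b (τ - 1) ≤ 5 * a * κ ^ 6 * W ^ 2 :=
  (h.stage_le_value (h.fine_perturb hr hr' hz b.2).1 _).trans
    (h.blockState_value_le hr hr' hz hb hq (Nat.sub_le _ _) le_rfl)

/-- Passing from the state to its value costs a factor `κ²`, which the contraction over the
sub-epoch regains; the bound `5` it leaves is below the admitted `8`. -/
lemma blockState_mem_goodStart {τ : ℕ} (hb : ∀ k < τ, b.1 k ⬝ᵥ b.1 k ≤ W ^ 2)
    (hq : (1 - 1 / (2 * κ ^ 2)) ^ (τ - 1) ≤ 1 / (16 * κ ^ 2)) :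
    (z.1, blockState S r z b τ) ∈ goodStart S V ν κ W := by
  refine ⟨hz.1, le_of_mul_le_mul_left ?_ h.a_pos⟩
  refine (h.value_ge (h.fine_perturb hr hr' hz b.2).1 _).trans
    ((h.blockState_value_le hr hr' hz hb hq le_rfl (Nat.sub_le _ _)).trans ?_)
  have ha := h.a_pos
  have : 0 ≤ a * κ ^ 6 * W ^ 2 := by have := h.kappa_pos; positivity
  nlinarith

end System.Bounds
end Blocks

/-! ### Controllers as Euclidean vectors -/

section Vectorization

variable {dx du : ℕ}

/-- Matrices as vectors in a Euclidean space. -/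
def vec : Controller dx du ≃ₗ[ℝ] EuclideanSpace ℝ (Fin du × Fin dx) where
  toFun M := WithLp.toLp 2 fun q => M q.1 q.2
  invFun v := Matrix.of fun a b => v (a, b)
  map_add' _ _ := rfl
  map_smul' _ _ := rfl
  left_inv _ := rfl
  right_inv _ := rfl

lemma vec_apply (M : Controller dx du) (q : Fin du × Fin dx) : vec M q = M q.1 q.2 := rfl

lemma continuous_vec : Continuous (vec : Controller dx du → _) := by
  refine (PiLp.continuous_toLp 2 _).comp (continuous_pi fun q => ?_)
  exact (continuous_apply q.2).comp (continuous_apply q.1)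

lemma continuous_vec_symm :
    Continuous (vec.symm : EuclideanSpace ℝ (Fin du × Fin dx) → Controller dx du) := by
  refine continuous_matrix fun a b => ?_
  exact (continuous_apply (a, b)).comp (PiLp.continuous_ofLp 2 _)

lemma norm_vec (M : Controller dx du) : ‖vec M‖ = frob M := by
  rw [EuclideanSpace.norm_eq, frob, Fintype.sum_prod_type]
  simp [vec_apply]

lemma inner_vec (M N : Controller dx du) : inner ℝ (vec M) (vec N) = (Mᵀ * N).trace := by
  rw [PiLp.inner_apply, Fintype.sum_prod_type, Finset.sum_comm]
  simp [vec_apply, Matrix.trace, Matrix.mul_apply, mul_comm]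

lemma vec_direction (g : Controller dx du) :
    vec ((frob g)⁻¹ • g) = ‖vec g‖⁻¹ • vec g := by
  rw [map_smul, norm_vec]

end Vectorization

/-! ### Integrating first over the noise, then over the exploration -/

section BlockExpectation

lemma integral_of_indepFun {Ω α β E : Type*} [MeasurableSpace Ω] {P : Measure Ω}
    [IsProbabilityMeasure P]
    [MeasurableSpace α] [MeasurableSpace β] [NormedAddCommGroup E] [NormedSpace ℝ E]
    {X : Ω → α} {Y : Ω → β} (h : IndepFun X Y P) (hX : Measurable X) (hY : Measurable Y)
    {f : α × β → E} (hf : StronglyMeasurable f) (hi : Integrable (fun ω => f (X ω, Y ω)) P) :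
    ∫ ω, f (X ω, Y ω) ∂P = ∫ ω, ∫ ω', f (X ω', Y ω) ∂P ∂P := by
  have hXY := (indepFun_iff_map_prod_eq_prod_map_map hX.aemeasurable hY.aemeasurable).mp h
  have : IsProbabilityMeasure (P.map X) := Measure.isProbabilityMeasure_map hX.aemeasurable
  have : IsProbabilityMeasure (P.map Y) := Measure.isProbabilityMeasure_map hY.aemeasurable
  have hi' : Integrable f ((P.map X).prod (P.map Y)) := by
    rw [← hXY]
    exact (integrable_map_measure hf.aestronglyMeasurable (hX.prodMk hY).aemeasurable).mpr hi
  have e1 : ∫ ω, f (X ω, Y ω) ∂P = ∫ q, f q ∂(P.map fun ω => (X ω, Y ω)) :=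
    (integral_map (hX.prodMk hY).aemeasurable hf.aestronglyMeasurable).symm
  have hsm : StronglyMeasurable fun y => ∫ x, f (x, y) ∂(P.map X) :=
    (hf.comp_measurable measurable_swap).integral_prod_right'
  rw [e1, hXY, integral_prod_symm _ hi', integral_map hY.aemeasurable hsm.aestronglyMeasurable]
  refine integral_congr_ae (ae_of_all _ fun ω => ?_)
  exact integral_map hX.aemeasurable
    (hf.comp_measurable (measurable_id.prodMk measurable_const)).aestronglyMeasurable

variable {dx du : ℕ} {Ω : Type*} [mΩ : MeasurableSpace Ω] {P : Measure Ω}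
  {w : ℕ → Ω → Fin dx → ℝ} {G : ℕ → ℕ → Ω → Controller dx du} {σ W : ℝ}

lemma IsGaussianExploration.measurable_matrix (hG : IsGaussianExploration P G) (j i : ℕ) :
    Measurable (G j i) :=
  measurable_pi_lambda _ fun a => measurable_pi_lambda _ fun b => hG.measurable j i a b

lemma measurable_trunc (τ t : ℕ) : Measurable fun v : ℕ → Fin dx → ℝ => trunc τ fun s => v (t + s) := by
  refine measurable_pi_lambda _ fun k => ?_
  by_cases hk : k < τ
  · simpa only [trunc, hk, if_true] using measurable_pi_apply (t + k)
  · simpa only [trunc, hk, if_false] using measurable_const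

lemma IsNoise.measurable_noise (hw : IsNoise P w σ W) : Measurable fun ω t => w t ω :=
  measurable_pi_lambda _ hw.measurable

lemma measurable_block (hw : IsNoise P w σ W) (hG : IsGaussianExploration P G) (τ t j i : ℕ) :
    Measurable (block w G τ t j i) :=
  ((measurable_trunc τ t).comp hw.measurable_noise).prodMk (hG.measurable_matrix j i)

/-- The expectation over a block is an iterated expectation over its noise and its exploration
matrix. -/
lemma integral_block [IsProbabilityMeasure P] (hw : IsNoise P w σ W)
    (hG : IsGaussianExploration P G)
    (hI : IndepFun (fun ω t => w t ω)
      (fun ω (q : ℕ × ℕ × Fin du × Fin dx) => G q.1 q.2.1 ω q.2.2.1 q.2.2.2) P)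
    {E : Type*} [NormedAddCommGroup E] [NormedSpace ℝ E] (τ t j i : ℕ)
    {f : (ℕ → Fin dx → ℝ) × Controller dx du → E} (hf : StronglyMeasurable f)
    (hi : Integrable (fun ω => f (block w G τ t j i ω)) P) :
    ∫ ω, f (block w G τ t j i ω) ∂P
      = ∫ ω, ∫ ω', f (trunc τ fun s => w (t + s) ω', G j i ω) ∂P ∂P := by
  have h1 : Measurable fun g : ℕ × ℕ × Fin du × Fin dx → ℝ =>
      (Matrix.of fun a b => g (j, i, a, b) : Controller dx du) :=
    measurable_pi_lambda _ fun a => measurable_pi_lambda _ fun b => measurable_pi_apply _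
  have h2 : IndepFun (fun ω => trunc τ fun s => w (t + s) ω) (G j i) P :=
    hI.comp (measurable_trunc τ t) h1
  exact integral_of_indepFun h2 ((measurable_trunc τ t).comp hw.measurable_noise)
    (hG.measurable_matrix j i) hf hi

lemma map_vec_exploration [IsProbabilityMeasure P] (hG : IsGaussianExploration P G) (j i : ℕ) :
    P.map (fun ω => vec (G j i ω)) = stdGaussian (EuclideanSpace ℝ (Fin du × Fin dx)) := by
  have h1 : iIndepFun (fun (q : Fin du × Fin dx) ω => G j i ω q.1 q.2) P :=
    hG.indep.precomp (g := fun q : Fin du × Fin dx => (j, i, q.1, q.2)) fun q q' h => by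
      simpa [Prod.ext_iff] using h
  have h2 := (iIndepFun_iff_map_fun_eq_pi_map fun q : Fin du × Fin dx =>
    (hG.measurable j i q.1 q.2).aemeasurable).mp h1
  simp only [hG.law] at h2
  have h3 : Measurable fun ω (q : Fin du × Fin dx) => G j i ω q.1 q.2 :=
    measurable_pi_lambda _ fun q => hG.measurable j i q.1 q.2
  rw [← map_pi_eq_stdGaussian, ← h2]
  exact (Measure.map_map (WithLp.measurable_toLp 2 _) h3).symm

lemma isUniformDirection_exploration [IsProbabilityMeasure P] [NeZero dx] [NeZero du]
    (hG : IsGaussianExploration P G) (j i : ℕ) :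
    IsUniformDirection P fun ω => vec ((frob (G j i ω))⁻¹ • G j i ω) := by
  simp only [vec_direction]
  exact isUniformDirection_of_gaussian (P := P)
    (continuous_vec.measurable.comp (hG.measurable_matrix j i)) (map_vec_exploration hG j i)

lemma IsNoise.dot_self_le (hw : IsNoise P w σ W) :
    ∀ᵐ ω ∂P, ∀ t, w t ω ⬝ᵥ w t ω ≤ W ^ 2 := by
  rw [ae_all_iff]
  intro t
  filter_upwards [hw.bounded t] with ω hω
  rw [← euc_sq]
  exact pow_le_pow_left₀ (norm_nonneg _) hω 2

lemma dot_self_trunc_le {v : ℕ → Fin dx → ℝ} (hv : ∀ k, v k ⬝ᵥ v k ≤ W ^ 2) (τ t k : ℕ) :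
    (trunc τ fun s => v (t + s)) k ⬝ᵥ (trunc τ fun s => v (t + s)) k ≤ W ^ 2 := by
  by_cases hk : k < τ
  · simpa [trunc, hk] using hv (t + k)
  · simpa [trunc, hk] using sq_nonneg W

lemma IsNoise.block_dot_self_le (hw : IsNoise P w σ W) (τ t j i : ℕ) :
    ∀ᵐ ω ∂P, ∀ k < τ, (block w G τ t j i ω).1 k ⬝ᵥ (block w G τ t j i ω).1 k ≤ W ^ 2 := by
  filter_upwards [hw.dot_self_le] with ω hω k _ using dot_self_trunc_le hω τ t k

/-- The expected value of a quadratic form in the state of a sub-epoch, for given exploration. -/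
lemma IsNoise.integral_rollout_trunc [IsProbabilityMeasure P] (hw : IsNoise P w σ W)
    (S : System dx du) (K : Controller dx du) (x : Fin dx → ℝ) (t : ℕ) {s τ : ℕ} (hs : s ≤ τ)
    (N : Matrix (Fin dx) (Fin dx) ℝ) :
    ∫ ω, S.rollout K x (trunc τ fun s => w (t + s) ω) s ⬝ᵥ
        N *ᵥ S.rollout K x (trunc τ fun s => w (t + s) ω) s ∂P
      = S.expQuad (noiseCov P w) K x s N := by
  simp only [S.rollout_trunc _ _ _ hs]
  exact hw.integral_rollout_quad S K x t s N

lemma IsNoise.integrable_rollout_trunc [IsProbabilityMeasure P] (hw : IsNoise P w σ W)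
    (S : System dx du) (K : Controller dx du) (x : Fin dx → ℝ) (t : ℕ) {s τ : ℕ} (hs : s ≤ τ)
    (N : Matrix (Fin dx) (Fin dx) ℝ) :
    Integrable (fun ω => S.rollout K x (trunc τ fun s => w (t + s) ω) s ⬝ᵥ
        N *ᵥ S.rollout K x (trunc τ fun s => w (t + s) ω) s) P := by
  simp only [S.rollout_trunc _ _ _ hs]
  exact hw.integrable_rollout_quad S K x t s N

end BlockExpectation

/-! ### The gradient of the cost and the smoothing bias -/

section GradientBias

variable {dx du : ℕ} {S : System dx du} {V : Matrix (Fin dx) (Fin dx) ℝ} {a ψ ν σ κ W r : ℝ}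
  {K : Controller dx du}

/-- The gradient of the average cost. -/
def System.gradient (S : System dx du) (V : Matrix (Fin dx) (Fin dx) ℝ) (K : Controller dx du) :
    Controller dx du := (2 : ℝ) • (S.advantage K * S.statCov V K)

/-- Test the gradient `M` against itself: `‖M‖_F² = 2 tr(Mᵀ E Σ)`, with `E` the advantage and `Σ`
the covariance. The trace of `Σ` is controlled by the cost, so the Frobenius bound carries no
dimension factor. -/
lemma System.Bounds.frob_gradient_le (h : S.Bounds V a ψ ν σ κ) (hK : S.Fine V ν K) :
    frob (S.gradient V K) ≤ 4 * √a * ψ * κ ^ 2 * (ν / a) := by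
  have ha := h.a_pos
  have hk := h.kappa_pos
  have hp := h.psi_pos
  have hn := h.nu_pos
  set M := S.gradient V K with hM
  have h1 : frob M ^ 2 ≤ frob M * (4 * √a * ψ * κ ^ 2 * (ν / a)) := by
    rw [frob_sq]
    have e : (Mᵀ * M).trace = 2 * ((Mᵀ * S.advantage K) * S.statCov V K).trace := by
      conv_lhs => rw [hM]
      rw [System.gradient, Matrix.mul_smul, Matrix.trace_smul, Matrix.mul_assoc, smul_eq_mul]
      congr 4
    rw [e]
    have h2 := (le_abs_self _).trans
      (abs_trace_mul_le (Mᵀ * S.advantage K) (h.statCov_psd hK.1))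
    have h3 : ‖Mᵀ * S.advantage K‖ ≤ frob M * (2 * √a * ψ * κ ^ 2) :=
      (Matrix.l2_opNorm_mul _ _).trans (mul_le_mul
        ((norm_transpose_eq M).le.trans (norm_le_frob M)) (h.norm_advantage_le hK) (norm_nonneg _)
        (frob_nonneg M))
    have h4 := mul_le_mul h3 (h.statCov_trace_le hK) (h.statCov_trace_nonneg hK.1)
      (mul_nonneg (frob_nonneg M) (by positivity))
    linarith
  by_cases h0 : frob M = 0
  · rw [h0]; positivity
  · exact le_of_mul_le_mul_left (by rwa [sq] at h1) ((frob_nonneg M).lt_of_ne' h0)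

lemma perturb_eq (r : ℝ) (K g : Controller dx du) :
    perturb r K g = K + r • vec.symm (vec ((frob g)⁻¹ • g)) := by
  rw [LinearEquiv.symm_apply_apply, perturb]

lemma norm_smul_vec_symm_le (hr : 0 ≤ r) {y : EuclideanSpace ℝ (Fin du × Fin dx)} :
    ‖r • (vec.symm y : Controller dx du)‖ ≤ r * ‖y‖ := by
  rw [norm_smul, Real.norm_of_nonneg hr]
  refine mul_le_mul_of_nonneg_left ((norm_le_frob _).trans (le_of_eq ?_)) hr
  rw [← norm_vec, LinearEquiv.apply_symm_apply]

variable {Ω : Type*} [mΩ : MeasurableSpace Ω] {P : Measure Ω} [IsProbabilityMeasure P]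

/-- The bias of the one-point gradient estimate. -/
lemma System.Bounds.norm_onePoint_gradient_sub_le [NeZero dx] [NeZero du]
    (h : S.Bounds V a ψ ν σ κ) (hr : 0 < r)
    (hr' : r ≤ √a / (16 * ψ * κ ^ 3)) (hK : S.Fine V (ν / 2) K)
    {u : Ω → EuclideanSpace ℝ (Fin du × Fin dx)} (hu : IsUniformDirection P u) :
    ‖((dx : ℝ) * du / r) • ∫ ω, S.avgCost V (K + r • vec.symm (u ω)) • u ω ∂P
      - vec (S.gradient V K)‖ ≤ 25 * ψ ^ 2 * κ ^ 5 * (ν / a) * r := by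
  have hp := h.psi_pos
  have hk := h.kappa_pos
  have hf : Measurable fun y : EuclideanSpace ℝ (Fin du × Fin dx) =>
      S.avgCost V (K + r • vec.symm y) :=
    (S.measurable_avgCost V).comp
      (continuous_const.add (continuous_vec_symm.const_smul r)).measurable
  have hnorm : ∀ y : EuclideanSpace ℝ (Fin du × Fin dx), ‖y‖ ≤ 1 →
      ‖r • (vec.symm y : Controller dx du)‖ ≤ r := fun y hy =>
    (norm_smul_vec_symm_le hr.le).trans (mul_le_of_le_one_right hr.le hy)
  have hfine : ∀ y : EuclideanSpace ℝ (Fin du × Fin dx), ‖y‖ ≤ 1 →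
      S.Fine V ν (K + r • vec.symm y) := fun y hy => h.fine_add hK ((hnorm y hy).trans hr')
  -- Applied to `y ↦ J(K + r y)`: the slope is scaled by `r`, and the deviation has one factor `r`
  -- from smoothness and one from the scaling.
  have key := hu.norm_onePoint_sub_le hf (g := r • vec (S.gradient V K))
    (ε := 25 * ψ ^ 2 * κ ^ 5 * (ν / a) * r * r) fun x y hx hy => by
      have h1 := h.abs_avgCost_sub_le (hK.mono (by linarith [h.nu_pos])) (hfine y hy) (hfine x hx)
        (hnorm y hy) (hnorm x hx) (hr'.trans (div_le_div_of_nonneg_left (Real.sqrt_nonneg a)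
          (by positivity) (by nlinarith [show 0 < ψ * κ ^ 3 by positivity])))
      have e : r • (vec.symm x : Controller dx du) - r • vec.symm y = r • vec.symm (x - y) := by
        rw [map_sub, smul_sub]
      rw [e] at h1
      have e2 : 2 * ((r • (vec.symm (x - y) : Controller dx du))ᵀ
          * (S.advantage K * S.statCov V K)).trace
          = inner ℝ (r • vec (S.gradient V K)) (x - y) := by
        rw [← inner_vec, System.gradient, map_smul, map_smul, LinearEquiv.apply_symm_apply]
        simp only [inner_smul_left, inner_smul_right, real_inner_comm (x - y)]
        simp
        ring
      rw [e2] at h1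
      refine h1.trans ?_
      have h3 := norm_smul_vec_symm_le (dx := dx) (du := du) hr.le (y := x - y)
      have := h.nu_pos
      have := h.a_pos
      calc _ ≤ 25 * ψ ^ 2 * κ ^ 5 * (ν / a) * r * (r * ‖x - y‖) :=
            mul_le_mul_of_nonneg_left h3 (by positivity)
        _ = _ := by ring
  have e : ((dx : ℝ) * du / r) • ∫ ω, S.avgCost V (K + r • vec.symm (u ω)) • u ω ∂P
      - vec (S.gradient V K) = r⁻¹ • ((Fintype.card (Fin du × Fin dx) : ℝ) •
        ∫ ω, S.avgCost V (K + r • vec.symm (u ω)) • u ω ∂P - r • vec (S.gradient V K)) := by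
    rw [smul_sub, smul_smul, smul_smul, inv_mul_cancel₀ hr.ne', one_smul]
    congr 2
    simp
    field_simp
  rw [e, norm_smul, Real.norm_of_nonneg (by positivity)]
  refine (mul_le_mul_of_nonneg_left key (by positivity)).trans (le_of_eq ?_)
  field_simp

end GradientBias

/-! ### Concentration on the event that all states are good -/

section RestrictedAzuma

variable {Ω 𝒵 Ξ : Type*} [mΩ : MeasurableSpace Ω] [MeasurableSpace 𝒵] [MeasurableSpace Ξ]
  {P : Measure Ω} [IsProbabilityMeasure P] {F : ℕ → MeasurableSpace Ω} {Z : ℕ → Ω → 𝒵}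
  {ξ : ℕ → Ω → Ξ}

namespace IsChain

/-- Azuma's inequality for increments that are only controlled on a set of states. -/
lemma azuma_on (h : IsChain P F Z ξ) {A : Set 𝒵} (hA : MeasurableSet A) {D : ℕ → 𝒵 → Ξ → ℝ}
    (hD : ∀ n, Measurable (Function.uncurry (D n))) {b c L : ℝ} (hc : 0 < c) (hL : 0 ≤ L)
    (hb0 : 0 ≤ b)
    (hb : ∀ n, ∀ z ∈ A, ∀ᵐ ω ∂P, |D n z (ξ n ω)| ≤ c)
    (hm : ∀ n, ∀ z ∈ A, ∫ ω, D n z (ξ n ω) ∂P ≤ b) {N : ℕ} (hN : 0 < N) :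
    P {ω | (∀ k < N, Z k ω ∈ A) ∧
        N * b + c * √(2 * N * L) ≤ ∑ k ∈ Finset.range N, D k (Z k ω) (ξ k ω)}
      ≤ ENNReal.ofReal (Real.exp (-L)) := by
  classical
  -- Increments are set to zero outside `A`. The bounds then hold for every state, the mean bound
  -- because `0 ≤ b`, and on the event in question the sum is unchanged.
  have hD' : ∀ n, Measurable (Function.uncurry fun z x => if z ∈ A then D n z x else 0) := fun n =>
    Measurable.ite (measurable_fst hA) (hD n) measurable_const
  refine (measure_mono ?_).trans (h.azuma hD' hc hL (b := b) (fun n z => ?_) (fun n z => ?_) hN)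
  · rintro ω ⟨h1, h2⟩
    refine h2.trans (le_of_eq (Finset.sum_congr rfl fun k hk => ?_))
    rw [if_pos (h1 k (Finset.mem_range.mp hk))]
  · by_cases hz : z ∈ A
    · simpa only [hz, if_true] using hb n z hz
    · simp [hz, hc.le]
  · by_cases hz : z ∈ A
    · simpa only [hz, if_true] using hm n z hz
    · simpa [hz] using hb0

/-- Concentration in a Hilbert space of increments that are only controlled on a set of states. -/
lemma azuma_norm_on {E : Type*} [NormedAddCommGroup E] [InnerProductSpace ℝ E] [MeasurableSpace E]
    [BorelSpace E] [SecondCountableTopology E] [CompleteSpace E]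
    (h : IsChain P F Z ξ) {A : Set 𝒵} (hA : MeasurableSet A) {D : ℕ → 𝒵 → Ξ → E}
    (hD : ∀ n, Measurable (Function.uncurry (D n))) {c L : ℝ} (hc : 0 < c) (hL : 0 ≤ L)
    (hb : ∀ n, ∀ z ∈ A, ∀ᵐ ω ∂P, ‖D n z (ξ n ω)‖ ≤ c) {N : ℕ} (hN : 0 < N) :
    P {ω | (∀ k < N, Z k ω ∈ A) ∧ 2 * c * √N * (3 / 2) + 2 * c * √(2 * N * L)
        ≤ ‖∑ k ∈ Finset.range N, (D k (Z k ω) (ξ k ω) - ∫ ω', D k (Z k ω) (ξ k ω') ∂P)‖}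
      ≤ ENNReal.ofReal (Real.exp (-L)) := by
  classical
  have hmean : ∀ n, Measurable fun z => ∫ ω, D n z (ξ n ω) ∂P := fun n => by
    have h1 : StronglyMeasurable fun q : 𝒵 × Ω => D n q.1 (ξ n q.2) :=
      ((hD n).comp (measurable_fst.prodMk ((h.measurable_innov n).comp measurable_snd))).stronglyMeasurable
    exact h1.integral_prod_right'.measurable
  have hD' : ∀ n, Measurable (Function.uncurry fun z x =>
      if z ∈ A then D n z x - ∫ ω, D n z (ξ n ω) ∂P else 0) := fun n =>
    Measurable.ite (measurable_fst hA) ((hD n).sub ((hmean n).comp measurable_fst))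
      measurable_const
  have hmean_le : ∀ n, ∀ z ∈ A, ‖∫ ω, D n z (ξ n ω) ∂P‖ ≤ c := fun n z hz => by
    have := norm_integral_le_of_norm_le_const (hb n z hz)
    simpa using this
  -- Centering at most doubles the bound on the increments.
  refine (measure_mono ?_).trans (h.azuma_norm hD' (c := 2 * c) (by positivity) hL
    (fun n z => ?_) (fun n z => ?_) hN)
  · rintro ω ⟨h1, h2⟩
    refine h2.trans (le_of_eq (congrArg _ (Finset.sum_congr rfl fun k hk => ?_)))
    rw [if_pos (h1 k (Finset.mem_range.mp hk))]
  · by_cases hz : z ∈ A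
    · simp only [hz, if_true]
      filter_upwards [hb n z hz] with ω hω
      refine (norm_sub_le _ _).trans ?_
      linarith [hmean_le n z hz]
    · simp [hz, hc.le]
  · by_cases hz : z ∈ A
    · simp only [hz, if_true]
      have hi : Integrable (fun ω => D n z (ξ n ω)) P := Integrable.of_bound
        ((hD n).comp (measurable_const.prodMk (h.measurable_innov n))).aestronglyMeasurable c
        (hb n z hz)
      rw [integral_sub hi (integrable_const _)]
      simp
    · simp [hz]

end IsChain

end RestrictedAzuma

lemma norm_smul_sub_le_of_norm_sub_le {E : Type*} [NormedAddCommGroup E] [NormedSpace ℝ E]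
    {x y g : E} {t ε ε' : ℝ} (ht : 0 ≤ t) (h : ‖x - y‖ ≤ ε) (h' : ‖t • y - g‖ ≤ ε') :
    ‖t • x - g‖ ≤ ε' + t * ε := by
  have e : t • x - g = (t • y - g) + t • (x - y) := by rw [smul_sub]; abel
  rw [e]
  refine (norm_add_le _ _).trans (add_le_add h' ?_)
  rw [norm_smul, Real.norm_of_nonneg ht]
  exact mul_le_mul_of_nonneg_left h ht

/-! ### Bias of the gradient estimate of a sub-epoch -/

section EpochError

variable {dx du : ℕ} {S : System dx du} {a ψ ν σ κ W r : ℝ}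
  {Ω : Type*} [mΩ : MeasurableSpace Ω] {P : Measure Ω} [IsProbabilityMeasure P]
  {w : ℕ → Ω → Fin dx → ℝ} {G : ℕ → ℕ → Ω → Controller dx du}

omit mΩ [IsProbabilityMeasure P] in
lemma continuous_expQuad_stageCost (S : System dx du) (V : Matrix (Fin dx) (Fin dx) ℝ)
    (x : Fin dx → ℝ) (s : ℕ) : Continuous fun K => S.expQuad V K x s (S.stageCost K) := by
  have h1 := S.continuous_closedLoop
  have h2 := S.continuous_stageCost
  unfold System.expQuad
  have h3 : ∀ k, Continuous fun K => S.closedLoop K ^ k := fun k => h1.pow k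
  refine Continuous.add ?_ (continuous_finsetSum _ fun k _ => ?_)
  · exact ((h3 s).matrix_mulVec continuous_const).dotProduct
      (h2.matrix_mulVec ((h3 s).matrix_mulVec continuous_const))
  · exact (((((h3 k).matrix_transpose).mul h2).mul (h3 k)).mul continuous_const).matrix_trace

omit mΩ [IsProbabilityMeasure P] in
lemma measurable_vec_blockGrad (S : System dx du) (r : ℝ) (τ : ℕ)
    (z : Controller dx du × (Fin dx → ℝ)) : Measurable fun b => vec (blockGrad S r τ z b) := by
  have h1 : Measurable fun b : (ℕ → Fin dx → ℝ) × Controller dx du => (z, b) :=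
    measurable_const.prodMk measurable_id
  have h2 := (measurable_blockGrad S r τ).comp h1
  exact continuous_vec.measurable.comp h2

omit mΩ [IsProbabilityMeasure P] in
lemma norm_vec_blockGrad_le {τ : ℕ} {z : Controller dx du × (Fin dx → ℝ)}
    {b : (ℕ → Fin dx → ℝ) × Controller dx du} :
    ‖vec (blockGrad S r τ z b)‖ ≤ |blockCost S r z b (τ - 1)| := by
  rw [blockGrad, map_smul, norm_smul, norm_vec]
  exact mul_le_of_le_one_right (norm_nonneg _) (frob_smul_inv_le _)

omit [IsProbabilityMeasure P] in
lemma norm_vec_blockGrad_ae_le (hw : IsNoise P w σ W)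
    (h : S.Bounds (noiseCov P w) a ψ ν σ κ) (hr : 0 ≤ r) (hr' : r ≤ √a / (16 * ψ * κ ^ 3))
    {z : Controller dx du × (Fin dx → ℝ)} (hz : z ∈ goodStart S (noiseCov P w) ν κ W) {τ : ℕ}
    (hq : (1 - 1 / (2 * κ ^ 2)) ^ (τ - 1) ≤ 1 / (16 * κ ^ 2)) (t j i : ℕ) :
    ∀ᵐ ω ∂P, ‖vec (blockGrad S r τ z (block w G τ t j i ω))‖ ≤ 5 * a * κ ^ 6 * W ^ 2 := by
  filter_upwards [hw.block_dot_self_le (G := G) τ t j i] with ω hω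
  refine norm_vec_blockGrad_le.trans ?_
  rw [abs_of_nonneg (h.blockCost_nonneg _)]
  exact h.blockCost_last_le hr hr' hz hω hq

/-- The bias of the one-point gradient estimate from a state after finite mixing. -/
lemma norm_onePoint_expQuad_sub_le [NeZero dx] [NeZero du] {V : Matrix (Fin dx) (Fin dx) ℝ}
    (h : S.Bounds V a ψ ν σ κ) (hr : 0 < r) (hr' : r ≤ √a / (16 * ψ * κ ^ 3))
    {z : Controller dx du × (Fin dx → ℝ)} (hz : z ∈ goodStart S V ν κ W) (s : ℕ)
    {u : Ω → EuclideanSpace ℝ (Fin du × Fin dx)} (hu : IsUniformDirection P u) :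
    ‖((dx : ℝ) * du / r) • ∫ ω, S.expQuad V (z.1 + r • vec.symm (u ω)) z.2 s
          (S.stageCost (z.1 + r • vec.symm (u ω))) • u ω ∂P - vec (S.gradient V z.1)‖
      ≤ 25 * ψ ^ 2 * κ ^ 5 * (ν / a) * r + (dx : ℝ) * du / r *
        ((1 - 1 / κ ^ 2) ^ s * (8 * a * κ ^ 8 * W ^ 2 + ν)) := by
  have ha := h.a_pos
  have hk := h.kappa_pos
  have hfine : ∀ ω, S.Fine V ν (z.1 + r • vec.symm (u ω)) := fun ω =>
    h.fine_add hz.1 (((norm_smul_vec_symm_le hr.le).trans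
      (mul_le_of_le_one_right hr.le (hu.norm_le ω))).trans hr')
  have hmK : Measurable fun ω => z.1 + r • (vec.symm (u ω) : Controller dx du) :=
    (continuous_const.add (continuous_vec_symm.const_smul r)).measurable.comp hu.measurable
  have hJm : Measurable fun ω => S.avgCost V (z.1 + r • vec.symm (u ω)) :=
    (S.measurable_avgCost _).comp hmK
  have hJint : Integrable
      (fun ω => S.avgCost V (z.1 + r • vec.symm (u ω)) • u ω) P := by
    refine Integrable.of_bound (hJm.smul hu.measurable).aestronglyMeasurable ν
      (ae_of_all _ fun ω => ?_)
    rw [norm_smul, Real.norm_of_nonneg (h.avgCost_nonneg (hfine ω).1)]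
    have := hu.norm_le ω
    have := (hfine ω).2
    have := h.nu_pos
    nlinarith [norm_nonneg (u ω)]
  have hdiff : ∀ ω, |S.expQuad V (z.1 + r • vec.symm (u ω)) z.2 s
      (S.stageCost (z.1 + r • vec.symm (u ω))) - S.avgCost V (z.1 + r • vec.symm (u ω))|
      ≤ (1 - 1 / κ ^ 2) ^ s * (8 * a * κ ^ 8 * W ^ 2 + ν) := fun ω => by
    refine (h.abs_expQuad_stageCost_sub_le (hfine ω) _ _).trans ?_
    refine mul_le_mul_of_nonneg_left ?_ (pow_nonneg h.mixing_nonneg _)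
    have := mul_le_mul_of_nonneg_left hz.2 (show 0 ≤ a * κ ^ 2 by positivity)
    linarith
  have hEint : Integrable (fun ω => S.expQuad V (z.1 + r • vec.symm (u ω)) z.2 s
          (S.stageCost (z.1 + r • vec.symm (u ω))) • u ω) P := by
    have hcm := continuous_expQuad_stageCost S V z.2 s
    refine Integrable.of_bound ((hcm.measurable.comp hmK).smul hu.measurable).aestronglyMeasurable
      ((1 - 1 / κ ^ 2) ^ s * (8 * a * κ ^ 8 * W ^ 2 + ν) + ν) (ae_of_all _ fun ω => ?_)
    rw [norm_smul]
    refine (mul_le_of_le_one_right (norm_nonneg _) (hu.norm_le ω)).trans ?_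
    have h1 := abs_le.mp (hdiff ω)
    have h2 := (hfine ω).2
    have h3 := h.avgCost_nonneg (hfine ω).1
    rw [Real.norm_eq_abs, abs_le]
    constructor <;> linarith [h.nu_pos]
  have hsub : ‖∫ ω, S.expQuad V (z.1 + r • vec.symm (u ω)) z.2 s
          (S.stageCost (z.1 + r • vec.symm (u ω))) • u ω ∂P
        - ∫ ω, S.avgCost V (z.1 + r • vec.symm (u ω)) • u ω ∂P‖
      ≤ (1 - 1 / κ ^ 2) ^ s * (8 * a * κ ^ 8 * W ^ 2 + ν) := by
    rw [← integral_sub hEint hJint]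
    have hb : ∀ ω, ‖S.expQuad V (z.1 + r • vec.symm (u ω)) z.2 s
          (S.stageCost (z.1 + r • vec.symm (u ω))) • u ω
        - S.avgCost V (z.1 + r • vec.symm (u ω)) • u ω‖
        ≤ (1 - 1 / κ ^ 2) ^ s * (8 * a * κ ^ 8 * W ^ 2 + ν) := fun ω => by
      rw [← sub_smul, norm_smul]
      exact (mul_le_of_le_one_right (norm_nonneg _) (hu.norm_le ω)).trans (hdiff ω)
    have := norm_integral_le_of_norm_le_const (μ := P) (ae_of_all _ hb)
    rwa [probReal_univ, mul_one] at this
  have hone := h.norm_onePoint_gradient_sub_le hr hr' hz.1 hu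
  have hd : 0 ≤ (dx : ℝ) * du / r := by positivity
  revert hsub hone
  exact norm_smul_sub_le_of_norm_sub_le hd

/-- The bias of the gradient estimate of a single sub-epoch. -/
lemma norm_mean_blockGrad_sub_le [NeZero dx] [NeZero du] (hw : IsNoise P w σ W)
    (hG : IsGaussianExploration P G)
    (hI : IndepFun (fun ω t => w t ω)
      (fun ω (q : ℕ × ℕ × Fin du × Fin dx) => G q.1 q.2.1 ω q.2.2.1 q.2.2.2) P)
    (h : S.Bounds (noiseCov P w) a ψ ν σ κ) (hr : 0 < r) (hr' : r ≤ √a / (16 * ψ * κ ^ 3))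
    {z : Controller dx du × (Fin dx → ℝ)} (hz : z ∈ goodStart S (noiseCov P w) ν κ W) {τ : ℕ}
    (hq : (1 - 1 / (2 * κ ^ 2)) ^ (τ - 1) ≤ 1 / (16 * κ ^ 2)) (t j i : ℕ) :
    ‖((dx : ℝ) * du / r) • ∫ ω, vec (blockGrad S r τ z (block w G τ t j i ω)) ∂P
        - vec (S.gradient (noiseCov P w) z.1)‖
      ≤ 25 * ψ ^ 2 * κ ^ 5 * (ν / a) * r + (dx : ℝ) * du / r *
        ((1 - 1 / κ ^ 2) ^ (τ - 1) * (8 * a * κ ^ 8 * W ^ 2 + ν)) := by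
  have ha := h.a_pos
  have hk := h.kappa_pos
  let u : Ω → EuclideanSpace ℝ (Fin du × Fin dx) := fun ω =>
    vec ((frob (G j i ω))⁻¹ • G j i ω)
  have hu : IsUniformDirection P u := isUniformDirection_exploration hG j i
  have hctrl : ∀ ω, perturb r z.1 (G j i ω) = z.1 + r • vec.symm (u ω) := fun ω =>
    perturb_eq r z.1 _
  have hmeas : Measurable fun b => vec (blockGrad S r τ z b) :=
    measurable_vec_blockGrad S r τ z
  have hint : Integrable (fun ω => vec (blockGrad S r τ z (block w G τ t j i ω))) P :=
    Integrable.of_bound (hmeas.comp (measurable_block hw hG τ t j i)).aestronglyMeasurable _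
      (norm_vec_blockGrad_ae_le hw h hr.le hr' hz hq t j i)
  have e1 : ∫ ω, vec (blockGrad S r τ z (block w G τ t j i ω)) ∂P
      = ∫ ω, S.expQuad (noiseCov P w) (z.1 + r • vec.symm (u ω)) z.2 (τ - 1)
          (S.stageCost (z.1 + r • vec.symm (u ω))) • u ω ∂P := by
    rw [integral_block hw hG hI τ t j i (f := fun b => vec (blockGrad S r τ z b))
      hmeas.stronglyMeasurable hint]
    -- For a fixed direction, integrating the noise replaces the cost of the last round by its
    -- expectation, a function of the direction alone.
    have e2 : ∀ ω, ∫ ω', vec (blockGrad S r τ z (trunc τ fun s => w (t + s) ω', G j i ω)) ∂P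
        = S.expQuad (noiseCov P w) (z.1 + r • vec.symm (u ω)) z.2 (τ - 1)
          (S.stageCost (z.1 + r • vec.symm (u ω))) • u ω := fun ω => by
      rw [← hctrl, ← hw.integral_rollout_trunc S _ _ t (Nat.sub_le τ 1), ← integral_smul_const]
      simp only [blockGrad, map_smul, blockCost, blockState, u]
    simp only [e2]
  rw [e1]
  exact norm_onePoint_expQuad_sub_le h hr hr' hz (τ - 1) hu

end EpochError

/-! ### Inexact gradient steps -/

section Descent

variable {dx du : ℕ} {S : System dx du} {V : Matrix (Fin dx) (Fin dx) ℝ} {a ψ ν σ κ η e : ℝ}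
  {K g : Controller dx du}

/-- With `y = v + d`, the left side is at most `-‖v‖² + e ‖v‖ + (‖v‖ + e)² / 100`, whose maximum
over `‖v‖` is below `3 e² / 4`. Thus the exact gradient may have any size. -/
lemma neg_inner_add_sq_le {E : Type*} [NormedAddCommGroup E] [InnerProductSpace ℝ E] {y v : E}
    (he : ‖y - v‖ ≤ e) : -inner ℝ y v + 1 / 100 * ‖y‖ ^ 2 ≤ 3 / 4 * e ^ 2 := by
  obtain ⟨d, rfl⟩ : ∃ d, y = v + d := ⟨y - v, by abel⟩
  rw [add_sub_cancel_left] at he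
  rw [inner_add_left, real_inner_self_eq_norm_sq]
  have h1 := (abs_le.mp (abs_real_inner_le_norm d v)).1
  have h2 := norm_add_le v d
  have h3 := norm_nonneg d
  have h4 := norm_nonneg v
  have h5 : ‖v + d‖ ^ 2 ≤ (‖v‖ + e) ^ 2 := pow_le_pow_left₀ (norm_nonneg _) (by linarith) 2
  have h6 : ‖d‖ * ‖v‖ ≤ e * ‖v‖ := mul_le_mul_of_nonneg_right he h4
  nlinarith [sq_nonneg (‖v‖ - e), sq_nonneg (‖v‖ - e / 2), sq_nonneg e]

/-- A gradient step with an inexact gradient does not increase the average cost by much. -/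
lemma System.Bounds.descent (h : S.Bounds V a ψ ν σ κ) (hK : S.Fine V (ν / 2) K)
    (hη : η * (128 * ν * ψ ^ 2 * κ ^ 10) = a) (he : ‖vec g - vec (S.gradient V K)‖ ≤ e)
    (he' : e ≤ 2 / 3 * (ν / κ ^ 2)) :
    StableMat (S.closedLoop (K - η • g)) ∧
      S.avgCost V (K - η • g) ≤ S.avgCost V K + 3 / 4 * η * e ^ 2 := by
  have ha := h.a_pos
  have hk := h.kappa_ge
  have hp := h.psi_ge
  have hn := h.nu_pos
  have hs : 0 < √a := Real.sqrt_pos.mpr ha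
  have hsa : √a * √a = a := Real.mul_self_sqrt ha.le
  have hs1 := h.sqrt_a_le
  have hK' : S.Fine V ν K := hK.mono (by linarith)
  have hη0 : 0 < η := by
    rw [← hη] at ha
    exact pos_of_mul_pos_left ha (by positivity)
  have hη1 : η = a / (128 * ν * ψ ^ 2 * κ ^ 10) := by
    rw [eq_div_iff (by positivity)]; exact hη
  have he0 : 0 ≤ e := (norm_nonneg _).trans he
  set y := vec g with hy
  set v := vec (S.gradient V K) with hv
  have hvn : ‖v‖ ≤ 4 * √a * ψ * κ ^ 2 * (ν / a) := by
    rw [hv, norm_vec]; exact h.frob_gradient_le hK'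
  have hyn : ‖y‖ ≤ 4 * √a * ψ * κ ^ 2 * (ν / a) + 2 / 3 * (ν / κ ^ 2) := by
    have : y = v + (y - v) := by abel
    rw [this]
    exact (norm_add_le _ _).trans (add_le_add hvn (he.trans he'))
  have hstep : η * ‖y‖ ≤ √a / (16 * ψ * κ ^ 3) := by
    refine (mul_le_mul_of_nonneg_left hyn hη0.le).trans ?_
    have e1 : η * (4 * √a * ψ * κ ^ 2 * (ν / a) + 2 / 3 * (ν / κ ^ 2))
        = √a / (16 * ψ * κ ^ 3) * (1 / (2 * κ ^ 5) + √a / (12 * ψ * κ ^ 9)) := by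
      rw [hη1]
      field_simp
      linear_combination (-768) * hsa
    rw [e1]
    refine mul_le_of_le_one_right (by positivity) ?_
    have h2 : 1 / (2 * κ ^ 5) ≤ 1 / 2 := by
      rw [div_le_div_iff₀ (by positivity) (by positivity)]
      linarith [one_le_pow₀ (n := 5) (show 1 ≤ κ by linarith)]
    have h3 : √a / (12 * ψ * κ ^ 9) ≤ 1 / 2 := by
      rw [div_le_div_iff₀ (by positivity) (by positivity)]
      have : 1 ≤ ψ * κ ^ 9 := one_le_mul_of_one_le_of_one_le hp (one_le_pow₀ (by linarith))
      linarith
    linarith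
  have hgn : ‖-(η • g)‖ ≤ η * ‖y‖ := by
    rw [norm_neg, norm_smul, Real.norm_of_nonneg hη0.le, hy, norm_vec]
    exact mul_le_mul_of_nonneg_left (norm_le_frob g) hη0.le
  have hD : ‖-(η • g)‖ ≤ √a / (16 * ψ * κ ^ 3) := hgn.trans hstep
  have hK1 : S.Fine V ν (K + -(η • g)) := h.fine_add hK hD
  rw [sub_eq_add_neg]
  refine ⟨hK1.1, ?_⟩
  have hsm := h.abs_avgCost_sub_le hK' (D₁ := 0) (D₂ := -(η • g)) (r := η * ‖y‖)
    (by simpa using hK') hK1 (by simpa using mul_nonneg hη0.le (norm_nonneg y)) hgn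
    (hstep.trans (div_le_div_of_nonneg_left (Real.sqrt_nonneg a) (by positivity)
      (by nlinarith [show 0 < ψ * κ ^ 3 by positivity])))
  have hin : 2 * ((-(η • g) - 0)ᵀ * (S.advantage K * S.statCov V K)).trace = -η * inner ℝ y v := by
    rw [hv, hy, inner_vec, System.gradient, Matrix.mul_smul, Matrix.trace_smul]
    simp
    ring
  have hnorm : ‖-(η • g) - 0‖ ≤ η * ‖y‖ := by rwa [sub_zero]
  rw [hin, add_zero] at hsm
  have h1 := (abs_le.mp hsm).2
  -- The step size makes the smoothness constant times `η` equal to `25 / (128 κ⁵)`, which is below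
  -- `1 / 100` because `κ ≥ 2`.
  have h2 : 25 * ψ ^ 2 * κ ^ 5 * (ν / a) * (η * ‖y‖) * ‖-(η • g) - 0‖ ≤ 1 / 100 * η * ‖y‖ ^ 2 := by
    refine (mul_le_mul_of_nonneg_left hnorm (by positivity)).trans ?_
    have e1 : 25 * ψ ^ 2 * κ ^ 5 * (ν / a) * (η * ‖y‖) * (η * ‖y‖)
        = 25 / (128 * κ ^ 5) * (η * ‖y‖ ^ 2) := by
      nth_rewrite 1 [hη1]
      field_simp
    rw [e1, mul_assoc (1 / 100 : ℝ)]
    refine mul_le_mul_of_nonneg_right ?_ (by positivity)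
    rw [div_le_div_iff₀ (by positivity) (by positivity)]
    have : (2 : ℝ) ^ 5 ≤ κ ^ 5 := pow_le_pow_left₀ (by norm_num) hk 5
    linarith
  have h5 := mul_le_mul_of_nonneg_left (neg_inner_add_sq_le he) hη0.le
  linarith

end Descent

/-! ### Induction over the epochs -/

section Epochs

variable {dx du : ℕ} {S : System dx du} {p : AlgParams} {K₀ : Controller dx du}
  {a ψ ν σ κ W L ρ : ℝ}

/-- The bound on the error of the gradient estimate of epoch `k`. -/
def gradError (dx du : ℕ) (p : AlgParams) (a ψ ν κ W L : ℝ) (k : ℕ) : ℝ :=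
  (dx : ℝ) * du / (p.m k * p.r k) *
      (2 * (5 * a * κ ^ 6 * W ^ 2) * √(p.m k) * (3 / 2)
        + 2 * (5 * a * κ ^ 6 * W ^ 2) * √(2 * p.m k * L))
    + (25 * ψ ^ 2 * κ ^ 5 * (ν / a) * p.r k + (dx : ℝ) * du / p.r k *
        ((1 - 1 / κ ^ 2) ^ (p.τ - 1) * (8 * a * κ ^ 8 * W ^ 2 + ν)))

/-- The properties of the tuning which keep the controllers of the epochs up to `j` good. -/
structure Tuned (dx du : ℕ) (p : AlgParams) (a ψ ν κ W L ρ : ℝ) (j : ℕ) : Prop where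
  eta_eq : p.η * (128 * ν * ψ ^ 2 * κ ^ 10) = a
  rho_eq : 1 - ρ = 4 * ν / κ ^ 4 * p.η / 3
  rho_pos : 0 < ρ
  r_pos : ∀ k, 0 < p.r k
  r_le : ∀ k, p.r k ≤ √a / (16 * ψ * κ ^ 3)
  m_pos : ∀ k, 0 < p.m k
  rate : (1 - 1 / (2 * κ ^ 2)) ^ (p.τ - 1) ≤ 1 / (16 * κ ^ 2)
  L_nonneg : 0 ≤ L
  W_pos : 0 < W
  error_le : ∀ k ≤ j, gradError dx du p a ψ ν κ W L k ≤ 2 / 3 * (ν / κ ^ 2) * √(ρ ^ k)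

variable {Ω : Type*} [mΩ : MeasurableSpace Ω] {P : Measure Ω} [IsProbabilityMeasure P]
  {w : ℕ → Ω → Fin dx → ℝ} {G : ℕ → ℕ → Ω → Controller dx du}

/-- The event that the gradient estimate of epoch `k` is far from its conditional mean. -/
def badEpoch (S : System dx du) (p : AlgParams) (K₀ : Controller dx du) (P : Measure Ω)
    (w : ℕ → Ω → Fin dx → ℝ) (G : ℕ → ℕ → Ω → Controller dx du) (a ν κ W L : ℝ) (k : ℕ) : Set Ω :=
  {ω | (∀ i < p.m k, runState S p K₀ w G k i ω ∈ goodStart S (noiseCov P w) ν κ W) ∧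
    2 * (5 * a * κ ^ 6 * W ^ 2) * √(p.m k) * (3 / 2)
        + 2 * (5 * a * κ ^ 6 * W ^ 2) * √(2 * p.m k * L)
      ≤ ‖∑ i ∈ Finset.range (p.m k),
        (vec (blockGrad S (p.r k) p.τ (runState S p K₀ w G k i ω) (runBlock p w G k i ω))
          - ∫ ω', vec (blockGrad S (p.r k) p.τ (runState S p K₀ w G k i ω)
              (runBlock p w G k i ω')) ∂P)‖}

lemma measure_badEpoch_le (hw : IsNoise P w σ W) (hG : IsGaussianExploration P G)
    (hI : IndepFun (fun ω t => w t ω)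
      (fun ω (q : ℕ × ℕ × Fin du × Fin dx) => G q.1 q.2.1 ω q.2.2.1 q.2.2.2) P)
    (h : S.Bounds (noiseCov P w) a ψ ν σ κ) {j : ℕ} (ht : Tuned dx du p a ψ ν κ W L ρ j) (k : ℕ) :
    P (badEpoch S p K₀ P w G a ν κ W L k) ≤ ENNReal.ofReal (Real.exp (-L)) := by
  have hD : Measurable (Function.uncurry fun z b => vec (blockGrad S (p.r k) p.τ z b)) := by
    have := (measurable_blockGrad S (p.r k) p.τ)
    exact continuous_vec.measurable.comp this
  have ha := h.a_pos
  have hk := h.kappa_pos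
  have hW := ht.W_pos
  exact (isChain_run S p K₀ hw hG hI k).azuma_norm_on measurableSet_goodStart (fun _ => hD)
    (by positivity) ht.L_nonneg
    (fun i z hz => norm_vec_blockGrad_ae_le hw h (ht.r_pos k).le (ht.r_le k) hz ht.rate _ _ _)
    (ht.m_pos k)

omit mΩ in
/-- The state at the beginning of the sub-epochs of an epoch stays small. -/
lemma runState_mem_goodStart {V : Matrix (Fin dx) (Fin dx) ℝ} (h : S.Bounds V a ψ ν σ κ) {j : ℕ}
    (ht : Tuned dx du p a ψ ν κ W L ρ j) {ω : Ω} (hω : ∀ t, w t ω ⬝ᵥ w t ω ≤ W ^ 2) {k : ℕ}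
    (h0 : runState S p K₀ w G k 0 ω ∈ goodStart S V ν κ W) (i : ℕ) :
    runState S p K₀ w G k i ω ∈ goodStart S V ν κ W := by
  induction i with
  | zero => exact h0
  | succ i ih =>
    rw [runState_succ]
    exact h.blockState_mem_goodStart (ht.r_pos k).le (ht.r_le k) ih
      (fun s _ => dot_self_trunc_le hω p.τ _ s) ht.rate

lemma norm_gradEstimate_sub_le [NeZero dx] [NeZero du] (hw : IsNoise P w σ W)
    (hG : IsGaussianExploration P G)
    (hI : IndepFun (fun ω t => w t ω)
      (fun ω (q : ℕ × ℕ × Fin du × Fin dx) => G q.1 q.2.1 ω q.2.2.1 q.2.2.2) P)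
    (h : S.Bounds (noiseCov P w) a ψ ν σ κ) {j : ℕ} (ht : Tuned dx du p a ψ ν κ W L ρ j) {k : ℕ}
    {ω : Ω} (hz : ∀ i, runState S p K₀ w G k i ω ∈ goodStart S (noiseCov P w) ν κ W)
    (hb : ω ∉ badEpoch S p K₀ P w G a ν κ W L k) :
    ‖vec ((((dx : ℝ) * du) / (p.m k * p.r k)) • ∑ i ∈ Finset.range (p.m k),
        blockGrad S (p.r k) p.τ (runState S p K₀ w G k i ω) (runBlock p w G k i ω))
      - vec (S.gradient (noiseCov P w) (runState S p K₀ w G k 0 ω).1)‖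
      ≤ gradError dx du p a ψ ν κ W L k := by
  have hr := ht.r_pos k
  have hm : (0 : ℝ) < p.m k := by exact_mod_cast ht.m_pos k
  have hmean := fun i => norm_mean_blockGrad_sub_le hw hG hI h hr (ht.r_le k) (hz i) ht.rate
    (epochTime p k + i * p.τ) k i
  have hdev := not_le.mp fun hc => hb ⟨fun i _ => hz i, hc⟩
  revert hmean hdev
  generalize hμ : (fun i => ∫ ω', vec (blockGrad S (p.r k) p.τ (runState S p K₀ w G k i ω)
              (runBlock p w G k i ω')) ∂P) = μ
  intro hmean hdev
  have hmean' : ∀ i, ‖((dx : ℝ) * du / p.r k) • μ i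
      - vec (S.gradient (noiseCov P w) (runState S p K₀ w G k 0 ω).1)‖
      ≤ 25 * ψ ^ 2 * κ ^ 5 * (ν / a) * p.r k + (dx : ℝ) * du / p.r k *
        ((1 - 1 / κ ^ 2) ^ (p.τ - 1) * (8 * a * κ ^ 8 * W ^ 2 + ν)) := fun i => by
    rw [← hμ]; exact hmean i
  have hdev' : ‖∑ i ∈ Finset.range (p.m k),
        (vec (blockGrad S (p.r k) p.τ (runState S p K₀ w G k i ω) (runBlock p w G k i ω)) - μ i)‖
      ≤ 2 * (5 * a * κ ^ 6 * W ^ 2) * √(p.m k) * (3 / 2)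
        + 2 * (5 * a * κ ^ 6 * W ^ 2) * √(2 * p.m k * L) := by
    rw [← hμ]; exact hdev.le
  generalize vec (S.gradient (noiseCov P w) (runState S p K₀ w G k 0 ω).1) = g at *
  rw [gradError, map_smul, map_sum]
  -- Fluctuation around the conditional means `μ i`, controlled outside the bad event, plus the
  -- average bias of these means; the target gradient is the same for all sub-epochs because the
  -- base controller is.
  have e : ((dx : ℝ) * du / (p.m k * p.r k)) • ∑ i ∈ Finset.range (p.m k),
      vec (blockGrad S (p.r k) p.τ (runState S p K₀ w G k i ω) (runBlock p w G k i ω)) - g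
      = ((dx : ℝ) * du / (p.m k * p.r k)) • ∑ i ∈ Finset.range (p.m k),
        (vec (blockGrad S (p.r k) p.τ (runState S p K₀ w G k i ω) (runBlock p w G k i ω)) - μ i)
        + (p.m k : ℝ)⁻¹ • ∑ i ∈ Finset.range (p.m k), (((dx : ℝ) * du / p.r k) • μ i - g) := by
    rw [Finset.sum_sub_distrib, Finset.sum_sub_distrib, smul_sub, smul_sub, ← Finset.smul_sum,
      smul_smul, Finset.sum_const, Finset.card_range, ← Nat.cast_smul_eq_nsmul ℝ, smul_smul,
      inv_mul_cancel₀ hm.ne', one_smul,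
      show (p.m k : ℝ)⁻¹ * ((dx : ℝ) * du / p.r k) = (dx : ℝ) * du / (p.m k * p.r k) by
        field_simp]
    abel
  rw [e]
  refine (norm_add_le _ _).trans (add_le_add ?_ ?_)
  · rw [norm_smul, Real.norm_of_nonneg (by positivity)]
    exact mul_le_mul_of_nonneg_left hdev' (by positivity)
  · rw [norm_smul, Real.norm_of_nonneg (by positivity), inv_mul_le_iff₀ hm]
    refine (norm_sum_le _ _).trans ((Finset.sum_le_sum fun i _ => hmean' i).trans ?_)
    rw [Finset.sum_const, Finset.card_range, nsmul_eq_mul]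

/-- Outside of the bad events, all epochs start with a good controller and a small state. -/
lemma runState_zero_mem_goodStart [NeZero dx] [NeZero du] (hw : IsNoise P w σ W)
    (hG : IsGaussianExploration P G)
    (hI : IndepFun (fun ω t => w t ω)
      (fun ω (q : ℕ × ℕ × Fin du × Fin dx) => G q.1 q.2.1 ω q.2.2.1 q.2.2.2) P)
    (h : S.Bounds (noiseCov P w) a ψ ν σ κ) {j : ℕ} (ht : Tuned dx du p a ψ ν κ W L ρ j)
    (hK₀ : S.Fine (noiseCov P w) (ν / 4) K₀) {ω : Ω} (hω : ∀ t, w t ω ⬝ᵥ w t ω ≤ W ^ 2)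
    (hb : ∀ k < j, ω ∉ badEpoch S p K₀ P w G a ν κ W L k) {k : ℕ} (hk : k ≤ j) :
    runState S p K₀ w G k 0 ω ∈ goodStart S (noiseCov P w) ν κ W := by
  have hn := h.nu_pos
  have hρ := ht.rho_pos
  -- The bound `ν/2 - (ν/4) ρ^k` equals `ν/4` at the start. Epoch `k` may add `3/4 η e²` with `e² =
  -- 4/9 (ν²/κ⁴) ρ^k`, which by the choice of `ρ` is exactly `(ν/4)(ρ^k - ρ^(k+1))`.
  suffices hs : (runState S p K₀ w G k 0 ω).2 ⬝ᵥ (runState S p K₀ w G k 0 ω).2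
        ≤ 8 * κ ^ 6 * W ^ 2 ∧
      S.Fine (noiseCov P w) (ν / 2 - ν / 4 * ρ ^ k) (runState S p K₀ w G k 0 ω).1 from
    ⟨hs.2.mono (by have : 0 ≤ ν / 4 * ρ ^ k := by positivity
                   linarith), hs.1⟩
  induction k with
  | zero =>
    rw [runState_epoch_zero]
    refine ⟨?_, hK₀.mono (by rw [pow_zero]; linarith)⟩
    simp only [dotProduct_zero]
    have := h.kappa_pos
    positivity
  | succ k ih =>
    obtain ⟨ih1, ih2⟩ := ih (by omega)
    have hpow : 0 < ν / 4 * ρ ^ k := by positivity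
    have hgood := runState_mem_goodStart h ht hω
      (show runState S p K₀ w G k 0 ω ∈ goodStart S (noiseCov P w) ν κ W from
        ⟨ih2.mono (by linarith), ih1⟩)
    refine ⟨?_, ?_⟩
    · rw [runState_epoch_succ_snd]
      exact (hgood _).2
    · rw [runState_epoch_succ_fst]
      have hη : 0 < p.η := by
        have := h.a_pos
        rw [← ht.eta_eq] at this
        have hp := h.psi_pos
        have hk := h.kappa_pos
        exact pos_of_mul_pos_left this (by positivity)
      have hle := ht.error_le k (by omega)
      have hρ1 : ρ ≤ 1 := by
        have h1 := ht.rho_eq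
        have : 0 ≤ 4 * ν / κ ^ 4 * p.η / 3 := by positivity
        linarith
      have hs1 : √(ρ ^ k) ≤ 1 := Real.sqrt_le_one.mpr (pow_le_one₀ hρ.le hρ1)
      have hνκ : 0 ≤ 2 / 3 * (ν / κ ^ 2) := by positivity
      have hd := h.descent (hgood 0).1 ht.eta_eq
        ((norm_gradEstimate_sub_le hw hG hI h ht hgood (hb k (by omega))).trans hle)
        (mul_le_of_le_one_right hνκ hs1)
      refine ⟨hd.1, hd.2.trans ?_⟩
      have e1 : (2 / 3 * (ν / κ ^ 2) * √(ρ ^ k)) ^ 2 = 4 / 9 * (ν ^ 2 / κ ^ 4) * ρ ^ k := by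
        rw [mul_pow, Real.sq_sqrt (by positivity)]
        ring
      rw [e1, pow_succ ρ k]
      have h3 := ih2.2
      have h4 : ρ = 1 - 4 * ν / κ ^ 4 * p.η / 3 := by linarith [ht.rho_eq]
      have h5 : ν / 4 * (ρ ^ k * ρ) = ν / 4 * ρ ^ k
          - 1 / 3 * p.η * (ν ^ 2 / κ ^ 4) * ρ ^ k := by
        nth_rewrite 2 [h4]
        ring
      rw [h5]
      linarith

end Epochs

/-! ### The value matrix averaged over the exploration -/

section AverageValue

variable {dx du : ℕ} {S : System dx du} {V : Matrix (Fin dx) (Fin dx) ℝ} {a ψ ν σ κ W r : ℝ}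
  {Ω : Type*} [mΩ : MeasurableSpace Ω] {P : Measure Ω} [IsProbabilityMeasure P]
  {g : Ω → Controller dx du}

/-- The value matrix averaged over the exploration. -/
def averageValue (S : System dx du) (P : Measure Ω) (g : Ω → Controller dx du) (r : ℝ)
    (K : Controller dx du) : Matrix (Fin dx) (Fin dx) ℝ :=
  ∫ ω, S.value (perturb r K (g ω)) ∂P

lemma measurable_value_perturb (hg : Measurable g) : Measurable
    fun q : Controller dx du × Ω => S.value (perturb r q.1 (g q.2)) := by
  have h1 : Measurable fun q : Controller dx du × Ω => (q.1, g q.2) :=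
    measurable_fst.prodMk (hg.comp measurable_snd)
  have h2 := (measurable_perturb r).comp h1
  exact S.measurable_value.comp h2

lemma measurable_averageValue (hg : Measurable g) : Measurable (averageValue S P g r) := by
  have h1 := (measurable_value_perturb (S := S) (r := r) hg).stronglyMeasurable
  exact h1.integral_prod_right'.measurable

namespace System.Bounds

variable (h : S.Bounds V a ψ ν σ κ) (hr : 0 ≤ r) (hr' : r ≤ √a / (16 * ψ * κ ^ 3))
  {K : Controller dx du} (hK : S.Fine V (ν / 2) K) (hg : Measurable g)
include h hr hr' hK hg

omit hg [IsProbabilityMeasure P] mΩ in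
lemma fine_perturb_of_fine (M : Controller dx du) : S.Fine V ν (perturb r K M) :=
  h.fine_add hK ((norm_smul_direction_le hr M).trans hr')

lemma integrable_value_perturb : Integrable (fun ω => S.value (perturb r K (g ω))) P :=
  Integrable.of_bound ((measurable_value_perturb (S := S) (r := r) hg).comp
    (measurable_const.prodMk measurable_id)).aestronglyMeasurable (a * κ ^ 2)
    (ae_of_all _ fun _ => h.norm_value_le (h.fine_perturb_of_fine hr hr' hK _))

omit hg in
lemma norm_averageValue_le : ‖averageValue S P g r K‖ ≤ a * κ ^ 2 := by
  have := norm_integral_le_of_norm_le_const (μ := P) (f := fun ω => S.value (perturb r K (g ω)))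
    (ae_of_all _ fun ω => h.norm_value_le (h.fine_perturb_of_fine hr hr' hK (g ω)))
  rwa [probReal_univ, mul_one] at this

omit [IsProbabilityMeasure P] mΩ hg in
lemma norm_value_perturb_sub_le (M : Controller dx du) :
    ‖S.value (perturb r K M) - S.value K‖ ≤ 5 * ψ * κ ^ 4 * r := by
  have hp := h.psi_pos
  have hk := h.kappa_pos
  have hn := norm_smul_direction_le hr M
  refine (h.norm_value_sub_le (hK.mono (by linarith [h.nu_pos]))
    (h.fine_perturb_of_fine hr hr' hK M) ((hn.trans hr').trans
      (div_le_div_of_nonneg_left (Real.sqrt_nonneg a) (by positivity)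
      (by nlinarith [show 0 < ψ * κ ^ 3 by positivity])))).trans ?_
  exact mul_le_mul_of_nonneg_left hn (by positivity)

lemma norm_averageValue_sub_le : ‖averageValue S P g r K - S.value K‖ ≤ 5 * ψ * κ ^ 4 * r := by
  have hi := h.integrable_value_perturb (P := P) hr hr' hK hg
  have e : averageValue S P g r K - S.value K
      = ∫ ω, (S.value (perturb r K (g ω)) - S.value K) ∂P := by
    rw [integral_sub hi (integrable_const _)]
    simp [averageValue]
  rw [e]
  have := norm_integral_le_of_norm_le_const (μ := P)
    (f := fun ω => S.value (perturb r K (g ω)) - S.value K)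
    (ae_of_all _ fun ω => h.norm_value_perturb_sub_le hr hr' hK (g ω))
  rwa [probReal_univ, mul_one] at this

/-- This removes the first-order terms: a linear functional of the random value matrix has as its
mean the functional of the averaged matrix. -/
lemma integral_linear_value (φ : Matrix (Fin dx) (Fin dx) ℝ →ₗ[ℝ] ℝ) :
    Integrable (fun ω => φ (S.value (perturb r K (g ω)))) P ∧
      ∫ ω, φ (S.value (perturb r K (g ω))) ∂P = φ (averageValue S P g r K) := by
  have hi := h.integrable_value_perturb (P := P) hr hr' hK hg
  exact ⟨(LinearMap.toContinuousLinearMap φ).integrable_comp hi,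
    (LinearMap.toContinuousLinearMap φ).integral_comp_comm hi⟩

/-- The mean of the values under exploration, weighted with the state, differs from the value of
the mean only to second order in the exploration radius. -/
lemma expQuad_averageValue_sub_le (x : Fin dx → ℝ) (s : ℕ) (M : Controller dx du) :
    S.expQuad V (perturb r K M) x s (averageValue S P g r K - S.value (perturb r K M))
      ≤ ((averageValue S P g r K - S.value (perturb r K M)) * S.statCov V K).trace
        + (20 * ψ ^ 2 * κ ^ 7 * (ν / a) * r ^ 2
          + 2 * κ ^ 2 * ((1 - 1 / κ ^ 2) ^ s * (a * κ ^ 2 * (x ⬝ᵥ x) + ν))) := by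
  have ha := h.a_pos
  have hk := h.kappa_pos
  have hp := h.psi_pos
  have hn := h.nu_pos
  have hf := h.fine_perturb_of_fine hr hr' hK M
  -- Two bounds on the same matrix: the one of order `r` multiplies the change of the covariance,
  -- also of order `r`; the crude one suffices for the exponentially small mixing error.
  have hN1 : ‖averageValue S P g r K - S.value (perturb r K M)‖ ≤ 10 * ψ * κ ^ 4 * r := by
    have e : averageValue S P g r K - S.value (perturb r K M)
        = (averageValue S P g r K - S.value K) - (S.value (perturb r K M) - S.value K) := by abel
    rw [e]
    refine (norm_sub_le _ _).trans ?_
    linarith [h.norm_averageValue_sub_le (P := P) hr hr' hK hg,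
      h.norm_value_perturb_sub_le hr hr' hK M]
  have hN2 : ‖averageValue S P g r K - S.value (perturb r K M)‖ ≤ 2 * (a * κ ^ 2) := by
    refine (norm_sub_le _ _).trans ?_
    linarith [h.norm_averageValue_le (P := P) (g := g) hr hr' hK, h.norm_value_le hf]
  generalize averageValue S P g r K - S.value (perturb r K M) = N at hN1 hN2 ⊢
  have h1 := (abs_le.mp (h.abs_expQuad_sub_le_norm hf N x s)).2
  have h2 := (abs_le.mp (h.abs_trace_statCov_sub_le (hK.mono (by linarith)) hf N)).2
  have hd := norm_smul_direction_le hr M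
  change (N * (S.statCov V (perturb r K M) - S.statCov V K)).trace ≤ _ at h2
  rw [Matrix.mul_sub, Matrix.trace_sub] at h2
  have h3 : 2 * ψ * κ ^ 3 * (ν / a) * ‖N‖ * ‖r • ((frob M)⁻¹ • M)‖
      ≤ 2 * ψ * κ ^ 3 * (ν / a) * (10 * ψ * κ ^ 4 * r) * r := by
    gcongr
  have h4 : ‖N‖ / a * ((1 - 1 / κ ^ 2) ^ s * (a * κ ^ 2 * (x ⬝ᵥ x) + ν))
      ≤ 2 * κ ^ 2 * ((1 - 1 / κ ^ 2) ^ s * (a * κ ^ 2 * (x ⬝ᵥ x) + ν)) := by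
    refine mul_le_mul_of_nonneg_right ?_ ?_
    · rw [div_le_iff₀ ha]; linarith
    · have := h.mixing_nonneg
      have := dot_self_nonneg x
      positivity
  have e : 2 * ψ * κ ^ 3 * (ν / a) * (10 * ψ * κ ^ 4 * r) * r
      = 20 * ψ ^ 2 * κ ^ 7 * (ν / a) * r ^ 2 := by ring
  linarith

end System.Bounds

end AverageValue

/-! ### The compensated excess cost of an epoch -/

section Excess

variable {dx du : ℕ} {S : System dx du} {a ψ ν σ κ W r : ℝ}
  {Ω : Type*} [mΩ : MeasurableSpace Ω] {P : Measure Ω} [IsProbabilityMeasure P]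
  {w : ℕ → Ω → Fin dx → ℝ} {G : ℕ → ℕ → Ω → Controller dx du}

/-- The excess cost of a sub-epoch, compensated by the change of the potential `xᵀ M x`. -/
def blockExcess (S : System dx du) (V : Matrix (Fin dx) (Fin dx) ℝ) (r : ℝ) (τ : ℕ)
    (M : Controller dx du → Matrix (Fin dx) (Fin dx) ℝ) (z : Controller dx du × (Fin dx → ℝ))
    (b : (ℕ → Fin dx → ℝ) × Controller dx du) : ℝ :=
  ∑ s ∈ Finset.range τ, (blockCost S r z b s - S.avgCost V (perturb r z.1 b.2))
    + blockState S r z b τ ⬝ᵥ M z.1 *ᵥ blockState S r z b τ - z.2 ⬝ᵥ M z.1 *ᵥ z.2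

lemma measurable_blockExcess (V : Matrix (Fin dx) (Fin dx) ℝ) (r : ℝ) (τ : ℕ)
    {M : Controller dx du → Matrix (Fin dx) (Fin dx) ℝ} (hM : Measurable M) : Measurable
    fun q : (Controller dx du × (Fin dx → ℝ)) × ((ℕ → Fin dx → ℝ) × Controller dx du) =>
      blockExcess S V r τ M q.1 q.2 := by
  have h1 : Measurable fun q : (Controller dx du × (Fin dx → ℝ)) ×
      ((ℕ → Fin dx → ℝ) × Controller dx du) => (q.1.1, q.2.2) :=
    (measurable_fst.comp measurable_fst).prodMk (measurable_snd.comp measurable_snd)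
  have h2 := (S.measurable_avgCost V).comp ((measurable_perturb r).comp h1)
  have h3 : Measurable fun q : (Controller dx du × (Fin dx → ℝ)) ×
      ((ℕ → Fin dx → ℝ) × Controller dx du) => M q.1.1 :=
    hM.comp (measurable_fst.comp measurable_fst)
  have h4 := measurable_blockState S r τ
  have h5 : Measurable fun q : (Controller dx du × (Fin dx → ℝ)) ×
      ((ℕ → Fin dx → ℝ) × Controller dx du) => q.1.2 := measurable_snd.comp measurable_fst
  unfold blockExcess
  refine Measurable.sub (Measurable.add (Finset.measurable_fun_sum _ fun s _ =>
    (measurable_blockCost S r s).sub h2) (h4.dot (h3.matrix_mulVec h4))) (h5.dot (h3.matrix_mulVec h5))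

lemma measurable_blockExcess_right (V : Matrix (Fin dx) (Fin dx) ℝ) (r : ℝ) (τ : ℕ)
    {M : Controller dx du → Matrix (Fin dx) (Fin dx) ℝ} (hM : Measurable M)
    (z : Controller dx du × (Fin dx → ℝ)) : Measurable fun b => blockExcess S V r τ M z b := by
  have h1 := measurable_blockExcess (S := S) V r τ hM
  have h2 : Measurable fun b : (ℕ → Fin dx → ℝ) × Controller dx du => (z, b) :=
    measurable_const.prodMk measurable_id
  have h3 := h1.comp h2
  exact h3

/-- In units of `a κ⁸ W²`, a round contributes at most `10` and the potential at most `8` at either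
end; `10 τ + 16 ≤ 26 τ` since `τ ≥ 1`. -/
lemma System.Bounds.abs_blockExcess_le {V : Matrix (Fin dx) (Fin dx) ℝ}
    (h : S.Bounds V a ψ ν σ κ) (hr : 0 ≤ r) (hr' : r ≤ √a / (16 * ψ * κ ^ 3)) (hσ : σ ≤ W)
    {z : Controller dx du × (Fin dx → ℝ)} (hz : z ∈ goodStart S V ν κ W)
    {b : (ℕ → Fin dx → ℝ) × Controller dx du} {τ : ℕ}
    (hb : ∀ k < τ, b.1 k ⬝ᵥ b.1 k ≤ W ^ 2) (hτ : 1 ≤ τ)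
    (hq : (1 - 1 / (2 * κ ^ 2)) ^ (τ - 1) ≤ 1 / (16 * κ ^ 2))
    {M : Controller dx du → Matrix (Fin dx) (Fin dx) ℝ} (hM : ‖M z.1‖ ≤ a * κ ^ 2) :
    |blockExcess S V r τ M z b| ≤ 26 * a * κ ^ 8 * W ^ 2 * τ := by
  have ha := h.a_pos
  have hk := h.kappa_ge
  have hf := h.fine_perturb hr hr' hz b.2
  have hpot : ∀ x : Fin dx → ℝ, x ⬝ᵥ x ≤ 8 * κ ^ 6 * W ^ 2 →
      |x ⬝ᵥ M z.1 *ᵥ x| ≤ 8 * a * κ ^ 8 * W ^ 2 := fun x hx => by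
    refine (abs_quad_le _ _).trans ((mul_le_mul hM hx (dot_self_nonneg x) (by positivity)).trans
      (le_of_eq (by ring)))
  have h1 := hpot _ hz.2
  have h2 := hpot _ (h.blockState_mem_goodStart hr hr' hz hb hq).2
  have hν : ν ≤ 10 * a * κ ^ 8 * W ^ 2 := by
    rw [← h.kappa_eq]
    have h3 : σ ^ 2 ≤ W ^ 2 := pow_le_pow_left₀ h.sigma_pos.le hσ 2
    have h4 : (1 : ℝ) ≤ κ ^ 6 := one_le_pow₀ (by linarith)
    calc a * κ ^ 2 * σ ^ 2 ≤ a * κ ^ 2 * W ^ 2 := by gcongr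
      _ ≤ a * κ ^ 2 * W ^ 2 * (10 * κ ^ 6) := le_mul_of_one_le_right (by positivity) (by linarith)
      _ = _ := by ring
  have h3 : |∑ s ∈ Finset.range τ, (blockCost S r z b s - S.avgCost V (perturb r z.1 b.2))|
      ≤ τ * (10 * a * κ ^ 8 * W ^ 2) := by
    refine (Finset.abs_sum_le_sum_abs _ _).trans ?_
    rw [show (τ : ℝ) * (10 * a * κ ^ 8 * W ^ 2)
      = ∑ s ∈ Finset.range τ, 10 * a * κ ^ 8 * W ^ 2 by simp]
    refine Finset.sum_le_sum fun s hs => ?_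
    have h5 := h.blockCost_nonneg (r := r) (z := z) (b := b) s
    have h6 := h.blockCost_le hr hr' hz hb (Finset.mem_range.mp hs).le
    have h7 := h.avgCost_nonneg hf.1
    have h8 := hf.2
    exact abs_le.mpr ⟨by linarith, by linarith⟩
  have hτ' : (1 : ℝ) ≤ τ := by exact_mod_cast hτ
  have hpos : 0 ≤ a * κ ^ 8 * W ^ 2 := by positivity
  rw [blockExcess]
  have e1 := abs_le.mp h1
  have e2 := abs_le.mp h2
  have e3 := abs_le.mp h3
  have e4 : 16 * (a * κ ^ 8 * W ^ 2) ≤ 16 * (a * κ ^ 8 * W ^ 2) * τ :=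
    le_mul_of_one_le_right (by positivity) hτ'
  exact abs_le.mpr ⟨by linarith, by linarith⟩

/-- The bound on the conditional mean of the compensated excess cost of a sub-epoch. -/
def excessMean (a ψ ν κ W r : ℝ) (τ : ℕ) : ℝ :=
  20 * ψ ^ 2 * κ ^ 7 * (ν / a) * r ^ 2
    + 2 * κ ^ 2 * ((1 - 1 / κ ^ 2) ^ τ * (8 * a * κ ^ 8 * W ^ 2 + ν))

lemma identDistrib_exploration (hG : IsGaussianExploration P G) (j i i' : ℕ) :
    IdentDistrib (G j i) (G j i') P P where
  aemeasurable_fst := (hG.measurable_matrix j i).aemeasurable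
  aemeasurable_snd := (hG.measurable_matrix j i').aemeasurable
  map_eq := by
    have h1 : ∀ i, P.map (G j i)
        = (stdGaussian (EuclideanSpace ℝ (Fin du × Fin dx))).map vec.symm := fun i => by
      rw [← map_vec_exploration hG j i]
      exact (Measure.map_map continuous_vec_symm.measurable
        (continuous_vec.measurable.comp (hG.measurable_matrix j i))).symm
    rw [h1, h1]

/-- All directions of an epoch have the same law, so a single potential serves all its sub-epochs
and can telescope. -/
lemma averageValue_exploration (hG : IsGaussianExploration P G) (j i i' : ℕ) :
    averageValue S P (G j i) r = averageValue S P (G j i') r := by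
  funext K
  have hm : Measurable fun g => S.value (perturb r K g) :=
    S.measurable_value.comp ((measurable_perturb r).comp (measurable_const.prodMk measurable_id))
  exact ((identDistrib_exploration hG j i i').comp hm).integral_eq

/-- The linear functional `N ↦ xᵀ N x - tr (N X)`. -/
def quadSubTrace (x : Fin dx → ℝ) (X : Matrix (Fin dx) (Fin dx) ℝ) :
    Matrix (Fin dx) (Fin dx) ℝ →ₗ[ℝ] ℝ where
  toFun N := x ⬝ᵥ N *ᵥ x - (N * X).trace
  map_add' N N' := by
    rw [Matrix.add_mulVec, dotProduct_add, Matrix.add_mul, Matrix.trace_add]; ring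
  map_smul' c N := by
    rw [Matrix.smul_mulVec, dotProduct_smul, Matrix.smul_mul, Matrix.trace_smul]
    simp only [smul_eq_mul, RingHom.id_apply]
    ring

omit [IsProbabilityMeasure P] in
-- If `f` is not integrable its integral is the default value zero, which `h0` covers.
lemma integral_le_of_le {f f' : Ω → ℝ} (hf' : Integrable f' P) (hle : ∀ ω, f ω ≤ f' ω)
    (h0 : 0 ≤ ∫ ω, f' ω ∂P) : ∫ ω, f ω ∂P ≤ ∫ ω, f' ω ∂P := by
  by_cases hf : Integrable f P
  · exact integral_mono hf hf' hle
  · rwa [integral_undef hf]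

/-- By `sum_expQuad_stageCost` the excess cost is itself a change of the potential `P_K`, so only
the difference of the two potentials remains at the two ends. -/
lemma IsNoise.integral_excess (hw : IsNoise P w σ W) (S : System dx du) {K : Controller dx du}
    (hK : StableMat (S.closedLoop K)) (x : Fin dx → ℝ) (t τ : ℕ)
    (M : Matrix (Fin dx) (Fin dx) ℝ) :
    ∫ ω, (∑ s ∈ Finset.range τ, (S.rollout K x (trunc τ fun s => w (t + s) ω) s ⬝ᵥ
          S.stageCost K *ᵥ S.rollout K x (trunc τ fun s => w (t + s) ω) s
            - S.avgCost (noiseCov P w) K)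
        + S.rollout K x (trunc τ fun s => w (t + s) ω) τ ⬝ᵥ
          M *ᵥ S.rollout K x (trunc τ fun s => w (t + s) ω) τ - x ⬝ᵥ M *ᵥ x) ∂P
      = x ⬝ᵥ S.value K *ᵥ x - x ⬝ᵥ M *ᵥ x
        + S.expQuad (noiseCov P w) K x τ (M - S.value K) := by
  have h1 : ∀ s ∈ Finset.range τ, Integrable (fun ω =>
      S.rollout K x (trunc τ fun s => w (t + s) ω) s ⬝ᵥ
          S.stageCost K *ᵥ S.rollout K x (trunc τ fun s => w (t + s) ω) s
            - S.avgCost (noiseCov P w) K) P := fun s hs =>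
    (hw.integrable_rollout_trunc S K x t (Finset.mem_range.mp hs).le _).sub (integrable_const _)
  have h2 := hw.integrable_rollout_trunc S K x t (le_refl τ) M
  rw [integral_sub ((integrable_finsetSum _ h1).fun_add h2) (integrable_const _),
    integral_add (integrable_finsetSum _ h1) h2, integral_finsetSum _ h1,
    hw.integral_rollout_trunc S K x t (le_refl τ)]
  have h3 : ∑ s ∈ Finset.range τ, ∫ ω, (S.rollout K x (trunc τ fun s => w (t + s) ω) s ⬝ᵥ
          S.stageCost K *ᵥ S.rollout K x (trunc τ fun s => w (t + s) ω) s
            - S.avgCost (noiseCov P w) K) ∂P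
      = ∑ s ∈ Finset.range τ, (S.expQuad (noiseCov P w) K x s (S.stageCost K)
        - S.avgCost (noiseCov P w) K) := Finset.sum_congr rfl fun s hs => by
    rw [integral_sub (hw.integrable_rollout_trunc S K x t (Finset.mem_range.mp hs).le _)
      (integrable_const _), hw.integral_rollout_trunc S K x t (Finset.mem_range.mp hs).le]
    simp
  have h4 := System.expQuad_add (S := S) (V := noiseCov P w) (K := K) x τ (M - S.value K)
    (S.value K)
  rw [sub_add_cancel] at h4
  rw [h3, System.sum_expQuad_stageCost hK, h4]
  simp only [integral_const, probReal_univ, one_smul]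
  ring

/-- The conditional mean of the compensated excess cost of a sub-epoch. -/
lemma integral_blockExcess_le (hw : IsNoise P w σ W)
    (hG : IsGaussianExploration P G)
    (hI : IndepFun (fun ω t => w t ω)
      (fun ω (q : ℕ × ℕ × Fin du × Fin dx) => G q.1 q.2.1 ω q.2.2.1 q.2.2.2) P)
    (h : S.Bounds (noiseCov P w) a ψ ν σ κ) (hr : 0 ≤ r) (hr' : r ≤ √a / (16 * ψ * κ ^ 3))
    (hσ : σ ≤ W)
    {z : Controller dx du × (Fin dx → ℝ)} (hz : z ∈ goodStart S (noiseCov P w) ν κ W) {τ : ℕ}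
    (hτ : 1 ≤ τ) (hq : (1 - 1 / (2 * κ ^ 2)) ^ (τ - 1) ≤ 1 / (16 * κ ^ 2)) (t j i : ℕ) :
    ∫ ω, blockExcess S (noiseCov P w) r τ (averageValue S P (G j i) r) z (block w G τ t j i ω) ∂P
      ≤ excessMean a ψ ν κ W r τ := by
  have ha := h.a_pos
  have hk := h.kappa_pos
  have hn := h.nu_pos
  have hp := h.psi_pos
  have hq0 := h.mixing_nonneg
  have hg := hG.measurable_matrix j i
  have hmeas : Measurable fun b => blockExcess S (noiseCov P w) r τ
      (averageValue S P (G j i) r) z b :=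
    measurable_blockExcess_right (noiseCov P w) r τ (measurable_averageValue hg) z
  have hint : Integrable (fun ω => blockExcess S (noiseCov P w) r τ (averageValue S P (G j i) r) z
      (block w G τ t j i ω)) P := by
    have h1 := hmeas.comp (measurable_block hw hG τ t j i)
    refine Integrable.of_bound h1.aestronglyMeasurable (26 * a * κ ^ 8 * W ^ 2 * τ) ?_
    filter_upwards [hw.block_dot_self_le (G := G) τ t j i] with ω hω
    exact h.abs_blockExcess_le hr hr' hσ hz hω hτ hq (h.norm_averageValue_le hr hr' hz.1)
  rw [integral_block hw hG hI τ t j i (f := fun b => blockExcess S (noiseCov P w) r τ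
    (averageValue S P (G j i) r) z b) hmeas.stronglyMeasurable hint]
  generalize hM : averageValue S P (G j i) r z.1 = M
  have hinner : ∀ ω, ∫ ω', blockExcess S (noiseCov P w) r τ (averageValue S P (G j i) r) z
        (trunc τ fun s => w (t + s) ω', G j i ω) ∂P
      = z.2 ⬝ᵥ S.value (perturb r z.1 (G j i ω)) *ᵥ z.2 - z.2 ⬝ᵥ M *ᵥ z.2
        + S.expQuad (noiseCov P w) (perturb r z.1 (G j i ω)) z.2 τ
          (M - S.value (perturb r z.1 (G j i ω))) := fun ω => by
    have hf := h.fine_perturb hr hr' hz (G j i ω)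
    simp only [blockExcess, blockCost, blockState, hM]
    exact hw.integral_excess S hf.1 z.2 t τ M
  simp only [hinner]
  -- The upper bound depends affinely on the value matrix of the perturbed controller; its two
  -- `quadSubTrace` terms cancel in the mean because `M` is the mean of these matrices.
  have hB : ∀ ω, z.2 ⬝ᵥ S.value (perturb r z.1 (G j i ω)) *ᵥ z.2 - z.2 ⬝ᵥ M *ᵥ z.2
        + S.expQuad (noiseCov P w) (perturb r z.1 (G j i ω)) z.2 τ
          (M - S.value (perturb r z.1 (G j i ω)))
      ≤ quadSubTrace z.2 (S.statCov (noiseCov P w) z.1) (S.value (perturb r z.1 (G j i ω)))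
        - quadSubTrace z.2 (S.statCov (noiseCov P w) z.1) M + excessMean a ψ ν κ W r τ := fun ω => by
    have h1 := h.expQuad_averageValue_sub_le (P := P) hr hr' hz.1 hg z.2 τ (G j i ω)
    rw [hM, Matrix.sub_mul, Matrix.trace_sub] at h1
    have h2 : 2 * κ ^ 2 * ((1 - 1 / κ ^ 2) ^ τ * (a * κ ^ 2 * (z.2 ⬝ᵥ z.2) + ν))
        ≤ 2 * κ ^ 2 * ((1 - 1 / κ ^ 2) ^ τ * (8 * a * κ ^ 8 * W ^ 2 + ν)) := by
      have h3 := mul_le_mul_of_nonneg_left hz.2 (show 0 ≤ a * κ ^ 2 by positivity)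
      refine mul_le_mul_of_nonneg_left (mul_le_mul_of_nonneg_left ?_ (pow_nonneg hq0 _))
        (by positivity)
      linarith
    simp only [quadSubTrace, LinearMap.coe_mk, AddHom.coe_mk, excessMean]
    linarith
  obtain ⟨hi, he⟩ := h.integral_linear_value (P := P) hr hr' hz.1 hg
    (quadSubTrace z.2 (S.statCov (noiseCov P w) z.1))
  rw [hM] at he
  have h0 : 0 ≤ excessMean a ψ ν κ W r τ := by
    rw [excessMean]; positivity
  have hs : Integrable (fun ω => quadSubTrace z.2 (S.statCov (noiseCov P w) z.1)
      (S.value (perturb r z.1 (G j i ω))) - quadSubTrace z.2 (S.statCov (noiseCov P w) z.1) M) P :=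
    hi.sub (integrable_const _)
  have hi' := hs.fun_add (integrable_const (excessMean a ψ ν κ W r τ))
  have he' : ∫ ω, (quadSubTrace z.2 (S.statCov (noiseCov P w) z.1) (S.value (perturb r z.1 (G j i ω)))
        - quadSubTrace z.2 (S.statCov (noiseCov P w) z.1) M + excessMean a ψ ν κ W r τ) ∂P
      = excessMean a ψ ν κ W r τ := by
    rw [integral_add hs (integrable_const _),
      integral_sub hi (integrable_const _), he]
    simp
  exact (integral_le_of_le hi' hB (h0.trans he'.ge)).trans he'.le

/-- The event that the compensated excess cost of epoch `j` is large. -/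
def badExcess (S : System dx du) (p : AlgParams) (K₀ : Controller dx du) (P : Measure Ω)
    (w : ℕ → Ω → Fin dx → ℝ) (G : ℕ → ℕ → Ω → Controller dx du) (a ψ ν κ W L : ℝ) (j : ℕ) : Set Ω :=
  {ω | (∀ i < p.m j, runState S p K₀ w G j i ω ∈ goodStart S (noiseCov P w) ν κ W) ∧
    p.m j * excessMean a ψ ν κ W (p.r j) p.τ + 26 * a * κ ^ 8 * W ^ 2 * p.τ * √(2 * p.m j * L)
      ≤ ∑ i ∈ Finset.range (p.m j), blockExcess S (noiseCov P w) (p.r j) p.τ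
        (averageValue S P (G j 0) (p.r j)) (runState S p K₀ w G j i ω) (runBlock p w G j i ω)}

lemma measure_badExcess_le {p : AlgParams} {K₀ : Controller dx du} {L ρ : ℝ} (hw : IsNoise P w σ W)
    (hG : IsGaussianExploration P G)
    (hI : IndepFun (fun ω t => w t ω)
      (fun ω (q : ℕ × ℕ × Fin du × Fin dx) => G q.1 q.2.1 ω q.2.2.1 q.2.2.2) P)
    (h : S.Bounds (noiseCov P w) a ψ ν σ κ) {j : ℕ} (ht : Tuned dx du p a ψ ν κ W L ρ j)
    (hσ : σ ≤ W) (hτ : 1 ≤ p.τ) :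
    P (badExcess S p K₀ P w G a ψ ν κ W L j) ≤ ENNReal.ofReal (Real.exp (-L)) := by
  have ha := h.a_pos
  have hk := h.kappa_pos
  have hW := ht.W_pos
  have hn := h.nu_pos
  have hq0 := h.mixing_nonneg
  have hτ' : (0 : ℝ) < p.τ := by exact_mod_cast hτ
  have hr := (ht.r_pos j).le
  have hD : Measurable (Function.uncurry
      (blockExcess S (noiseCov P w) (p.r j) p.τ (averageValue S P (G j 0) (p.r j)))) :=
    measurable_blockExcess (S := S) (noiseCov P w) (p.r j) p.τ
      (measurable_averageValue (hG.measurable_matrix j 0))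
  refine (isChain_run S p K₀ hw hG hI j).azuma_on
    (D := fun _ => blockExcess S (noiseCov P w) (p.r j) p.τ (averageValue S P (G j 0) (p.r j)))
    measurableSet_goodStart (fun _ => hD) (by positivity) ht.L_nonneg
    (by rw [excessMean]; have := h.psi_pos; positivity) (fun i z hz => ?_) (fun i z hz => ?_)
    (ht.m_pos j)
  · filter_upwards [hw.block_dot_self_le (G := G) p.τ (epochTime p j + i * p.τ) j i] with ω hω
    exact h.abs_blockExcess_le hr (ht.r_le j) hσ hz hω hτ ht.rate
      (h.norm_averageValue_le hr (ht.r_le j) hz.1)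
  · rw [averageValue_exploration hG j 0 i]
    exact integral_blockExcess_le hw hG hI h hr (ht.r_le j) hσ hz hτ ht.rate _ j i

/-- Outside of the bad event, the excess cost of an epoch is small. -/
lemma sum_excess_le {p : AlgParams} {K₀ : Controller dx du} {L ρ : ℝ}
    (h : S.Bounds (noiseCov P w) a ψ ν σ κ) {j : ℕ} (ht : Tuned dx du p a ψ ν κ W L ρ j)
    {ω : Ω} (hz : ∀ i, runState S p K₀ w G j i ω ∈ goodStart S (noiseCov P w) ν κ W)
    (hb : ω ∉ badExcess S p K₀ P w G a ψ ν κ W L j) :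
    ∑ i ∈ Finset.range (p.m j), ∑ s ∈ Finset.range p.τ,
        (blockCost S (p.r j) (runState S p K₀ w G j i ω) (runBlock p w G j i ω) s
          - S.avgCost (noiseCov P w)
            (perturb (p.r j) (runState S p K₀ w G j i ω).1 (runBlock p w G j i ω).2))
      ≤ p.m j * excessMean a ψ ν κ W (p.r j) p.τ
        + 26 * a * κ ^ 8 * W ^ 2 * p.τ * √(2 * p.m j * L) + 16 * a * κ ^ 8 * W ^ 2 := by
  have ha := h.a_pos
  have hk := h.kappa_pos
  have hdev := (not_le.mp fun hc => hb ⟨fun i _ => hz i, hc⟩).le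
  set M := averageValue S P (G j 0) (p.r j) (runState S p K₀ w G j 0 ω).1 with hM
  have hMn : ‖M‖ ≤ a * κ ^ 2 := h.norm_averageValue_le (ht.r_pos j).le (ht.r_le j) (hz 0).1
  have hpot : ∀ i, |(runState S p K₀ w G j i ω).2 ⬝ᵥ M *ᵥ (runState S p K₀ w G j i ω).2|
      ≤ 8 * a * κ ^ 8 * W ^ 2 := fun i =>
    (abs_quad_le _ _).trans ((mul_le_mul hMn (hz i).2 (dot_self_nonneg _) (by positivity)).trans
      (le_of_eq (by ring)))
  have e : ∀ i, blockExcess S (noiseCov P w) (p.r j) p.τ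
        (averageValue S P (G j 0) (p.r j)) (runState S p K₀ w G j i ω) (runBlock p w G j i ω)
      = ∑ s ∈ Finset.range p.τ,
        (blockCost S (p.r j) (runState S p K₀ w G j i ω) (runBlock p w G j i ω) s
          - S.avgCost (noiseCov P w)
            (perturb (p.r j) (runState S p K₀ w G j i ω).1 (runBlock p w G j i ω).2))
        + ((runState S p K₀ w G j (i + 1) ω).2 ⬝ᵥ M *ᵥ (runState S p K₀ w G j (i + 1) ω).2
          - (runState S p K₀ w G j i ω).2 ⬝ᵥ M *ᵥ (runState S p K₀ w G j i ω).2) := fun i => by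
    rw [blockExcess, ← runState_succ_snd, runState_fst S p K₀ w G j i ω, ← hM]
    ring
  simp only [e] at hdev
  -- The potential telescopes over the whole epoch, leaving two boundary terms of at most `8 a κ⁸
  -- W²` each, whatever the number of sub-epochs.
  rw [Finset.sum_add_distrib, Finset.sum_range_sub fun i =>
    (runState S p K₀ w G j i ω).2 ⬝ᵥ M *ᵥ (runState S p K₀ w G j i ω).2] at hdev
  have h1 := abs_le.mp (hpot (p.m j))
  have h2 := abs_le.mp (hpot 0)
  linarith

end Excess

/-! ### The choice of parameters -/

section Tuning

/-- The equations which define the tuning, with the real powers evaluated. -/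
structure IsTuning (dx du : ℕ) (p : AlgParams) (a ψ ν σ κ W L ρ r₀ X : ℝ) (T : ℕ) : Prop where
  eta_eq : p.η = a / (128 * ν * ψ ^ 2 * κ ^ 10)
  rho_eq : ρ = 1 - 4 * ν / κ ^ 4 * p.η / 3
  r_zero_eq : r₀ = a / (448 * √dx * ψ ^ 2 * κ ^ 10)
  r_rpow : ∀ k : ℕ, p.r k = r₀ * ρ ^ ((k : ℝ) / 2)
  root_eq : X = 2 ^ 17 * du * (dx * √dx) * ψ ^ 2 * κ ^ 20 * W ^ 2 / (a * σ ^ 2) * √L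
  m_eq : ∀ k, p.m k = ⌈X ^ 2 * (ρ ^ (2 * k))⁻¹⌉₊
  tau_eq : p.τ = ⌈2 * κ ^ 2 * Real.log (7 * κ * T)⌉₊
  L_ge : 1 ≤ L
  W_ge : σ ≤ W
  dx_pos : 0 < dx
  du_pos : 0 < du

variable {dx du : ℕ} {S : System dx du} {V : Matrix (Fin dx) (Fin dx) ℝ} {p : AlgParams}
  {a ψ ν σ κ W L ρ r₀ X : ℝ} {T j : ℕ}

namespace IsTuning

variable (t : IsTuning dx du p a ψ ν σ κ W L ρ r₀ X T) (h : S.Bounds V a ψ ν σ κ)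
include t h

lemma W_pos : 0 < W := h.sigma_pos.trans_le t.W_ge

omit h in
lemma one_le_dx : (1 : ℝ) ≤ dx := by exact_mod_cast t.dx_pos

omit h in
lemma one_le_du : (1 : ℝ) ≤ du := by exact_mod_cast t.du_pos

omit h in
lemma one_le_sqrt_dx : 1 ≤ √(dx : ℝ) := Real.one_le_sqrt.mpr t.one_le_dx

omit h in
lemma one_le_sqrt_L : 1 ≤ √L := Real.one_le_sqrt.mpr t.L_ge

lemma one_sub_rho : 1 - ρ = a / (96 * ψ ^ 2 * κ ^ 14) := by
  have := h.nu_pos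
  have := h.psi_pos
  have := h.kappa_pos
  rw [t.rho_eq, t.eta_eq]
  field_simp
  ring

lemma rho_lt_one : ρ < 1 := by
  have h1 := t.one_sub_rho h
  have := h.a_pos
  have := h.psi_pos
  have := h.kappa_pos
  have : 0 < a / (96 * ψ ^ 2 * κ ^ 14) := by positivity
  linarith

lemma rho_pos : 0 < ρ := by
  have h1 := t.one_sub_rho h
  have ha := h.a_le
  have hp := h.psi_ge
  have hk := h.kappa_ge
  have : a / (96 * ψ ^ 2 * κ ^ 14) < 1 := by
    rw [div_lt_one (by positivity)]
    have : 1 ≤ ψ ^ 2 * κ ^ 14 :=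
      one_le_mul_of_one_le_of_one_le (one_le_pow₀ hp) (one_le_pow₀ (by linarith))
    linarith
  linarith

lemma r_eq (k : ℕ) : p.r k = r₀ * √(ρ ^ k) := by
  have hρ := t.rho_pos h
  rw [t.r_rpow, Real.sqrt_eq_rpow, ← Real.rpow_natCast, ← Real.rpow_mul hρ.le]
  congr 2
  ring

lemma r_zero_pos : 0 < r₀ := by
  have := h.a_pos
  have := h.psi_pos
  have := h.kappa_pos
  have := t.one_le_sqrt_dx
  rw [t.r_zero_eq]
  positivity

lemma r_zero_le : r₀ ≤ a / (448 * ψ ^ 2 * κ ^ 10) := by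
  have ha := h.a_pos
  have := h.psi_pos
  have := h.kappa_pos
  rw [t.r_zero_eq]
  refine div_le_div_of_nonneg_left ha.le (by positivity) ?_
  have e : 448 * √(dx : ℝ) * ψ ^ 2 * κ ^ 10 = 448 * ψ ^ 2 * κ ^ 10 * √(dx : ℝ) := by ring
  rw [e]
  exact le_mul_of_one_le_right (by positivity) t.one_le_sqrt_dx

lemma sqrt_pow_le_one (k : ℕ) : √(ρ ^ k) ≤ 1 :=
  Real.sqrt_le_one.mpr (pow_le_one₀ (t.rho_pos h).le (t.rho_lt_one h).le)

lemma root_ge : 2 ^ 17 * ψ ^ 2 * κ ^ 20 / a ≤ X := by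
  have ha := h.a_pos
  have hp := h.psi_pos
  have hk := h.kappa_pos
  have hs := h.sigma_pos
  have hW := t.W_pos h
  have h1 : 1 ≤ du * (dx * √(dx : ℝ)) * √L * (W ^ 2 / σ ^ 2) := by
    refine one_le_mul_of_one_le_of_one_le (one_le_mul_of_one_le_of_one_le
      (one_le_mul_of_one_le_of_one_le t.one_le_du
        (one_le_mul_of_one_le_of_one_le t.one_le_dx t.one_le_sqrt_dx)) t.one_le_sqrt_L) ?_
    rw [one_le_div (by positivity)]
    exact pow_le_pow_left₀ hs.le t.W_ge 2
  have e : X = 2 ^ 17 * ψ ^ 2 * κ ^ 20 / a * (du * (dx * √(dx : ℝ)) * √L * (W ^ 2 / σ ^ 2)) := by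
    rw [t.root_eq]
    field_simp
  rw [e]
  exact le_mul_of_one_le_right (by positivity) h1

lemma root_ge_kappa : 2 ^ 17 * κ ^ 20 ≤ X := by
  have ha := h.a_pos
  have hp := h.psi_ge
  have hk := h.kappa_pos
  refine le_trans ?_ (t.root_ge h)
  rw [le_div_iff₀ ha]
  have h1 : 2 ^ 17 * κ ^ 20 * a ≤ 2 ^ 17 * κ ^ 20 * 1 :=
    mul_le_mul_of_nonneg_left h.a_le (by positivity)
  have h2 : 2 ^ 17 * κ ^ 20 * 1 ≤ 2 ^ 17 * κ ^ 20 * ψ ^ 2 :=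
    mul_le_mul_of_nonneg_left (one_le_pow₀ hp) (by positivity)
  linarith

lemma root_pos : 0 < X := by
  have hk := h.kappa_pos
  exact lt_of_lt_of_le (by positivity) (t.root_ge_kappa h)

lemma one_le_root : 1 ≤ X := by
  have hk := h.kappa_ge
  have := t.root_ge_kappa h
  have : (1 : ℝ) ≤ κ ^ 20 := one_le_pow₀ (by linarith)
  linarith

omit h in
lemma le_m (k : ℕ) : X ^ 2 * (ρ ^ (2 * k))⁻¹ ≤ p.m k := by
  rw [t.m_eq]; exact Nat.le_ceil _

lemma sq_root_le_m (k : ℕ) : X ^ 2 ≤ p.m k := by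
  refine le_trans ?_ (t.le_m k)
  refine le_mul_of_one_le_right (by positivity) ?_
  have hρ := t.rho_pos h
  exact one_le_inv_iff₀.mpr ⟨by positivity, pow_le_one₀ hρ.le (t.rho_lt_one h).le⟩

lemma m_pos (k : ℕ) : 0 < p.m k := by
  have h1 := t.sq_root_le_m h k
  have h2 : 0 < X ^ 2 := by have := t.root_pos h; positivity
  exact_mod_cast h2.trans_le h1

lemma m_mono {k : ℕ} (hk : k ≤ j) : p.m k ≤ p.m j := by
  have hρ := t.rho_pos h
  rw [t.m_eq, t.m_eq]
  refine Nat.ceil_mono (mul_le_mul_of_nonneg_left ?_ (by positivity))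
  exact inv_anti₀ (by positivity)
    (pow_le_pow_of_le_one hρ.le (t.rho_lt_one h).le (by omega))

variable (hj : p.m j ≤ T)
include hj

/-- The hypothesis `p.m j ≤ T` makes `T` large compared with `κ` and with universal constants, since
already the lengths of the first epochs are. -/
lemma sq_root_le_T : X ^ 2 ≤ T := (t.sq_root_le_m h j).trans (by exact_mod_cast hj)

lemma T_ge : 2 ^ 17 * κ ^ 20 ≤ T := by
  refine (t.root_ge_kappa h).trans (le_trans ?_ (t.sq_root_le_T h hj))
  have := t.one_le_root h
  nlinarith

lemma T_ge' : 2 ^ 17 * κ ≤ T := by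
  refine le_trans ?_ (t.T_ge h hj)
  have hk := h.kappa_ge
  have : κ ≤ κ ^ 20 := le_self_pow₀ (by linarith) (by norm_num)
  linarith

/-- By Bernoulli's inequality `ρ^(-2j) ≥ 1 + 2 j (1 - ρ)`, and the initial length is so large that
`X² (1 - ρ) ≥ 1`. Hence `m_j ≤ T` bounds the number of epochs in the union bound. -/
lemma epoch_le_T : (j : ℝ) ≤ T := by
  have ha := h.a_pos
  have hp := h.psi_ge
  have hk := h.kappa_ge
  have hρ := t.rho_pos h
  have hX1 := t.one_le_root h
  have h1 : 1 + (2 * j : ℕ) * (1 - ρ) ≤ (ρ ^ (2 * j))⁻¹ := by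
    rw [← inv_pow]
    have h2 : 1 + (1 - ρ) ≤ ρ⁻¹ := by
      rw [← one_div, le_div_iff₀ hρ]
      nlinarith [sq_nonneg (1 - ρ)]
    refine le_trans ?_ (pow_le_pow_left₀ (by linarith [t.rho_lt_one h]) h2 _)
    exact one_add_mul_le_pow (by linarith [t.rho_lt_one h]) _
  have h2 : X ^ 2 * (1 + (2 * j : ℕ) * (1 - ρ)) ≤ T :=
    (mul_le_mul_of_nonneg_left h1 (sq_nonneg X)).trans ((t.le_m j).trans (by exact_mod_cast hj))
  have h3 : 1 ≤ X ^ 2 * (1 - ρ) := by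
    rw [t.one_sub_rho h]
    have h4 := t.root_ge h
    have h5 : X ≤ X ^ 2 := by nlinarith
    have h6 : 2 ^ 17 * ψ ^ 2 * κ ^ 20 / a * (a / (96 * ψ ^ 2 * κ ^ 14))
        ≤ X ^ 2 * (a / (96 * ψ ^ 2 * κ ^ 14)) :=
      mul_le_mul_of_nonneg_right (h4.trans h5) (by positivity)
    have e : 2 ^ 17 * ψ ^ 2 * κ ^ 20 / a * (a / (96 * ψ ^ 2 * κ ^ 14)) = 2 ^ 17 / 96 * κ ^ 6 := by
      field_simp
    have h7 : (1 : ℝ) ≤ κ ^ 6 := one_le_pow₀ (by linarith)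
    linarith
  push_cast at h2
  have h4 : (j : ℝ) * 1 ≤ j * (X ^ 2 * (1 - ρ)) := mul_le_mul_of_nonneg_left h3 (Nat.cast_nonneg j)
  nlinarith [sq_nonneg X, Nat.cast_nonneg (α := ℝ) j]

lemma log_pos : 1 ≤ Real.log (7 * κ * T) := by
  have hk := h.kappa_ge
  have hT := t.T_ge' h hj
  rw [Real.le_log_iff_exp_le (by nlinarith)]
  have := Real.exp_one_lt_d9
  nlinarith

lemma tau_pos : 1 ≤ p.τ := by
  have hk := h.kappa_ge
  have := t.log_pos h hj
  rw [t.tau_eq]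
  exact Nat.one_le_ceil_iff.mpr (by positivity)

lemma rate_le : (1 - 1 / (2 * κ ^ 2)) ^ (p.τ - 1) ≤ 1 / (6 * κ * T) := by
  have hk := h.kappa_ge
  have hT := t.T_ge' h hj
  have hT0 : (0 : ℝ) < T := by nlinarith
  have hq := h.rate_nonneg
  have hg : 1 / (2 * κ ^ 2) ≤ 1 / 8 := by
    rw [div_le_div_iff₀ (by positivity) (by norm_num)]; nlinarith
  have h1 : (1 - 1 / (2 * κ ^ 2)) ^ p.τ ≤ 1 / (7 * κ * T) := by
    have h2 : 1 - 1 / (2 * κ ^ 2) ≤ Real.exp (-(1 / (2 * κ ^ 2))) := Real.one_sub_le_exp_neg _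
    refine (pow_le_pow_left₀ hq h2 _).trans ?_
    rw [← Real.exp_nat_mul, one_div (7 * κ * T), ← Real.exp_log (show 0 < 7 * κ * T by positivity),
      ← Real.exp_neg, Real.exp_le_exp]
    have h3 : 2 * κ ^ 2 * Real.log (7 * κ * T) ≤ p.τ := by rw [t.tau_eq]; exact Nat.le_ceil _
    have h4 : Real.log (7 * κ * T) ≤ p.τ * (1 / (2 * κ ^ 2)) := by
      rw [mul_one_div, le_div_iff₀ (by positivity)]
      linarith
    linarith
  -- Only `τ - 1` rounds precede the last cost. The missing round costs a factor of at most `8 / 7`,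
  -- absorbed by weakening `7` to `6`.
  have h2 : (1 - 1 / (2 * κ ^ 2)) ^ p.τ
      = (1 - 1 / (2 * κ ^ 2)) ^ (p.τ - 1) * (1 - 1 / (2 * κ ^ 2)) := by
    rw [← pow_succ, Nat.sub_add_cancel (t.tau_pos h hj)]
  have h3 : (1 - 1 / (2 * κ ^ 2)) ^ (p.τ - 1) * (7 / 8) ≤ 1 / (7 * κ * T) := by
    refine le_trans ?_ (h2 ▸ h1)
    exact mul_le_mul_of_nonneg_left (by linarith) (pow_nonneg hq _)
  have h4 : 1 / (7 * κ * T) = 7 / 8 * (8 / 49 * (1 / (κ * T))) := by field_simp; norm_num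
  have h5 : 1 / (6 * κ * T) = 1 / 6 * (1 / (κ * T)) := by field_simp
  have h6 : 0 < 1 / (κ * T) := by positivity
  rw [h5]
  linarith

/-- Expectations contract at the square of the pathwise rate, since `1 - 1/κ² ≤ (1 - 1/(2κ²))²`;
this yields the power `T⁻²`. -/
lemma mixing_le {s : ℕ} (hs : p.τ - 1 ≤ s) : (1 - 1 / κ ^ 2) ^ s ≤ 1 / (36 * κ ^ 2 * T ^ 2) := by
  have hk := h.kappa_ge
  have h1 : 1 - 1 / κ ^ 2 ≤ (1 - 1 / (2 * κ ^ 2)) ^ 2 := by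
    have e : 1 / κ ^ 2 = 2 * (1 / (2 * κ ^ 2)) := by field_simp
    rw [e]
    nlinarith [sq_nonneg (1 / (2 * κ ^ 2))]
  have h0 := h.mixing_nonneg
  have h2 : 1 - 1 / κ ^ 2 ≤ 1 := by
    have : 0 ≤ 1 / κ ^ 2 := by positivity
    linarith
  calc (1 - 1 / κ ^ 2) ^ s ≤ (1 - 1 / κ ^ 2) ^ (p.τ - 1) := pow_le_pow_of_le_one h0 h2 hs
    _ ≤ ((1 - 1 / (2 * κ ^ 2)) ^ 2) ^ (p.τ - 1) := pow_le_pow_left₀ h0 h1 _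
    _ = ((1 - 1 / (2 * κ ^ 2)) ^ (p.τ - 1)) ^ 2 := by rw [← pow_mul, ← pow_mul, mul_comm (p.τ - 1)]
    _ ≤ (1 / (6 * κ * T)) ^ 2 := pow_le_pow_left₀ (pow_nonneg h.rate_nonneg _) (t.rate_le h hj) 2
    _ = _ := by rw [div_pow, mul_pow, mul_pow]; norm_num

omit hj in
lemma nu_le : ν ≤ a * κ ^ 8 * W ^ 2 := by
  have hk := h.kappa_ge
  have ha := h.a_pos
  have hs := h.sigma_pos
  rw [← h.kappa_eq]
  have h3 : σ ^ 2 ≤ W ^ 2 := pow_le_pow_left₀ hs.le t.W_ge 2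
  have h4 : (1 : ℝ) ≤ κ ^ 6 := one_le_pow₀ (by linarith)
  calc a * κ ^ 2 * σ ^ 2 ≤ a * κ ^ 2 * W ^ 2 := by gcongr
    _ ≤ a * κ ^ 2 * W ^ 2 * κ ^ 6 := le_mul_of_one_le_right (by positivity) h4
    _ = _ := by ring

lemma mixing_mul_le {s : ℕ} (hs : p.τ - 1 ≤ s) :
    (1 - 1 / κ ^ 2) ^ s * (8 * a * κ ^ 8 * W ^ 2 + ν) ≤ a * κ ^ 6 * W ^ 2 / (4 * T ^ 2) := by
  have hk := h.kappa_ge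
  have ha := h.a_pos
  have hT := t.T_ge' h hj
  have hT0 : (0 : ℝ) < T := by nlinarith
  have h1 := t.nu_le h
  have h2 : 8 * a * κ ^ 8 * W ^ 2 + ν ≤ 9 * (a * κ ^ 8 * W ^ 2) := by linarith
  refine (mul_le_mul (t.mixing_le h hj hs) h2 ?_ (by positivity)).trans (le_of_eq ?_)
  · have := h.nu_pos
    positivity
  · field_simp
    ring

omit hj in
-- The factor `dx * du` left here cancels the prefactor of the gradient estimate in the noise and
-- mixing errors; `ψ` drops out.
lemma r_zero_mul_root : r₀ * X = 2 ^ 17 / 448 * (dx * du) * κ ^ 10 * W ^ 2 * √L / σ ^ 2 := by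
  have ha := h.a_pos
  have hp := h.psi_pos
  have hk := h.kappa_pos
  have hs := h.sigma_pos
  have := t.one_le_sqrt_dx
  rw [t.r_zero_eq, t.root_eq]
  field_simp

omit hj in
lemma inv_sq_le_m (k : ℕ) : (X / √(ρ ^ k) ^ 2) ^ 2 ≤ p.m k := by
  have hρ := t.rho_pos h
  refine le_trans (le_of_eq ?_) (t.le_m k)
  rw [Real.sq_sqrt (by positivity), div_pow, ← pow_mul, mul_comm k 2, div_eq_mul_inv]

omit hj in
-- With `s = √(ρ^k)`, the radius is `r₀ s` and `√m_k` is at least `X / s²`, so the error, of order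
-- `1 / (r_k √m_k)`, is proportional to `s`.
lemma noiseError_le (k : ℕ) :
    (dx : ℝ) * du / (p.m k * p.r k) *
      (2 * (5 * a * κ ^ 6 * W ^ 2) * √(p.m k) * (3 / 2)
        + 2 * (5 * a * κ ^ 6 * W ^ 2) * √(2 * p.m k * L)) ≤ 1 / 4 * (ν / κ ^ 2) * √(ρ ^ k) := by
  have ha := h.a_pos
  have hk := h.kappa_ge
  have hW := t.W_pos h
  have hs := h.sigma_pos
  have hρ := t.rho_pos h
  have hX := t.root_pos h
  have hr₀ := t.r_zero_pos h
  have hdx : (0 : ℝ) < dx := by linarith [t.one_le_dx]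
  have hdu : (0 : ℝ) < du := by linarith [t.one_le_du]
  have hm : (0 : ℝ) < p.m k := by exact_mod_cast t.m_pos h k
  have hL := t.one_le_sqrt_L
  rw [t.r_eq h]
  have hs0 : 0 < √(ρ ^ k) := Real.sqrt_pos.mpr (by positivity)
  have hmr : X / √(ρ ^ k) ^ 2 ≤ √(p.m k) := Real.le_sqrt_of_sq_le (t.inv_sq_le_m h k)
  have hmm : √(p.m k : ℝ) * √(p.m k) = p.m k := Real.mul_self_sqrt hm.le
  have hsm : 0 < √(p.m k : ℝ) := Real.sqrt_pos.mpr hm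
  have h1 : √(2 * p.m k * L) ≤ 3 / 2 * (√(p.m k) * √L) := by
    rw [mul_assoc, Real.sqrt_mul (by norm_num), Real.sqrt_mul hm.le]
    refine mul_le_mul_of_nonneg_right ?_ (by positivity)
    rw [Real.sqrt_le_left (by norm_num)]
    norm_num
  generalize hs' : √(ρ ^ k) = s at *
  generalize hn' : √(p.m k : ℝ) = n at *
  have h2 : 2 * (5 * a * κ ^ 6 * W ^ 2) * n * (3 / 2) + 2 * (5 * a * κ ^ 6 * W ^ 2) * √(2 * p.m k * L)
      ≤ 30 * a * κ ^ 6 * W ^ 2 * n * √L := by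
    have h3 : 0 < a * κ ^ 6 * W ^ 2 := by positivity
    have h4 := mul_le_mul_of_nonneg_left h1 h3.le
    have h5 := mul_le_mul_of_nonneg_left hL (show 0 ≤ a * κ ^ 6 * W ^ 2 * n by positivity)
    nlinarith
  refine (mul_le_mul_of_nonneg_left h2 (by positivity)).trans ?_
  have e1 : (dx : ℝ) * du / (p.m k * (r₀ * s)) * (30 * a * κ ^ 6 * W ^ 2 * n * √L)
      = dx * du * (30 * a * κ ^ 6 * W ^ 2 * √L) / (r₀ * s * n) := by
    rw [← hmm]
    field_simp
  have h6 : r₀ * X / s ≤ r₀ * s * n := by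
    have := mul_le_mul_of_nonneg_left hmr (show 0 ≤ r₀ * s by positivity)
    refine le_trans (le_of_eq ?_) this
    field_simp
  rw [e1]
  refine (div_le_div_of_nonneg_left (by positivity) (by positivity) h6).trans ?_
  rw [t.r_zero_mul_root h, ← h.kappa_eq]
  have e2 : dx * du * (30 * a * κ ^ 6 * W ^ 2 * √L)
      / (2 ^ 17 / 448 * (dx * du) * κ ^ 10 * W ^ 2 * √L / σ ^ 2 / s)
      = 30 * 448 / 2 ^ 17 * (a * σ ^ 2 / κ ^ 4) * s := by
    field_simp
  rw [e2]
  refine mul_le_mul_of_nonneg_right ?_ hs0.le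
  have e3 : a * κ ^ 2 * σ ^ 2 / κ ^ 2 = a * σ ^ 2 / κ ^ 4 * κ ^ 4 := by field_simp
  rw [e3]
  have h7 : (1 : ℝ) ≤ κ ^ 4 := one_le_pow₀ (by linarith)
  have h8 : a * σ ^ 2 / κ ^ 4 * 1 ≤ a * σ ^ 2 / κ ^ 4 * κ ^ 4 :=
    mul_le_mul_of_nonneg_left h7 (by positivity)
  have h9 : 0 < a * σ ^ 2 / κ ^ 4 := by positivity
  linarith

omit hj in
lemma biasError_le (k : ℕ) :
    25 * ψ ^ 2 * κ ^ 5 * (ν / a) * p.r k ≤ 1 / 4 * (ν / κ ^ 2) * √(ρ ^ k) := by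
  have ha := h.a_pos
  have hk := h.kappa_ge
  have hp := h.psi_pos
  have hn := h.nu_pos
  rw [t.r_eq h, ← mul_assoc]
  refine mul_le_mul_of_nonneg_right ?_ (Real.sqrt_nonneg _)
  refine (mul_le_mul_of_nonneg_left (t.r_zero_le h) (by positivity)).trans ?_
  have e : 25 * ψ ^ 2 * κ ^ 5 * (ν / a) * (a / (448 * ψ ^ 2 * κ ^ 10))
      = 25 / 448 * (ν / κ ^ 5) := by field_simp
  rw [e]
  have h1 : ν / κ ^ 5 ≤ ν / κ ^ 2 :=
    div_le_div_of_nonneg_left hn.le (by positivity) (pow_le_pow_right₀ (by linarith) (by norm_num))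
  have h2 : 0 < ν / κ ^ 2 := by positivity
  linarith

/-- Since `m_k ≤ m_j ≤ T`, the ratio `X / ρ^k` is at most `T²`; so the factor `T⁻²` from mixing
outweighs the inverse radius and leaves an error proportional to `√(ρ^k)`. -/
lemma mixingError_le {k : ℕ} (hkj : k ≤ j) :
    (dx : ℝ) * du / p.r k * ((1 - 1 / κ ^ 2) ^ (p.τ - 1) * (8 * a * κ ^ 8 * W ^ 2 + ν))
      ≤ 1 / 6 * (ν / κ ^ 2) * √(ρ ^ k) := by
  have ha := h.a_pos
  have hk := h.kappa_ge
  have hW := t.W_pos h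
  have hσ := h.sigma_pos
  have hρ := t.rho_pos h
  have hX := t.root_pos h
  have hX1 := t.one_le_root h
  have hr₀ := t.r_zero_pos h
  have hdx : (0 : ℝ) < dx := by linarith [t.one_le_dx]
  have hdu : (0 : ℝ) < du := by linarith [t.one_le_du]
  have hL := t.one_le_sqrt_L
  have hT1 : (1 : ℝ) ≤ T := by nlinarith [t.T_ge' h hj]
  have hT := (t.inv_sq_le_m h k).trans
    (show (p.m k : ℝ) ≤ T by exact_mod_cast (t.m_mono h hkj).trans hj)
  have hs0 : 0 < √(ρ ^ k) := Real.sqrt_pos.mpr (by positivity)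
  have hs1 := t.sqrt_pow_le_one h k
  have hrX := t.r_zero_mul_root h
  have hmix := t.mixing_mul_le h hj (le_refl (p.τ - 1))
  rw [t.r_eq h]
  generalize √(ρ ^ k) = s at *
  refine (mul_le_mul_of_nonneg_left hmix (by positivity)).trans ?_
  have h1 : X / s ^ 2 ≤ T ^ 2 := by
    have h2 : X / s ^ 2 ≤ (X / s ^ 2) ^ 2 := by
      refine le_self_pow₀ ?_ (by norm_num)
      rw [le_div_iff₀ (by positivity)]
      nlinarith [pow_le_one₀ (n := 2) hs0.le hs1]
    nlinarith
  have e1 : (dx : ℝ) * du / (r₀ * s) * (a * κ ^ 6 * W ^ 2 / (4 * T ^ 2))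
      = dx * du * a * κ ^ 6 * W ^ 2 / (4 * r₀ * s * T ^ 2) := by
    field_simp
  rw [e1]
  have h2 : 4 * (r₀ * X) / s ≤ 4 * r₀ * s * T ^ 2 := by
    refine le_trans (le_of_eq ?_) (mul_le_mul_of_nonneg_left h1
      (show 0 ≤ 4 * r₀ * s by positivity))
    field_simp
  refine (div_le_div_of_nonneg_left (by positivity) (by positivity) h2).trans ?_
  rw [hrX, ← h.kappa_eq]
  have e2 : dx * du * a * κ ^ 6 * W ^ 2
      / (4 * (2 ^ 17 / 448 * (dx * du) * κ ^ 10 * W ^ 2 * √L / σ ^ 2) / s)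
      = 448 / 2 ^ 19 * (a * σ ^ 2 / κ ^ 4) * s / √L := by
    field_simp
    norm_num
  rw [e2]
  have e3 : a * κ ^ 2 * σ ^ 2 / κ ^ 2 = a * σ ^ 2 / κ ^ 4 * κ ^ 4 := by field_simp
  rw [e3]
  refine (div_le_self (by positivity) hL).trans (mul_le_mul_of_nonneg_right ?_ hs0.le)
  have h7 : (1 : ℝ) ≤ κ ^ 4 := one_le_pow₀ (by linarith)
  have h8 : a * σ ^ 2 / κ ^ 4 * 1 ≤ a * σ ^ 2 / κ ^ 4 * κ ^ 4 :=
    mul_le_mul_of_nonneg_left h7 (by positivity)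
  have h9 : 0 < a * σ ^ 2 / κ ^ 4 := by positivity
  linarith

/-- The tuning keeps the controllers good. -/
lemma tuned : Tuned dx du p a ψ ν κ W L ρ j where
  eta_eq := by
    have := h.nu_pos
    have := h.psi_pos
    have := h.kappa_pos
    rw [t.eta_eq]
    field_simp
  rho_eq := by rw [t.rho_eq]; ring
  rho_pos := t.rho_pos h
  r_pos k := by
    have := t.rho_pos h
    rw [t.r_eq h]
    exact mul_pos (t.r_zero_pos h) (Real.sqrt_pos.mpr (by positivity))
  r_le k := by
    have ha := h.a_pos
    have hp := h.psi_ge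
    have hk := h.kappa_ge
    rw [t.r_eq h]
    refine (mul_le_of_le_one_right (t.r_zero_pos h).le (t.sqrt_pow_le_one h k)).trans
      ((t.r_zero_le h).trans ?_)
    have hsa : a ≤ √a := Real.le_sqrt_of_sq_le (by nlinarith [h.a_le])
    refine div_le_div₀ (Real.sqrt_nonneg a) hsa (by positivity) ?_
    have h1 : ψ * κ ^ 3 ≤ ψ ^ 2 * κ ^ 10 :=
      mul_le_mul (le_self_pow₀ hp (by norm_num)) (pow_le_pow_right₀ (by linarith) (by norm_num))
        (by positivity) (by positivity)
    have h2 : 0 < ψ * κ ^ 3 := by positivity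
    linarith
  m_pos := t.m_pos h
  rate := by
    have hk := h.kappa_ge
    have hT := t.T_ge' h hj
    have hT0 : (0 : ℝ) < T := by nlinarith
    refine (t.rate_le h hj).trans ?_
    rw [div_le_div_iff₀ (by positivity) (by positivity)]
    nlinarith
  L_nonneg := by linarith [t.L_ge]
  W_pos := t.W_pos h
  error_le k hk := by
    -- The three shares of the error budget are `1/4 + 1/4 + 1/6 = 2/3`.
    have h1 := t.noiseError_le h k
    have h2 := t.biasError_le h k
    have h3 := t.mixingError_le h hj hk
    rw [gradError]
    linarith

/-- The bound on the excess cost of an epoch, in terms of the parameters. -/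
lemma excess_bound_le {ℓ : ℝ} (hℓ : 1 ≤ ℓ) (hLℓ : L ≤ 5 * ℓ) :
    p.m j * excessMean a ψ ν κ W (p.r j) p.τ
        + 26 * a * κ ^ 8 * W ^ 2 * p.τ * √(2 * p.m j * L) + 16 * a * κ ^ 8 * W ^ 2
      ≤ 110 * (ν * κ ^ 8 * W ^ 2 / σ ^ 2 * p.τ * √(p.m j * ℓ)
        + dx * ν * ψ ^ 2 * κ ^ 10 / a * p.m j * p.r j ^ 2) := by
  have ha := h.a_pos
  have hk := h.kappa_ge
  have hp := h.psi_pos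
  have hn := h.nu_pos
  have hW := t.W_pos h
  have hσ := h.sigma_pos
  have hτ : (1 : ℝ) ≤ p.τ := by exact_mod_cast t.tau_pos h hj
  have hm : (1 : ℝ) ≤ p.m j := by exact_mod_cast t.m_pos h j
  have hmT : (p.m j : ℝ) ≤ T := by exact_mod_cast hj
  have hT1 : (1 : ℝ) ≤ T := hm.trans hmT
  have hdx := t.one_le_dx
  have hmix := t.mixing_mul_le h hj (Nat.sub_le p.τ 1)
  have hE : a * κ ^ 8 * W ^ 2 ≤ ν * κ ^ 8 * W ^ 2 / σ ^ 2 := by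
    rw [← h.kappa_eq, le_div_iff₀ (by positivity)]
    have h1 : (1 : ℝ) ≤ κ ^ 2 := one_le_pow₀ (by linarith)
    have h2 := mul_le_mul_of_nonneg_left h1 (show 0 ≤ a * κ ^ 8 * W ^ 2 * σ ^ 2 by positivity)
    linarith
  have hE0 : 0 < a * κ ^ 8 * W ^ 2 := by positivity
  generalize ν * κ ^ 8 * W ^ 2 / σ ^ 2 = E at hE ⊢
  have hsq : 1 ≤ √(p.m j * ℓ) := Real.one_le_sqrt.mpr (one_le_mul_of_one_le_of_one_le hm hℓ)
  -- From `L ≤ 5 ℓ` and `10 ≤ (16 / 5)²`.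
  have hsqrt : √(2 * p.m j * L) ≤ 16 / 5 * √(p.m j * ℓ) := by
    have h1 : 2 * p.m j * L ≤ (16 / 5) ^ 2 * (p.m j * ℓ) := by
      have := mul_le_mul_of_nonneg_left hLℓ (show 0 ≤ 2 * (p.m j : ℝ) by positivity)
      nlinarith [show 0 < (p.m j : ℝ) * ℓ by positivity]
    refine (Real.sqrt_le_sqrt h1).trans (le_of_eq ?_)
    rw [Real.sqrt_mul (by positivity), Real.sqrt_sq (by norm_num)]
  generalize √(p.m j * ℓ) = q at hsq hsqrt ⊢
  have hEq : E ≤ E * p.τ * q := by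
    rw [mul_assoc]
    exact le_mul_of_one_le_right (by linarith) (one_le_mul_of_one_le_of_one_le hτ hsq)
  have h1 : 26 * a * κ ^ 8 * W ^ 2 * p.τ * √(2 * p.m j * L) ≤ 26 * (16 / 5) * (E * p.τ * q) := by
    have h2 : a * κ ^ 8 * W ^ 2 * p.τ * √(2 * p.m j * L) ≤ E * p.τ * (16 / 5 * q) :=
      mul_le_mul (mul_le_mul_of_nonneg_right hE (by positivity)) hsqrt (Real.sqrt_nonneg _)
        (by have := hE0.trans_le hE; positivity)
    linarith
  have h2 : p.m j * (2 * κ ^ 2 * ((1 - 1 / κ ^ 2) ^ p.τ * (8 * a * κ ^ 8 * W ^ 2 + ν))) ≤ E := by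
    have h3 : p.m j * (2 * κ ^ 2 * ((1 - 1 / κ ^ 2) ^ p.τ * (8 * a * κ ^ 8 * W ^ 2 + ν)))
        ≤ T * (2 * κ ^ 2 * (a * κ ^ 6 * W ^ 2 / (4 * T ^ 2))) := by
      refine mul_le_mul hmT (mul_le_mul_of_nonneg_left hmix (by positivity)) ?_ (by positivity)
      have := h.mixing_nonneg
      positivity
    have e : T * (2 * κ ^ 2 * (a * κ ^ 6 * W ^ 2 / (4 * T ^ 2))) = a * κ ^ 8 * W ^ 2 / (2 * T) := by
      field_simp
      norm_num
    rw [e] at h3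
    exact h3.trans ((div_le_self hE0.le (by linarith)).trans hE)
  have h3 : p.m j * (20 * ψ ^ 2 * κ ^ 7 * (ν / a) * p.r j ^ 2)
      ≤ 20 * (dx * ν * ψ ^ 2 * κ ^ 10 / a * p.m j * p.r j ^ 2) := by
    have h4 : 1 * κ ^ 7 ≤ dx * κ ^ 10 := mul_le_mul hdx
      (pow_le_pow_right₀ (by linarith) (by norm_num)) (by positivity) (by linarith)
    have h5 := mul_le_mul_of_nonneg_left h4
      (show 0 ≤ 20 * (ψ ^ 2 * (ν / a) * p.m j * p.r j ^ 2) by positivity)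
    refine le_trans (le_of_eq (by ring)) (h5.trans (le_of_eq (by ring)))
  have h4 : 0 ≤ dx * ν * ψ ^ 2 * κ ^ 10 / a * p.m j * p.r j ^ 2 := by positivity
  -- The coefficients add up to `26 · 16/5 + 16 + 1 ≤ 110` for the fluctuation, boundary and mixing
  -- terms, and `20 ≤ 110` for the exploration term.
  rw [excessMean]
  linarith

end IsTuning
end Tuning

/-! ### From the hypotheses of the theorem to the standing assumptions -/

section StandingAssumptions

variable {dx du : ℕ}

/-- Cauchy–Schwarz in the form `Q` for `x` and `Q⁻¹ x`: `(xᵀx)² ≤ (xᵀQx)(xᵀQ⁻¹x)`. -/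
lemma quad_ge_of_norm_inv_le {n : ℕ} {Q : Matrix (Fin n) (Fin n) ℝ} {a : ℝ} (ha : 0 < a)
    (hQ : Q.PosDef) (hinv : ‖Q⁻¹‖ ≤ 1 / a) (x : Fin n → ℝ) : a * (x ⬝ᵥ x) ≤ x ⬝ᵥ Q *ᵥ x := by
  have hdet : IsUnit Q.det := (Matrix.isUnit_iff_isUnit_det Q).mp hQ.isUnit
  have h1 : Q *ᵥ (Q⁻¹ *ᵥ x) = x := by
    rw [Matrix.mulVec_mulVec, Matrix.mul_nonsing_inv _ hdet, Matrix.one_mulVec]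
  have h2 := posSemidef_cauchy_schwarz hQ.posSemidef x (Q⁻¹ *ᵥ x)
  rw [h1, dotProduct_comm (Q⁻¹ *ᵥ x) x] at h2
  have h3 : x ⬝ᵥ Q⁻¹ *ᵥ x ≤ 1 / a * (x ⬝ᵥ x) := ((le_abs_self _).trans (abs_quad_le _ x)).trans
    (mul_le_mul_of_nonneg_right hinv (dot_self_nonneg x))
  have h0 := dot_self_nonneg x
  have hq := posSemidef_quad_nonneg hQ.posSemidef x
  have h4 : (x ⬝ᵥ x) ^ 2 ≤ (x ⬝ᵥ Q *ᵥ x) * (1 / a * (x ⬝ᵥ x)) := by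
    have h5 : x ⬝ᵥ x ≤ √(x ⬝ᵥ Q *ᵥ x) * √(1 / a * (x ⬝ᵥ x)) :=
      h2.trans (mul_le_mul_of_nonneg_left (Real.sqrt_le_sqrt h3) (Real.sqrt_nonneg _))
    calc (x ⬝ᵥ x) ^ 2 ≤ (√(x ⬝ᵥ Q *ᵥ x) * √(1 / a * (x ⬝ᵥ x))) ^ 2 := pow_le_pow_left₀ h0 h5 2
      _ = _ := by rw [mul_pow, Real.sq_sqrt hq, Real.sq_sqrt (by positivity)]
  rcases h0.eq_or_lt with h6 | h6
  · rw [← h6, mul_zero]; exact hq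
  · have h7 : (x ⬝ᵥ x) * (a * (x ⬝ᵥ x)) ≤ (x ⬝ᵥ x) * (x ⬝ᵥ Q *ᵥ x) := by
      have := mul_le_mul_of_nonneg_left h4 ha.le
      have e : a * ((x ⬝ᵥ Q *ᵥ x) * (1 / a * (x ⬝ᵥ x))) = (x ⬝ᵥ x) * (x ⬝ᵥ Q *ᵥ x) := by
        field_simp
      rw [e] at this
      linarith
    exact le_of_mul_le_mul_left h7 h6

lemma quad_le_of_one_sub_posSemidef {n : ℕ} {Q : Matrix (Fin n) (Fin n) ℝ}
    (hQ : (1 - Q).PosSemidef) (x : Fin n → ℝ) : x ⬝ᵥ Q *ᵥ x ≤ x ⬝ᵥ x := by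
  have := posSemidef_quad_nonneg hQ x
  rw [Matrix.sub_mulVec, Matrix.one_mulVec, dotProduct_sub] at this
  linarith

variable {Ω : Type*} [MeasurableSpace Ω] {P : Measure Ω}
  {w : ℕ → Ω → Fin dx → ℝ} {σ W : ℝ}

lemma IsNoise.noiseCov_ge (hw : IsNoise P w σ W) (x : Fin dx → ℝ) :
    σ ^ 2 * (x ⬝ᵥ x) ≤ x ⬝ᵥ noiseCov P w *ᵥ x := by
  have h := posSemidef_quad_nonneg hw.cov.posSemidef x
  rw [Matrix.sub_mulVec, dotProduct_sub, Matrix.smul_mulVec, Matrix.one_mulVec, dotProduct_smul,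
    smul_eq_mul] at h
  have e : noiseCov P w = Matrix.of (fun a b => ∫ ω, w 0 ω a * w 0 ω b ∂P) := rfl
  rw [e]
  linarith

lemma IsNoise.noiseCov_psd (hw : IsNoise P w σ W) : (noiseCov P w).PosSemidef := by
  refine posSemidef_of_quad ?_ fun x => le_trans ?_ (hw.noiseCov_ge x)
  · ext a b
    simp [noiseCov, mul_comm]
  · have := dot_self_nonneg x
    positivity

/-- One diagonal entry of the noise covariance is at least `σ²`, and its trace, the mean of `‖w‖²`,
is at most `W²`. -/
lemma IsNoise.sigma_le [IsProbabilityMeasure P] [NeZero dx] (hw : IsNoise P w σ W) : σ ≤ W := by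
  have h1 := hw.noiseCov_ge (Pi.single 0 1)
  have h2 := quad_le_trace hw.noiseCov_psd (Pi.single (0 : Fin dx) 1)
  have e : (Pi.single (0 : Fin dx) (1 : ℝ) : Fin dx → ℝ) ⬝ᵥ Pi.single 0 1 = 1 := by simp
  rw [e, mul_one] at h1 h2
  obtain ⟨hi, h3⟩ := hw.integral_quad 0 (1 : Matrix (Fin dx) (Fin dx) ℝ)
  simp only [Matrix.one_mulVec, one_mul] at h3 hi
  have h4 : ∫ ω, w 0 ω ⬝ᵥ w 0 ω ∂P ≤ W ^ 2 := by
    have := integral_mono_ae hi (integrable_const (W ^ 2)) (by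
      filter_upwards [hw.dot_self_le] with ω hω using hω 0)
    simpa using this
  exact le_of_sq_le_sq (by linarith) hw.W_nonneg

variable {S : System dx du} {a ψ ν κ : ℝ}

/-- The standing assumptions, from those of the theorem. -/
lemma bounds_of_assumptions [IsProbabilityMeasure P] [NeZero dx] (hw : IsNoise P w σ W) (ha : 0 < a)
    (hψ : 1 ≤ ψ) (hν : 0 < ν) (hσ : 0 < σ) (hQ : S.Q.PosDef) (hQ1 : (1 - S.Q).PosSemidef)
    (hR : S.R.PosDef) (hR1 : (1 - S.R).PosSemidef) (hQi : ‖S.Q⁻¹‖ ≤ 1 / a)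
    (hB : ‖S.B‖ ≤ ψ) {K₀ : Controller dx du}
    (hK₀ : S.J P w K₀ ≤ ENNReal.ofReal (ν / 4)) :
    S.Bounds (noiseCov P w) a ψ ν σ (kappa a ν σ) ∧ S.Fine (noiseCov P w) (ν / 4) K₀ := by
  have hQge := quad_ge_of_norm_inv_le ha hQ hQi
  have e : (Pi.single (0 : Fin dx) (1 : ℝ) : Fin dx → ℝ) ⬝ᵥ Pi.single 0 1 = 1 := by simp
  have ha1 : a ≤ 1 := by
    have h1 := (hQge (Pi.single 0 1)).trans (quad_le_of_one_sub_posSemidef hQ1 _)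
    rwa [e, mul_one] at h1
  -- `Bounds` includes `κ ≥ 2`, that is `ν ≥ 4 a σ²`, which is known only after `K₀` has been shown
  -- stable. The structure is therefore first built with an enlarged `ν'`; being `Fine` at level `ν
  -- / 4` does not involve `ν'` or `κ`.
  have mk : ∀ ν' : ℝ, 0 < ν' → 4 * (a * σ ^ 2) ≤ ν' →
      S.Bounds (noiseCov P w) a ψ ν' σ (kappa a ν' σ) := fun ν' hν' h4 =>
    { a_pos := ha
      a_le := ha1
      psi_ge := hψ
      nu_pos := hν'
      sigma_pos := hσ
      kappa_ge := by
        refine Real.le_sqrt_of_sq_le ?_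
        rw [le_div_iff₀ (by positivity)]
        linarith
      kappa_eq := by
        rw [kappa, Real.sq_sqrt (by positivity)]
        field_simp
      Q_psd := hQ.posSemidef
      R_psd := hR.posSemidef
      Q_ge := hQge
      R_le := quad_le_of_one_sub_posSemidef hR1
      B_le := hB
      V_psd := hw.noiseCov_psd
      V_ge := hw.noiseCov_ge }
  have h' := mk (max ν (4 * (a * σ ^ 2))) (lt_max_of_lt_left hν) (le_max_right _ _)
  have hfine := hw.fine_of_J_le h' (by positivity) hK₀
  refine ⟨mk ν hν ?_, hfine⟩
  -- `a ≤ tr P_{K₀}`, while `σ² tr P_{K₀}` is at most the cost of `K₀`, hence at most `ν / 4`;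
  -- together `4 a σ² ≤ ν`.
  have h1 := h'.value_ge hfine.1 (Pi.single 0 1)
  have h2 := quad_le_trace (h'.value_psd hfine.1) (Pi.single (0 : Fin dx) 1)
  have h3 := trace_mul_ge (h'.value_psd hfine.1) h'.V_ge
  rw [e, mul_one] at h1 h2
  rw [Matrix.trace_mul_comm] at h3
  have h4 : (S.value K₀ * noiseCov P w).trace ≤ ν / 4 := hfine.2
  have h5 : σ ^ 2 * a ≤ σ ^ 2 * (S.value K₀).trace :=
    mul_le_mul_of_nonneg_left (h1.trans h2) (sq_nonneg σ)
  linarith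

lemma isTuning_tuning {δ : ℝ} {T : ℕ} (hdx : 0 < dx) (hdu : 0 < du) (hσ : σ ≤ W) (hδ : 0 < δ)
    (hδ1 : δ < 1) (hT : 1 ≤ T) :
    IsTuning dx du (tuning dx du a ψ ν σ W δ T) a ψ ν σ (kappa a ν σ) W
      (Real.log (240 * T ^ 4 / δ)) (decay a ν σ (a / (128 * ν * ψ ^ 2 * kappa a ν σ ^ 10)))
      (a / (448 * √dx * ψ ^ 2 * kappa a ν σ ^ 10))
      (2 ^ 17 * du * (dx * √dx) * ψ ^ 2 * kappa a ν σ ^ 20 * W ^ 2 / (a * σ ^ 2)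
        * √(Real.log (240 * T ^ 4 / δ))) T where
  eta_eq := rfl
  rho_eq := rfl
  r_zero_eq := rfl
  r_rpow _ := rfl
  root_eq := rfl
  m_eq k := by
    have e : (dx : ℝ) ^ (3 / 2 : ℝ) = dx * √dx := by
      have h0 : (0 : ℝ) < dx := by exact_mod_cast hdx
      rw [show (3 / 2 : ℝ) = 1 + 1 / 2 by norm_num, Real.rpow_add h0, Real.rpow_one,
        Real.sqrt_eq_rpow]
    simp only [tuning, e]
    congr 2
    rw [neg_mul, zpow_neg]
    norm_cast
  tau_eq := rfl
  L_ge := by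
    have hT' : (1 : ℝ) ≤ T := by exact_mod_cast hT
    have h1 : (240 : ℝ) ≤ 240 * T ^ 4 / δ := by
      rw [le_div_iff₀ hδ]
      nlinarith [one_le_pow₀ (n := 4) hT']
    rw [Real.le_log_iff_exp_le (by linarith)]
    linarith [Real.exp_one_lt_d9]
  W_ge := hσ
  dx_pos := hdx
  du_pos := hdu

end StandingAssumptions

/-! ### The union bound -/

section Main

variable {dx du : ℕ} {S : System dx du} {a ψ ν σ κ W L ρ : ℝ} {p : AlgParams}
  {K₀ : Controller dx du} {Ω : Type*} [mΩ : MeasurableSpace Ω] {P : Measure Ω}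
  [IsProbabilityMeasure P] {w : ℕ → Ω → Fin dx → ℝ} {G : ℕ → ℕ → Ω → Controller dx du}

/-- With high probability, all sub-epochs of epoch `j` start well and the compensated excess cost of
the epoch is small. -/
lemma measure_good_ge [NeZero dx] [NeZero du] (hw : IsNoise P w σ W)
    (hG : IsGaussianExploration P G)
    (hI : IndepFun (fun ω t => w t ω)
      (fun ω (q : ℕ × ℕ × Fin du × Fin dx) => G q.1 q.2.1 ω q.2.2.1 q.2.2.2) P)
    (h : S.Bounds (noiseCov P w) a ψ ν σ κ) {j : ℕ} (ht : Tuned dx du p a ψ ν κ W L ρ j)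
    (hK₀ : S.Fine (noiseCov P w) (ν / 4) K₀) (hσ : σ ≤ W) (hτ : 1 ≤ p.τ) :
    1 - ENNReal.ofReal ((j + 1) * Real.exp (-L)) ≤
      P {ω | (∀ i, runState S p K₀ w G j i ω ∈ goodStart S (noiseCov P w) ν κ W) ∧
        ω ∉ badExcess S p K₀ P w G a ψ ν κ W L j} := by
  set A := {ω | (∀ i, runState S p K₀ w G j i ω ∈ goodStart S (noiseCov P w) ν κ W) ∧
        ω ∉ badExcess S p K₀ P w G a ψ ν κ W L j}
  -- Failure requires noise outside its bound (a null event), a bad gradient estimate in some epoch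
  -- before `j`, or a bad excess in epoch `j`.
  have hsub : Aᶜ ⊆ {ω | ¬ ∀ t, w t ω ⬝ᵥ w t ω ≤ W ^ 2} ∪
      ((⋃ k ∈ Finset.range j, badEpoch S p K₀ P w G a ν κ W L k) ∪
        badExcess S p K₀ P w G a ψ ν κ W L j) := by
    intro ω hω
    by_contra hc
    simp only [Set.mem_union, Set.mem_ofPred_eq, Set.mem_iUnion, not_or, not_not, Finset.mem_range,
      not_exists] at hc
    obtain ⟨h1, h2, h3⟩ := hc
    refine hω ⟨fun i => runState_mem_goodStart h ht h1 ?_ i, h3⟩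
    exact runState_zero_mem_goodStart hw hG hI h ht hK₀ h1 h2 le_rfl
  have hcompl : P Aᶜ ≤ ENNReal.ofReal ((j + 1) * Real.exp (-L)) := by
    refine (measure_mono hsub).trans ((measure_union_le _ _).trans ?_)
    have h0 : P {ω | ¬ ∀ t, w t ω ⬝ᵥ w t ω ≤ W ^ 2} = 0 := ae_iff.mp hw.dot_self_le
    rw [h0, zero_add]
    refine (measure_union_le _ _).trans ?_
    have h1 : P (⋃ k ∈ Finset.range j, badEpoch S p K₀ P w G a ν κ W L k)
        ≤ j * ENNReal.ofReal (Real.exp (-L)) := by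
      refine (measure_biUnion_finset_le _ _).trans
        ((Finset.sum_le_sum fun k _ => measure_badEpoch_le hw hG hI h ht k).trans ?_)
      simp
    refine (add_le_add h1 (measure_badExcess_le hw hG hI h ht hσ hτ)).trans (le_of_eq ?_)
    rw [ENNReal.ofReal_mul (by positivity), ENNReal.ofReal_add (by positivity) zero_le_one]
    simp [add_mul]
  rw [tsub_le_iff_right]
  calc (1 : ℝ≥0∞) = P (A ∪ Aᶜ) := by rw [Set.union_compl_self, measure_univ]
    _ ≤ P A + P Aᶜ := measure_union_le _ _
    _ ≤ _ := add_le_add le_rfl hcompl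

end Main

/-! ### Translation to the quantities in the statement -/

section Plays

variable {dx du : ℕ} {S : System dx du} {p : AlgParams} {K₀ : Controller dx du} {Ω : Type*}
  {w : ℕ → Ω → Fin dx → ℝ} {G : ℕ → ℕ → Ω → Controller dx du}

lemma playedController_eq (j i : ℕ) (ω : Ω) :
    playedController S p K₀ (fun t => w t ω) (fun j i => G j i ω) j i
      = perturb (p.r j) (runState S p K₀ w G j i ω).1 (runBlock p w G j i ω).2 := rfl

lemma realizedCost_eq (j i : ℕ) {s : ℕ} (hs : s ≤ p.τ) (ω : Ω) :
    realizedCost S p K₀ (fun t => w t ω) (fun j i => G j i ω) j i s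
      = blockCost S (p.r j) (runState S p K₀ w G j i ω) (runBlock p w G j i ω) s :=
  subCost_eq S p K₀ w G j i hs ω

end Plays

end LQR

end

theorem lemma4 :
    ∃ C : ℝ, 0 < C ∧
    ∀ (dx du : ℕ) (_ : 0 < dx) (_ : 0 < du)
      (S : LQR.System dx du) (α₀ ψ ν σ W : ℝ)
      (_ : 0 < α₀) (_ : 1 ≤ ψ) (_ : 0 < ν) (_ : 0 < σ) (_ : 0 < W)
      (_ : S.Q.PosDef) (_ : (1 - S.Q).PosSemidef)
      (_ : S.R.PosDef) (_ : (1 - S.R).PosSemidef)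
      (_ : ‖S.Q⁻¹‖ ≤ 1 / α₀) (_ : ‖S.R⁻¹‖ ≤ 1 / α₀) (_ : ‖S.B‖ ≤ ψ)
      {Ω : Type*} [MeasurableSpace Ω] (P : Measure Ω) [IsProbabilityMeasure P]
      (w : ℕ → Ω → Fin dx → ℝ) (_ : LQR.IsNoise P w σ W)
      (G : ℕ → ℕ → Ω → LQR.Controller dx du) (_ : LQR.IsGaussianExploration P G)
      (_ : IndepFun (fun ω t => w t ω)
        (fun ω (q : ℕ × ℕ × Fin du × Fin dx) => G q.1 q.2.1 ω q.2.2.1 q.2.2.2) P)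
      (K₀ : LQR.Controller dx du) (_ : S.J P w K₀ ≤ ENNReal.ofReal (ν / 4))
      (T : ℕ) (_ : 1 ≤ T) (δ : ℝ) (_ : 0 < δ) (_ : δ < 1)
      (κ : ℝ) (_ : κ = LQR.kappa α₀ ν σ)
      (p : LQR.AlgParams) (_ : p = LQR.tuning dx du α₀ ψ ν σ W δ T)
      (j : ℕ) (_ : p.m j ≤ T)
      (K : ℕ → Ω → LQR.Controller dx du)
      (_ : K = fun i ω =>
        LQR.playedController S p K₀ (fun t => w t ω) (fun j i => G j i ω) j i)
      (c : ℕ → ℕ → Ω → ℝ)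
      (_ : c = fun i s ω =>
        LQR.realizedCost S p K₀ (fun t => w t ω) (fun j i => G j i ω) j i s),
      1 - ENNReal.ofReal (δ / (4 * T)) ≤
        P {ω | (∀ i ∈ Finset.range (p.m j), S.J P w (K i ω) < ∞) ∧
          ∑ i ∈ Finset.range (p.m j), ∑ s ∈ Finset.range p.τ,
              (c i s ω - (S.J P w (K i ω)).toReal)
            ≤ C * (ν * κ ^ 8 * W ^ 2 / σ ^ 2 * p.τ * √(p.m j * Real.log (T / δ))
              + dx * ν * ψ ^ 2 * κ ^ 10 / α₀ * p.m j * p.r j ^ 2)} := by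
  refine ⟨110, by norm_num, ?_⟩
  intro dx du hdx hdu S a ψ ν σ W ha hψ hν hσ hW hQ hQ1 hR hR1 hQi _ hB Ω _ P _ w hw G hG hI K₀
    hK₀ T hT δ hδ hδ1 κ hκ p hp j hj K hK c hc
  have : NeZero dx := ⟨hdx.ne'⟩
  have : NeZero du := ⟨hdu.ne'⟩
  obtain ⟨h, hfine⟩ := LQR.bounds_of_assumptions hw ha hψ hν hσ hQ hQ1 hR hR1 hQi hB hK₀
  have t := LQR.isTuning_tuning (a := a) (ψ := ψ) (ν := ν) hdx hdu hw.sigma_le hδ hδ1 hT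
  rw [← hκ] at h
  rw [← hp, ← hκ] at t
  have hT' : (1 : ℝ) ≤ T := by exact_mod_cast hT
  have ht := t.tuned h hj
  have hT3 : 3 ≤ (T : ℝ) := by
    have h1 := t.T_ge' h hj
    have h2 := h.kappa_ge
    linarith
  have hTδ : (T : ℝ) ≤ T / δ := le_div_self (by linarith) hδ hδ1.le
  have hℓ : 1 ≤ Real.log (T / δ) := by
    rw [Real.le_log_iff_exp_le (by linarith)]
    linarith [Real.exp_one_lt_d9]
  have hT240 : (240 : ℝ) ≤ T := by
    have h1 := t.T_ge' h hj
    have h2 := h.kappa_ge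
    linarith
  -- `240 T⁴ / δ ≤ (T / δ)⁵`, because `T ≥ 240` and `δ < 1`.
  have hLℓ : Real.log (240 * T ^ 4 / δ) ≤ 5 * Real.log (T / δ) := by
    have e : (5 : ℝ) * Real.log (T / δ) = Real.log ((T / δ) ^ 5) := by
      rw [Real.log_pow]; norm_num
    rw [e]
    refine Real.log_le_log (by positivity) ?_
    rw [div_pow, div_le_div_iff₀ hδ (by positivity)]
    have h1 : 240 * (T : ℝ) ^ 4 ≤ T ^ 5 := by
      have := mul_le_mul_of_nonneg_right hT240 (show 0 ≤ (T : ℝ) ^ 4 by positivity)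
      linarith [pow_succ' (T : ℝ) 4]
    have h2 : δ ^ 5 ≤ δ := pow_le_of_le_one hδ.le hδ1.le (by norm_num)
    exact mul_le_mul h1 h2 (by positivity) (by positivity)
  -- Each bad event has probability at most `δ / (240 T⁴)`, and `j ≤ T` leaves ample room for all `j
  -- + 1` of them.
  have hprob : ((j : ℝ) + 1) * Real.exp (-Real.log (240 * T ^ 4 / δ)) ≤ δ / (4 * T) := by
    rw [Real.exp_neg, Real.exp_log (by positivity), inv_div, ← mul_div_assoc,
      div_le_div_iff₀ (by positivity) (by positivity)]
    have h1 := t.epoch_le_T h hj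
    have h2 : ((j : ℝ) + 1) * T ≤ 2 * T ^ 4 := by
      have h3 : ((j : ℝ) + 1) * T ≤ (2 * T) * T :=
        mul_le_mul_of_nonneg_right (by linarith) (by linarith)
      have h4 : (T : ℝ) ^ 2 ≤ T ^ 4 := pow_le_pow_right₀ hT' (by norm_num)
      nlinarith
    have h5 := mul_le_mul_of_nonneg_left h2 hδ.le
    have h6 : 0 ≤ δ * (T : ℝ) ^ 4 := by positivity
    linarith
  refine (tsub_le_tsub_left (ENNReal.ofReal_le_ofReal hprob) 1).trans
    ((LQR.measure_good_ge hw hG hI h ht hfine hw.sigma_le (t.tau_pos h hj)).trans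
      (MeasureTheory.measure_mono ?_))
  rintro ω ⟨hz, hbad⟩
  have hfineK : ∀ i, S.Fine (LQR.noiseCov P w) ν (K i ω) := fun i => by
    rw [hK]
    exact h.fine_perturb (ht.r_pos j).le (ht.r_le j) (hz i) _
  have hJ : ∀ i, S.J P w (K i ω) = ENNReal.ofReal (S.avgCost (LQR.noiseCov P w) (K i ω)) :=
    fun i => hw.J_eq_avgCost h (hfineK i).1
  refine ⟨fun i _ => by rw [hJ]; exact ENNReal.ofReal_lt_top, ?_⟩
  refine le_trans (le_of_eq ?_) ((LQR.sum_excess_le h ht hz hbad).trans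
    (t.excess_bound_le h hj hℓ hLℓ))
  refine Finset.sum_congr rfl fun i _ => Finset.sum_congr rfl fun s hs => ?_
  rw [hJ, ENNReal.toReal_ofReal (h.avgCost_nonneg (hfineK i).1), hc, hK]
  simp only [LQR.realizedCost_eq j i (Finset.mem_range.mp hs).le, LQR.playedController_eq]
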